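/- **Conventions.** Graphs are finite, have labelled vertices and labelled edges, and may have parallel edges but no loops. A graph is *2-connected* if it has at least three vertices, is connected, and remains connected after the deletion of any single vertex. An *embedding* of a graph is an embedding in the oriented sphere, described by its rotators (the cyclic orders of the half-edges around the vertices, satisfying Euler's formula). The embedding *induced* on a subgraph is obtained by restricting the rotators. The *size* of a sequence of graphs is the total number of vertices and edges of its members. A *weak deletion sequence* is a sequence $(G_1,\dots,G_n)$ of graphs such that, for each $i<n$, one of $G_i,G_{i+1}$ is isomorphic to a subgraph of the other. A *weak simultaneous embedding* of it is a sequence $(\varphi_1,\dots,\varphi_n)$ of embeddings of the $G_i$ such that, for each $i<n$, whenever one of $G_i,G_{i+1}$ is isomorphic to a subgraph of the other, its embedding is, up to isomorphism, the one induced by the embedding of the other graph on some subgraph. For a set $A$ of edges of $H$, an isomorphism from $H$ to a subgraph of $G$ is *$A$-fixing* if it is the identity on the edge labels in $A$; $H$ is a *hybrid subgraph of $G$ with respect to $A$* if such an isomorphism exists. A *hybrid deletion sequence* is a sequence $(G_1,\dots,G_n)$ of graphs together with a set $S$ of *strict* edge labels such that, for each $i<n$, $G_i$ is a hybrid subgraph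 of $G_{i+1}$ with respect to $E(G_i)\cap S$, or $G_{i+1}$ is a hybrid subgraph of $G_i$ with respect to $E(G_{i+1})\cap S$. A *hybrid simultaneous embedding* of it is a sequence $(\varphi_1,\dots,\varphi_n)$ of embeddings of the $G_i$ such that, for each $i<n$: if $G_i$ is a hybrid subgraph of $G_{i+1}$ with respect to $E(G_i)\cap S$, then $\varphi_i$ is, up to an $(E(G_i)\cap S)$-fixing isomorphism, the embedding induced by $\varphi_{i+1}$ on some subgraph of $G_{i+1}$; otherwise $\varphi_{i+1}$ is, up to an $(E(G_{i+1})\cap S)$-fixing isomorphism, the embedding induced by $\varphi_i$ on some subgraph of $G_i$. A *gadget* is a graph with two distinct distinguished vertices, its terminals. *Replacing* an edge $e$ by a gadget means deleting $e$ and adding a disjoint copy of the gadget whose terminals are identified with the two ends of $e$. **Lemma.** There are a polynomial $p$ and, for every $N\in\mathbb N$, planar gadgets $Q^N_*$ and $Q^N_0,\dots,Q^N_{N-1}$, where for $k\neq l$ the graph $Q^N_k$ is not isomorphic to a subgraph of $Q^N_l$, such that the following holds. Let $\mathcal G=(G_1,\dots,G_n)$ be a hybrid deletion sequence of 2-connected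 graphs with strict labels $S$, let $N$ be its size, and let the strict labels that occur in $\mathcal G$ be numbered injectively by numbers $c(e)<N$. Then there is a weak deletion sequence $\mathcal G'=(G_1',\dots,G_n')$ of simple 2-connected graphs, where $G_i'$ is obtained from $G_i$ by replacing each strict edge $e$ by a copy of $Q^N_{c(e)}$ and each non-strict edge by a copy of $Q^N_*$, such that $\mathcal G$ admits a hybrid simultaneous embedding if and only if $\mathcal G'$ admits a weak simultaneous embedding, and $\operatorname{size}(\mathcal G')\le p(\operatorname{size}(\mathcal G))$. -/

import Mathlib

namespace Graph

/-- A graph is finite if it has finitely many vertices and finitely many edges. -/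
def IsFinite {α β : Type*} (G : Graph α β) : Prop :=
  G.vertexSet.Finite ∧ G.edgeSet.Finite

/-- Any two vertices are joined by a walk, and there is at least one vertex. -/
def IsConnected {α β : Type*} (G : Graph α β) : Prop :=
  G.vertexSet.Nonempty ∧
    ∀ x ∈ G.vertexSet, ∀ y ∈ G.vertexSet, Relation.ReflTransGen G.Adj x y

/-- A graph (parallel edges allowed, loops not) is 2-connected if it has at least three vertices
and it is connected and stays so after the deletion of any single vertex. -/
structure IsTwoConnected {α β : Type*} (G : Graph α β) : Prop where
  loopless : G.Loopless
  three_le : 3 ≤ G.vertexSet.encard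
  connected : G.IsConnected
  connected_deleteVerts : ∀ v ∈ G.vertexSet, (G.deleteVerts {v}).IsConnected

/-- The half-edges `(v, e)` of a loopless graph: `e` is an edge incident with the vertex `v`. -/
abbrev Flag {α β : Type*} (G : Graph α β) : Type _ :=
  {p : α × β // G.Inc p.2 p.1}

/-- One step of face tracing for a rotation of the half-edges: traverse the edge of `f`
to its other half-edge `h`, then move on to the successor of `h` at its vertex. -/
def FaceStep {α β : Type*} (G : Graph α β) (rot : Equiv.Perm G.Flag) (f g : G.Flag) : Prop :=
  ∃ h : G.Flag, h.1.2 = f.1.2 ∧ G.IsLink f.1.2 f.1.1 h.1.1 ∧ rot h = g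

/-- An embedding of a finite loopless graph in the oriented sphere, given combinatorially: a cyclic
order of the half-edges at each vertex (a rotator), such that Euler's formula holds.
The faces are the orbits of face tracing; a vertex without edges counts as one face
of its component, so that Euler's formula reads `V - E + F = 2 c` with `c` components. -/
structure PlanarEmbedding {α β : Type*} (G : Graph α β) where
  rot : Equiv.Perm G.Flag
  rot_vertex : ∀ f : G.Flag, (rot f).1.1 = f.1.1
  rot_cyclic : ∀ f g : G.Flag, f.1.1 = g.1.1 → rot.SameCycle f g
  euler : G.vertexSet.ncard +
      (Nat.card (Quot (G.FaceStep rot)) + {v ∈ G.vertexSet | ∀ e, ¬ G.Inc e v}.ncard) =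
    G.edgeSet.ncard + 2 * Nat.card (Quot fun x y : G.vertexSet => G.Adj x y)

/-- A planar graph: one that has an embedding in the sphere. -/
def IsPlanar {α β : Type*} (G : Graph α β) : Prop := Nonempty G.PlanarEmbedding

/-- An isomorphism from `H` to a subgraph of `G` (the subgraph is the image). -/
structure SubIso {α β α' β' : Type*} (H : Graph α β) (G : Graph α' β') where
  toV : H.vertexSet → G.vertexSet
  toE : H.edgeSet → G.edgeSet
  toV_injective : Function.Injective toV
  toE_injective : Function.Injective toE
  isLink : ∀ (e : H.edgeSet) (x y : H.vertexSet),
    H.IsLink e x y → G.IsLink (toE e) (toV x) (toV y)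

/-- The action of an isomorphism onto a subgraph on half-edges. -/
def SubIso.flag {α β α' β' : Type*} {H : Graph α β} {G : Graph α' β'} (θ : SubIso H G)
    (f : H.Flag) : G.Flag :=
  ⟨(θ.toV ⟨f.1.1, f.2.vertex_mem⟩, θ.toE ⟨f.1.2, f.2.edge_mem⟩), by
    obtain ⟨y, hy⟩ := f.2
    exact ⟨_, θ.isLink ⟨f.1.2, hy.edge_mem⟩ ⟨f.1.1, hy.left_mem⟩ ⟨y, hy.right_mem⟩ hy⟩⟩

/-- `θ` is the identity on the labels of the edges in `A`. (Incidences between these edges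
are preserved by any isomorphism.) -/
def SubIso.Fixes {α α' β : Type*} {H : Graph α β} {G : Graph α' β} (θ : SubIso H G)
    (A : Set β) : Prop :=
  ∀ e : H.edgeSet, (e : β) ∈ A → (θ.toE e : β) = e

/-- `φ` is, via the isomorphism `θ`, the embedding that `ψ` induces on the image of `θ`:
the successor of a half-edge `f` under `φ` is the first half-edge of the image of `θ` that follows
`f` in the cyclic order of `ψ`. -/
def SubIso.Induces {α β α' β' : Type*} {H : Graph α β} {G : Graph α' β'} (θ : SubIso H G)
    (ψ : G.PlanarEmbedding) (φ : H.PlanarEmbedding) : Prop :=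
  ∀ f : H.Flag, ∃ k : ℕ, 0 < k ∧ (ψ.rot ^ k) (θ.flag f) = θ.flag (φ.rot f) ∧
    ∀ j : ℕ, 0 < j → j < k → (ψ.rot ^ j) (θ.flag f) ∉ Set.range θ.flag

/-- The total number of vertices and edges of a sequence of finite graphs. -/
noncomputable def seqSize {α β : Type*} {n : ℕ} (G : Fin n → Graph α β) : ℕ :=
  ∑ i, ((G i).vertexSet.ncard + (G i).edgeSet.ncard)

/-! ### Weak deletion sequences -/

/-- `H` is isomorphic to a subgraph of `G`. -/
def IsWeakSubgraph {α β α' β' : Type*} (H : Graph α β) (G : Graph α' β') : Prop :=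
  Nonempty (SubIso H G)

def IsWeakDeletionSequence {α β : Type*} {n : ℕ} (G : Fin n → Graph α β) : Prop :=
  ∀ i j : Fin n, (j : ℕ) = i + 1 →
    IsWeakSubgraph (G i) (G j) ∨ IsWeakSubgraph (G j) (G i)

/-- Whenever one of two consecutive graphs is isomorphic to a subgraph of the other, the embedding
of the larger one induces, up to isomorphism, that of the smaller one. -/
def IsWeakSimultaneousEmbedding {α β : Type*} {n : ℕ} (G : Fin n → Graph α β)
    (φ : ∀ i, (G i).PlanarEmbedding) : Prop :=
  ∀ i j : Fin n, (j : ℕ) = i + 1 →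
    (IsWeakSubgraph (G i) (G j) → ∃ θ : SubIso (G i) (G j), θ.Induces (φ j) (φ i)) ∧
    (IsWeakSubgraph (G j) (G i) → ∃ θ : SubIso (G j) (G i), θ.Induces (φ i) (φ j))

/-! ### Hybrid deletion sequences -/

/-- `H` is a hybrid subgraph of `G` with respect to a set `A` of edges of `H`: it arises from a
subgraph of `G` by relabelling vertices and relabelling edges outside of `A`. -/
def IsHybridSubgraph {α β : Type*} (A : Set β) (H G : Graph α β) : Prop :=
  A ⊆ H.edgeSet ∧ ∃ θ : SubIso H G, θ.Fixes A

/-- A hybrid deletion sequence with set `S` of strict edge labels: an edge label is strict in all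
hybrid subgraph relations of the sequence or in none. -/
def IsHybridDeletionSequence {α β : Type*} {n : ℕ} (S : Set β) (G : Fin n → Graph α β) : Prop :=
  ∀ i j : Fin n, (j : ℕ) = i + 1 →
    IsHybridSubgraph ((G i).edgeSet ∩ S) (G i) (G j) ∨
    IsHybridSubgraph ((G j).edgeSet ∩ S) (G j) (G i)

def IsHybridSimultaneousEmbedding {α β : Type*} {n : ℕ} (S : Set β) (G : Fin n → Graph α β)
    (φ : ∀ i, (G i).PlanarEmbedding) : Prop :=
  ∀ i j : Fin n, (j : ℕ) = i + 1 →
    (IsHybridSubgraph ((G i).edgeSet ∩ S) (G i) (G j) →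
      ∃ θ : SubIso (G i) (G j), θ.Fixes ((G i).edgeSet ∩ S) ∧ θ.Induces (φ j) (φ i)) ∧
    (¬ IsHybridSubgraph ((G i).edgeSet ∩ S) (G i) (G j) →
      ∃ θ : SubIso (G j) (G i), θ.Fixes ((G j).edgeSet ∩ S) ∧ θ.Induces (φ i) (φ j))

/-! ### Replacing edges by gadgets -/

/-- A gadget: a finite graph with two distinct terminals. -/
structure Gadget where
  graph : Graph ℕ ℕ
  finite : graph.IsFinite
  s : ℕ
  t : ℕ
  s_mem : s ∈ graph.vertexSet
  t_mem : t ∈ graph.vertexSet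
  s_ne_t : s ≠ t

/-- A choice of the order in which the two ends of each edge are listed. -/
structure EndOrder {α β : Type*} (G : Graph α β) where
  tail : β → α
  head : β → α
  isLink : ∀ e ∈ G.edgeSet, G.IsLink e (tail e) (head e)

/-- Where the vertex `x` of the copy of `Q` replacing `e` goes: the terminals are identified with
the ends of `e`, all other vertices are new. -/
def EndOrder.place {α β : Type*} {G : Graph α β} (o : G.EndOrder) (Q : Gadget) (e : β) (x : ℕ) :
    α ⊕ (β × ℕ) :=
  if x = Q.s then Sum.inl (o.tail e) else if x = Q.t then Sum.inl (o.head e) else Sum.inr (e, x)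

/-- The graph obtained from `G` by replacing each edge `e` by its own copy of the gadget `Q e`,
the terminals being identified with the ends of `e`. -/
def replaceEdges {α β : Type*} (G : Graph α β) (o : G.EndOrder) (Q : β → Gadget) :
    Graph (α ⊕ (β × ℕ)) (β × ℕ) where
  vertexSet := Sum.inl '' G.vertexSet ∪
    {v | ∃ e ∈ G.edgeSet, ∃ x ∈ (Q e).graph.vertexSet, v = o.place (Q e) e x}
  IsLink p v w := p.1 ∈ G.edgeSet ∧ ∃ x y, (Q p.1).graph.IsLink p.2 x y ∧
    v = o.place (Q p.1) p.1 x ∧ w = o.place (Q p.1) p.1 y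
  isLink_symm := by
    intro p _
    refine ⟨?_⟩
    rintro v w ⟨hp, x, y, h, hv, hw⟩
    exact ⟨hp, y, x, h.symm, hw, hv⟩
  eq_or_eq_of_isLink_of_isLink := by
    rintro p v w v' w' ⟨_, x, y, h, rfl, rfl⟩ ⟨_, x', y', h', rfl, rfl⟩
    rcases h.left_eq_or_eq h' with rfl | rfl
    · exact Or.inl rfl
    · exact Or.inr rfl
  left_mem_of_isLink := by
    rintro p v w ⟨hp, x, y, h, rfl, rfl⟩
    exact Or.inr ⟨p.1, hp, x, h.left_mem, rfl⟩

/-- `G'` is obtained from `G` by replacing each edge `e` by a copy of the gadget `Q e`. -/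
def IsGadgetReplacement {α β : Type*} (Q : β → Gadget) (G : Graph α β)
    (G' : Graph (α ⊕ (β × ℕ)) (β × ℕ)) : Prop :=
  ∃ o : G.EndOrder, G' = G.replaceEdges o Q

open Classical in
/-- The assignment of gadgets to edge labels: all non-strict labels get the gadget `Q₀`, and a
strict label `e` with number `c e` gets the gadget `Q (c e)`. -/
noncomputable def gadgetOf {β : Type*} (S : Set β) (c : β → ℕ) (Q₀ : Gadget) (Q : ℕ → Gadget)
    (e : β) : Gadget :=
  if e ∈ S then Q (c e) else Q₀

end Graph

/-! Weak subgraph relations forget labels, so the label of a strict edge has to be readable from the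
shape of its gadget. A gadget has two hubs joined by `m` paths, of which the first `b` and the last
`b` have length three and the others length two, and a pendant edge from each hub to a terminal.
Non-strict edges get `m = N + 2`, `b = 0`; the strict edge with number `k` gets `m = 5 * N + 2 + k`,
`b = 2 * (N - k)`. Along the strict family the hub degree `m + 1` increases with `k`, while `m + b =
7 * N + 2 - k`, which determines the number of edges, decreases. So no strict gadget lies in another
one. Since `m - 2 * b = N + 2 + 5 * k`, the short paths in the middle of every strict gadget leave
room for a non-strict gadget. This is needed because a non-strict edge may be mapped to any edge.

Isomorphisms: a hub has degree at least `N + 3`, more than an original vertex or an inner vertex of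
a path can have, so hubs go to hubs. Two hubs of one gadget have two common neighbours, hubs of
different gadgets at most one, so gadgets go to gadgets. By 2-connectedness, original vertices then
go to original vertices. Hence a weak relation between the new graphs descends to the old ones
(`exists_descent`), and the two monotone parameters force it to fix strict labels
(`SubIso.exists_fixes_descent`). Conversely, a hybrid relation extends over the gadgets
(`SubIso.lift`).

Embeddings: the gadget has a standard embedding, invariant under the half-turn that exchanges the
hubs and reverses the order of the paths; this is why long paths sit at both ends of that order.
Inserting standard gadgets lifts an embedding (`exists_lift`), compatibly with extended isomorphisms
(`lift_induces`). In the other direction the rotators at the original vertices already give an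
embedding, however the gadgets are embedded (`exists_restriction`). Euler's formula is transferred
without counting faces: by `euler_iff_bounding`, for a connected graph with an edge at every vertex
it says that every cycle modulo 2 is a sum of face boundaries, a condition that can be checked
gadget by gadget. -/

namespace Graph

/-! ### A homological criterion modulo 2 for Euler's formula -/

/-- `f` and `h` are the two half-edges of one edge. -/
def Opp {α β : Type*} {G : Graph α β} (f h : G.Flag) : Prop :=
  h.1.2 = f.1.2 ∧ G.IsLink f.1.2 f.1.1 h.1.1

/-- Every cycle modulo 2 is the sum of the boundaries of some faces: `q` is the indicator function
of these faces on half-edges. -/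
def Bounding {α β : Type*} (G : Graph α β) (rot : Equiv.Perm G.Flag) : Prop :=
  ∀ z : β → ZMod 2, (∀ v ∈ G.vertexSet, ∑ᶠ e ∈ {e | G.Inc e v}, z e = 0) →
    ∃ q : G.Flag → ZMod 2, ∀ f h : G.Flag, Opp f h → q f + q h = z f.1.2 ∧ q (rot h) = q f

section Criterion

variable {α β : Type*} {G : Graph α β}

theorem Opp.symm {f h : G.Flag} (hf : Opp f h) : Opp h f :=
  ⟨hf.1.symm, hf.1 ▸ hf.2.symm⟩

theorem exists_opp (f : G.Flag) : ∃ h : G.Flag, Opp f h := by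
  obtain ⟨y, hy⟩ := f.2
  exact ⟨⟨(y, f.1.2), ⟨_, hy.symm⟩⟩, rfl, hy⟩

theorem faceStep_iff {rot : Equiv.Perm G.Flag} {f g : G.Flag} :
    G.FaceStep rot f g ↔ ∃ h, Opp f h ∧ rot h = g := by
  simp only [FaceStep, Opp, and_assoc]

theorem IsFinite.finite_flag (hG : G.IsFinite) : Finite G.Flag := by
  refine Set.Finite.subset (hG.1.prod hG.2) ?_
  rintro ⟨v, e⟩ (h : G.Inc e v)
  exact ⟨h.vertex_mem, h.edge_mem⟩

theorem IsConnected.eq_of_adj {γ : Type*} (hc : G.IsConnected) (p : G.vertexSet → γ)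
    (hp : ∀ x y : G.vertexSet, G.Adj x y → p x = p y) (x y : G.vertexSet) : p x = p y := by
  have key : ∀ y, Relation.ReflTransGen G.Adj x y → ∀ hy : y ∈ G.vertexSet, p x = p ⟨y, hy⟩ := by
    intro y h
    induction h with
    | refl => intro _; rfl
    | tail _ hb ih => exact fun hy => (ih hb.left_mem).trans (hp ⟨_, hb.left_mem⟩ ⟨_, hy⟩ hb)
  exact key y (hc.2 x x.2 y y.2) y.2

theorem sum_ends {M : Type*} [AddCommMonoid M] [Fintype G.vertexSet] (hl : G.Loopless) {e : β}
    {x y : G.vertexSet} (h : G.IsLink e x y) (p : G.vertexSet → M)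
    [DecidablePred fun v : G.vertexSet => G.Inc e v] :
    (∑ v : G.vertexSet, if G.Inc e v then p v else 0) = p x + p y := by
  classical
  have hne : x ≠ y := fun hxy => hl.not_isLoopAt e x (by rw [← hxy] at h; exact h)
  rw [← Finset.sum_filter, ← Finset.sum_pair hne]
  congr 1
  ext v
  simp only [Finset.mem_filter, Finset.mem_univ, true_and, Finset.mem_insert,
    Finset.mem_singleton]
  constructor
  · intro hv
    exact (hv.eq_or_eq_of_isLink h).imp Subtype.ext Subtype.ext
  · rintro (rfl | rfl)
    exacts [h.inc_left, h.inc_right]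

theorem sum_flags_edge {M : Type*} [AddCommMonoid M] [Fintype G.Flag] (hl : G.Loopless)
    {f h : G.Flag} (hf : Opp f h) (q : G.Flag → M) [DecidablePred fun g : G.Flag => g.1.2 = f.1.2] :
    (∑ g : G.Flag, if g.1.2 = f.1.2 then q g else 0) = q f + q h := by
  classical
  have hne : f ≠ h := fun hfh => hl.not_isLoopAt f.1.2 f.1.1 (by have := hf.2; rwa [← hfh] at this)
  rw [← Finset.sum_filter, ← Finset.sum_pair hne]
  congr 1
  ext ⟨⟨v, e⟩, hv⟩
  simp only [Finset.mem_filter, Finset.mem_univ, true_and, Finset.mem_insert,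
    Finset.mem_singleton]
  constructor
  · rintro rfl
    rcases hv.eq_or_eq_of_isLink hf.2 with h1 | h1
    · exact Or.inl (Subtype.ext (Prod.ext h1 rfl))
    · exact Or.inr (Subtype.ext (Prod.ext h1 hf.1.symm))
  · rintro (h1 | h1)
    · exact congrArg (fun g : G.Flag => g.1.2) h1
    · exact (congrArg (fun g : G.Flag => g.1.2) h1).trans hf.1

theorem finsum_inc {M : Type*} [AddCommMonoid M] [Fintype G.edgeSet] (z : β → M) (v : α)
    [DecidablePred fun e : G.edgeSet => G.Inc e v] :
    ∑ᶠ e ∈ {e | G.Inc e v}, z e = ∑ e : G.edgeSet, if G.Inc e v then z e else 0 := by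
  classical
  have : {e | G.Inc e v} = ((((Finset.univ.filter fun e : G.edgeSet => G.Inc e v).map
      ⟨Subtype.val, Subtype.val_injective⟩ : Finset β)) : Set β) := by
    ext e
    simp only [Set.mem_ofPred_eq, Finset.coe_map, Function.Embedding.coeFn_mk, Set.mem_image,
      Finset.mem_coe, Finset.mem_filter, Finset.mem_univ, true_and, Subtype.exists,
      exists_and_left, exists_prop, exists_eq_right_right]
    exact ⟨fun h => ⟨h, h.edge_mem⟩, fun h => h.1⟩
  rw [this, finsum_mem_coe_finset, Finset.sum_map, Finset.sum_filter]
  rfl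

theorem sum_inc_eq_sum_flags {M : Type*} [AddCommMonoid M] [Fintype G.edgeSet] [Fintype G.Flag]
    (z : β → M) (v : α) [DecidablePred fun e : G.edgeSet => G.Inc e v] [DecidableEq α] :
    (∑ e : G.edgeSet, if G.Inc e v then z e else 0) =
      ∑ f : G.Flag, if f.1.1 = v then z f.1.2 else 0 := by
  classical
  rw [← Finset.sum_filter, ← Finset.sum_filter]
  symm
  refine Finset.sum_bij (fun f _ => ⟨f.1.2, f.2.edge_mem⟩) ?_ ?_ ?_ ?_
  · rintro ⟨⟨w, e⟩, hf⟩ h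
    simp only [Finset.mem_filter, Finset.mem_univ, true_and] at h ⊢
    exact h ▸ hf
  · rintro ⟨⟨w, e⟩, hf⟩ h ⟨⟨w', e'⟩, hf'⟩ h' hh
    simp only [Finset.mem_filter, Finset.mem_univ, true_and, Subtype.mk.injEq] at h h' hh ⊢
    rw [h, h', hh]
  · intro e he
    simp only [Finset.mem_filter, Finset.mem_univ, true_and] at he
    exact ⟨⟨(v, e), he⟩, by simp, rfl⟩
  · intros; rfl


/-- Connectedness makes the constants the whole kernel, both of the coboundary on vertices and of
the boundary on faces. This accounts for the two units in Euler's formula. -/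
theorem finrank_ker_of_forall_eq {ι κ : Type*} [Fintype ι] [Nonempty ι] [AddCommGroup κ]
    [Module (ZMod 2) κ] (T : (ι → ZMod 2) →ₗ[ZMod 2] κ)
    (h : ∀ p, T p = 0 ↔ ∀ x y, p x = p y) : Module.finrank (ZMod 2) (LinearMap.ker T) = 1 := by
  have : LinearMap.ker T = Submodule.span (ZMod 2) {fun _ => 1} := by
    ext p
    rw [LinearMap.mem_ker, h, Submodule.mem_span_singleton]
    constructor
    · intro hp
      exact ⟨p (Classical.arbitrary ι), funext fun x => by simp [hp x (Classical.arbitrary ι)]⟩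
    · rintro ⟨a, rfl⟩ x y
      rfl
  rw [this]
  refine finrank_span_singleton fun h0 => ?_
  have := congrFun h0 (Classical.arbitrary ι)
  simp at this

/-- The cycle space has dimension `E - V + 1` and the space of face boundaries has dimension `F -
1`. The second is always contained in the first, so they coincide exactly when `V + F = E + 2`. -/
theorem euler_iff_bounding (hG : G.IsFinite) (hl : G.Loopless) (hc : G.IsConnected)
    (hinc : ∀ v ∈ G.vertexSet, ∃ e, G.Inc e v) (rot : Equiv.Perm G.Flag)
    (rot_vertex : ∀ f : G.Flag, (rot f).1.1 = f.1.1)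
    (rot_cyclic : ∀ f g : G.Flag, f.1.1 = g.1.1 → rot.SameCycle f g) :
    (G.vertexSet.ncard +
      (Nat.card (Quot (G.FaceStep rot)) + {v ∈ G.vertexSet | ∀ e, ¬ G.Inc e v}.ncard) =
    G.edgeSet.ncard + 2 * Nat.card (Quot fun x y : G.vertexSet => G.Adj x y)) ↔
      G.Bounding rot := by
  classical
  have := hG.finite_flag
  have : Finite G.vertexSet := hG.1
  have : Finite G.edgeSet := hG.2
  have := Fintype.ofFinite G.vertexSet
  have := Fintype.ofFinite G.edgeSet
  have := Fintype.ofFinite G.Flag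
  have : Fintype (Quot (G.FaceStep rot)) := Fintype.ofFinite _
  have : Nonempty G.vertexSet := hc.1.to_subtype
  obtain ⟨v₀, hv₀⟩ := hc.1
  obtain ⟨e₀, he₀⟩ := hinc v₀ hv₀
  have : Nonempty (Quot (G.FaceStep rot)) := ⟨Quot.mk _ ⟨(v₀, e₀), he₀⟩⟩
  have hiso : {v ∈ G.vertexSet | ∀ e, ¬ G.Inc e v}.ncard = 0 := by
    rw [Set.ncard_eq_zero (hG.1.subset fun _ h => h.1)]
    ext v
    simp only [Set.mem_sep_iff, Set.mem_empty_iff_false, iff_false, not_and, not_forall, not_not]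
    exact hinc v
  have hcomp : Nat.card (Quot fun x y : G.vertexSet => G.Adj x y) = 1 := by
    rw [Nat.card_eq_one_iff_unique]
    refine ⟨⟨fun a b => ?_⟩, ⟨Quot.mk _ ⟨v₀, hv₀⟩⟩⟩
    induction a using Quot.ind with
    | mk x => induction b using Quot.ind with
      | mk y => exact hc.eq_of_adj (Quot.mk _) (fun _ _ h => Quot.sound h) x y
  have hstep : ∀ (q : Quot (G.FaceStep rot) → ZMod 2) (f h : G.Flag), Opp f h →
      q (Quot.mk _ (rot h)) = q (Quot.mk _ f) := fun q f h hf =>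
    congrArg q (Quot.sound (faceStep_iff.2 ⟨h, hf, rfl⟩)).symm
  let A : Matrix G.vertexSet G.edgeSet (ZMod 2) :=
    Matrix.of fun v e => if G.Inc e v then 1 else 0
  have hA : ∀ (z : G.edgeSet → ZMod 2) v,
      A.mulVecLin z v = ∑ e : G.edgeSet, if G.Inc e v then z e else 0 := by
    intro z v
    simp [A, Matrix.mulVec, dotProduct]
  have hAt : ∀ (p : G.vertexSet → ZMod 2) (e : G.edgeSet),
      A.transpose.mulVecLin p e = ∑ v : G.vertexSet, if G.Inc e v then p v else 0 := by
    intro p e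
    simp [A, Matrix.vecMul, dotProduct]
  have hrank : A.rank + 1 = Fintype.card G.vertexSet := by
    rw [← Matrix.rank_transpose, Matrix.rank,
      ← finrank_ker_of_forall_eq A.transpose.mulVecLin, LinearMap.finrank_range_add_finrank_ker,
      Module.finrank_fintype_fun_eq_card]
    intro p
    constructor
    · intro hp
      refine hc.eq_of_adj p ?_
      rintro x y ⟨e, he⟩
      have := congrFun hp ⟨e, he.edge_mem⟩
      rw [hAt, sum_ends hl he] at this
      exact CharTwo.add_eq_zero.1 this
    · intro hp
      funext e
      obtain ⟨x, y, he⟩ := exists_isLink_of_mem_edgeSet e.2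
      rw [hAt, sum_ends hl (x := ⟨x, he.left_mem⟩) (y := ⟨y, he.right_mem⟩) he,
        hp _ ⟨y, he.right_mem⟩, CharTwo.add_self_eq_zero]
      rfl
  have hker : A.rank + Module.finrank (ZMod 2) (LinearMap.ker A.mulVecLin) =
      Fintype.card G.edgeSet := by
    rw [Matrix.rank, LinearMap.finrank_range_add_finrank_ker, Module.finrank_fintype_fun_eq_card]
  let B : (Quot (G.FaceStep rot) → ZMod 2) →ₗ[ZMod 2] (G.edgeSet → ZMod 2) :=
    { toFun := fun q e => ∑ f : G.Flag, if f.1.2 = e then q (Quot.mk _ f) else 0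
      map_add' := by
        intro q q'
        funext e
        simp only [Pi.add_apply, ← Finset.sum_add_distrib]
        refine Finset.sum_congr rfl fun f _ => ?_
        split_ifs <;> simp
      map_smul' := by
        intro a q
        funext e
        simp only [Pi.smul_apply, smul_eq_mul, Finset.mul_sum, RingHom.id_apply]
        refine Finset.sum_congr rfl fun f _ => ?_
        split_ifs <;> simp }
  have hB : ∀ q (f h : G.Flag), Opp f h →
      B q ⟨f.1.2, f.2.edge_mem⟩ = q (Quot.mk _ f) + q (Quot.mk _ h) := fun q f h hf =>
    sum_flags_edge hl hf fun g => q (Quot.mk _ g)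
  have hrankB : Module.finrank (ZMod 2) (LinearMap.range B) + 1 =
      Fintype.card (Quot (G.FaceStep rot)) := by
    rw [← finrank_ker_of_forall_eq B, LinearMap.finrank_range_add_finrank_ker,
      Module.finrank_fintype_fun_eq_card]
    intro q
    constructor
    · intro hq
      -- If a face function has zero boundary, it does not change across an edge. Face tracing then
      -- shows that it does not change on turning at a vertex either, and connectedness makes it
      -- constant.
      have hopp : ∀ f h : G.Flag, Opp f h → q (Quot.mk _ f) = q (Quot.mk _ h) := fun f h hf => by
        have := hB q f h hf
        rw [hq] at this
        exact CharTwo.add_eq_zero.1 this.symm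
      have hrot : ∀ f : G.Flag, q (Quot.mk _ (rot f)) = q (Quot.mk _ f) := fun f => by
        obtain ⟨h, hf⟩ := exists_opp f
        rw [hstep q h f hf.symm, hopp f h hf]
      have hvert : ∀ f g : G.Flag, f.1.1 = g.1.1 → q (Quot.mk _ f) = q (Quot.mk _ g) := by
        intro f g hfg
        obtain ⟨k, -, rfl⟩ := (rot_cyclic f g hfg).exists_pow_eq'
        clear hfg
        induction k with
        | zero => rfl
        | succ k ih => rw [ih, pow_succ', Equiv.Perm.mul_apply, hrot]
      choose ed hed using hinc
      let p : G.vertexSet → ZMod 2 := fun v => q (Quot.mk _ ⟨(v, ed v v.2), hed v v.2⟩)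
      have hp := hc.eq_of_adj p (by
        rintro x y ⟨e, he⟩
        have h1 := hopp ⟨(x, e), he.inc_left⟩ ⟨(y, e), he.inc_right⟩ ⟨rfl, he⟩
        exact (hvert ⟨(x, _), hed x x.2⟩ ⟨(x, e), he.inc_left⟩ rfl).trans
          (h1.trans (hvert ⟨(y, e), he.inc_right⟩ ⟨(y, _), hed y y.2⟩ rfl)))
      intro a b
      induction a using Quot.ind with
      | mk f => induction b using Quot.ind with
        | mk g =>
          exact (hvert f ⟨(f.1.1, _), hed f.1.1 f.2.vertex_mem⟩ rfl).trans
            ((hp ⟨_, f.2.vertex_mem⟩ ⟨_, g.2.vertex_mem⟩).trans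
              (hvert ⟨(g.1.1, _), hed g.1.1 g.2.vertex_mem⟩ g rfl))
    · intro hq
      funext e
      obtain ⟨x, y, he⟩ := exists_isLink_of_mem_edgeSet e.2
      have := hB q ⟨(x, e), he.inc_left⟩ ⟨(y, e), he.inc_right⟩ ⟨rfl, he⟩
      rw [hq _ (Quot.mk _ ⟨(y, e), he.inc_right⟩), CharTwo.add_self_eq_zero] at this
      exact this
  have hle : LinearMap.range B ≤ LinearMap.ker A.mulVecLin := by
    rintro _ ⟨q, rfl⟩
    rw [LinearMap.mem_ker]
    funext v
    rw [hA]
    let z : β → ZMod 2 := fun e => if he : e ∈ G.edgeSet then B q ⟨e, he⟩ else 0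
    have hz : ∀ e : G.edgeSet, B q e = z e := fun e => by simp [z]
    simp only [hz]
    rw [sum_inc_eq_sum_flags]
    -- The edge of `f` separates the face of `f` from the face of `rot f`. Summed over a vertex,
    -- each face value therefore occurs twice.
    have h1 : ∀ f : G.Flag, (if f.1.1 = (v : α) then z f.1.2 else 0) =
        (if f.1.1 = (v : α) then q (Quot.mk _ f) else 0) +
          if (rot f).1.1 = (v : α) then q (Quot.mk _ (rot f)) else 0 := by
      intro f
      rw [rot_vertex]
      split_ifs
      · obtain ⟨h, hf⟩ := exists_opp f
        rw [hstep q h f hf.symm, ← hB q f h hf, hz]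
      · simp
    rw [Finset.sum_congr rfl fun f _ => h1 f, Finset.sum_add_distrib,
      Equiv.sum_comp rot fun f : G.Flag => if f.1.1 = (v : α) then q (Quot.mk _ f) else 0,
      CharTwo.add_self_eq_zero]
    rfl
  have hbound : G.Bounding rot ↔ LinearMap.ker A.mulVecLin ≤ LinearMap.range B := by
    constructor
    · intro h z hz
      let z' : β → ZMod 2 := fun e => if he : e ∈ G.edgeSet then z ⟨e, he⟩ else 0
      have hz' : ∀ e : G.edgeSet, z e = z' e := fun e => by simp [z']
      obtain ⟨q, hq⟩ := h z' (by
        intro v hv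
        rw [finsum_inc]
        have := congrFun (LinearMap.mem_ker.1 hz) ⟨v, hv⟩
        rw [hA] at this
        simp only [hz'] at this
        exact this)
      refine ⟨Quot.lift q ?_, ?_⟩
      · intro f g hfg
        obtain ⟨h, hf, rfl⟩ := faceStep_iff.1 hfg
        exact (hq f h hf).2.symm
      · funext e
        obtain ⟨x, y, he⟩ := exists_isLink_of_mem_edgeSet e.2
        have h1 := hB (Quot.lift q (by
          intro f g hfg
          obtain ⟨h, hf, rfl⟩ := faceStep_iff.1 hfg
          exact (hq f h hf).2.symm)) ⟨(x, e), he.inc_left⟩ ⟨(y, e), he.inc_right⟩ ⟨rfl, he⟩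
        refine h1.trans ?_
        rw [hz']
        exact (hq ⟨(x, e), he.inc_left⟩ ⟨(y, e), he.inc_right⟩ ⟨rfl, he⟩).1
    · intro h z hz
      obtain ⟨q, hq⟩ := h (show (fun e : G.edgeSet => z e) ∈ LinearMap.ker A.mulVecLin by
        rw [LinearMap.mem_ker]
        funext v
        rw [hA, ← finsum_inc, hz v v.2]
        rfl)
      refine ⟨fun f => q (Quot.mk _ f), fun f h hf => ⟨?_, hstep q f h hf⟩⟩
      rw [← hB q f h hf, hq]
  rw [hbound, hiso, hcomp, ← Nat.card_coe_set_eq, ← Nat.card_coe_set_eq, Nat.card_eq_fintype_card,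
    Nat.card_eq_fintype_card, Nat.card_eq_fintype_card]
  constructor
  · intro h
    refine (Submodule.eq_of_le_of_finrank_eq hle ?_).ge
    omega
  · intro h
    have := congrArg (fun W : Submodule (ZMod 2) (G.edgeSet → ZMod 2) =>
      Module.finrank (ZMod 2) W) (hle.antisymm h)
    beta_reduce at this
    omega

end Criterion

/-! ### The gadget as a graph with rotators -/

/-- A permutation of a subtype from a function on the ambient type and its inverse. -/
def permOfRaw {X : Type*} {p : X → Prop} (r r' : X → X) (h : ∀ x, p x → p (r x) ∧ r' (r x) = x)
    (h' : ∀ x, p x → p (r' x) ∧ r (r' x) = x) : Equiv.Perm {x // p x} where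
  toFun x := ⟨r x, (h x x.2).1⟩
  invFun x := ⟨r' x, (h' x x.2).1⟩
  left_inv x := Subtype.ext (h x x.2).2
  right_inv x := Subtype.ext (h' x x.2).2

/-! ### The gadgets

The gadget with parameters `m` and `b` consists of two hubs joined by `m` paths, the first `b` and
the last `b` of which have length three and the other ones length two, and of a pendant edge from
each hub to a terminal. A pendant edge counts as the half at this hub of a path with index `0`. -/

namespace Theta

/-- The path with index `j` has two inner vertices. -/
def Long (m b j : ℕ) : Prop := j ≤ b ∨ m < j + b

instance (m b j : ℕ) : Decidable (Long m b j) := inferInstanceAs (Decidable (_ ∨ _))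

/-- The two hubs. -/
def hub (σ : Bool) : ℕ := σ.toNat

/-- The neighbour of the hub `σ` on the path `j`. -/
def node (m b : ℕ) (σ : Bool) (j : ℕ) : ℕ := 2 * (j + 1) + if Long m b j then σ.toNat else 0

/-- The edge of the path `j` at the hub `σ`. -/
def spoke (σ : Bool) (j : ℕ) : ℕ := 3 * j + σ.toNat

/-- The middle edge of a long path. -/
def cross (j : ℕ) : ℕ := 3 * j + 2

section

variable {m b i j : ℕ} {σ τ : Bool}

/-- Counting index `0` as long keeps the two terminals apart, as the two nodes of that index. No
edge joins them, since middle edges exist for positive indices only. -/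
theorem long_zero : Long m b 0 := Or.inl (Nat.zero_le b)

theorem hub_inj : hub σ = hub τ ↔ σ = τ := by cases σ <;> cases τ <;> simp [hub]

theorem node_inj : node m b σ i = node m b τ j ↔ i = j ∧ (Long m b i → σ = τ) := by
  constructor
  · intro h
    have hij : i = j := by
      have hσ := Bool.toNat_le σ
      have hτ := Bool.toNat_le τ
      unfold node at h
      split_ifs at h <;> omega
    subst hij
    refine ⟨rfl, fun hl => ?_⟩
    cases σ <;> cases τ <;> simp [node, hl] at h ⊢
  · rintro ⟨rfl, h⟩
    by_cases hl : Long m b i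
    · rw [h hl]
    · simp [node, hl]

theorem node_eq_of_not_long (h : ¬ Long m b j) : node m b σ j = node m b τ j :=
  node_inj.2 ⟨rfl, fun h' => (h h').elim⟩

theorem hub_ne_node : hub σ ≠ node m b τ j := by
  cases σ <;> simp only [hub, node, Bool.toNat_true, Bool.toNat_false] <;> omega

theorem spoke_inj : spoke σ i = spoke τ j ↔ σ = τ ∧ i = j := by
  cases σ <;> cases τ <;> simp [spoke] <;> omega

theorem cross_inj : cross i = cross j ↔ i = j := by simp [cross]

theorem spoke_ne_cross : spoke σ i ≠ cross j := by
  cases σ <;> simp only [spoke, cross, Bool.toNat_true, Bool.toNat_false] <;> omega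

end

/-- The graph of the gadget. -/
def graph (m b : ℕ) : Graph ℕ ℕ where
  vertexSet := {x | (∃ σ, x = hub σ) ∨ ∃ σ j, j ≤ m ∧ x = node m b σ j}
  IsLink n x y :=
    (∃ σ j, j ≤ m ∧ n = spoke σ j ∧
      (x = hub σ ∧ y = node m b σ j ∨ x = node m b σ j ∧ y = hub σ)) ∨
    ∃ σ j, 0 < j ∧ j ≤ m ∧ Long m b j ∧ n = cross j ∧ x = node m b σ j ∧ y = node m b (!σ) j
  isLink_symm := by
    intro n _
    refine ⟨?_⟩
    rintro x y (⟨σ, j, h, rfl, h'⟩ | ⟨σ, j, h0, h, hl, rfl, rfl, rfl⟩)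
    · exact Or.inl ⟨σ, j, h, rfl, h'.symm.imp And.symm And.symm⟩
    · exact Or.inr ⟨!σ, j, h0, h, hl, rfl, rfl, by rw [Bool.not_not]⟩
  eq_or_eq_of_isLink_of_isLink := by
    rintro n x y v w (⟨σ, j, h, rfl, h'⟩ | ⟨σ, j, h0, h, hl, rfl, rfl, rfl⟩)
      (⟨τ, i, k, hk, k'⟩ | ⟨τ, i, k0, k, kl, hk, rfl, rfl⟩)
    · obtain ⟨rfl, rfl⟩ := spoke_inj.1 hk
      rcases h' with ⟨rfl, rfl⟩ | ⟨rfl, rfl⟩ <;> rcases k' with ⟨rfl, rfl⟩ | ⟨rfl, rfl⟩ <;> simp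
    · exact (spoke_ne_cross hk).elim
    · exact (spoke_ne_cross hk.symm).elim
    · obtain rfl := cross_inj.1 hk
      cases σ <;> cases τ <;> simp
  left_mem_of_isLink := by
    rintro n x y (⟨σ, j, h, rfl, ⟨rfl, rfl⟩ | ⟨rfl, rfl⟩⟩ | ⟨σ, j, h0, h, hl, rfl, rfl, rfl⟩)
    exacts [Or.inl ⟨σ, rfl⟩, Or.inr ⟨σ, j, h, rfl⟩, Or.inr ⟨σ, j, h, rfl⟩]

section

variable {m b i j : ℕ} {σ τ : Bool}

theorem isLink_spoke (h : j ≤ m) : (graph m b).IsLink (spoke σ j) (hub σ) (node m b σ j) :=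
  Or.inl ⟨σ, j, h, rfl, Or.inl ⟨rfl, rfl⟩⟩

theorem isLink_cross (h0 : 0 < j) (h : j ≤ m) (hl : Long m b j) :
    (graph m b).IsLink (cross j) (node m b σ j) (node m b (!σ) j) :=
  Or.inr ⟨σ, j, h0, h, hl, rfl, rfl, rfl⟩

theorem hub_mem : hub σ ∈ (graph m b).vertexSet := Or.inl ⟨σ, rfl⟩

theorem node_mem (h : j ≤ m) : node m b σ j ∈ (graph m b).vertexSet := Or.inr ⟨σ, j, h, rfl⟩

theorem mem_vertexSet {x : ℕ} : x ∈ (graph m b).vertexSet ↔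
    (∃ σ, x = hub σ) ∨ ∃ σ j, j ≤ m ∧ x = node m b σ j := Iff.rfl

theorem inc_iff {n x : ℕ} : (graph m b).Inc n x ↔
    (∃ σ j, j ≤ m ∧ n = spoke σ j ∧ (x = hub σ ∨ x = node m b σ j)) ∨
    ∃ σ j, 0 < j ∧ j ≤ m ∧ Long m b j ∧ n = cross j ∧ x = node m b σ j := by
  constructor
  · rintro ⟨y, ⟨σ, j, h, rfl, ⟨rfl, rfl⟩ | ⟨rfl, rfl⟩⟩ | ⟨σ, j, h0, h, hl, rfl, rfl, rfl⟩⟩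
    exacts [Or.inl ⟨σ, j, h, rfl, Or.inl rfl⟩, Or.inl ⟨σ, j, h, rfl, Or.inr rfl⟩,
      Or.inr ⟨σ, j, h0, h, hl, rfl, rfl⟩]
  · rintro (⟨σ, j, h, rfl, rfl | rfl⟩ | ⟨σ, j, h0, h, hl, rfl, rfl⟩)
    exacts [(isLink_spoke h).inc_left, (isLink_spoke h).inc_right, (isLink_cross h0 h hl).inc_left]

theorem mem_edgeSet {n : ℕ} : n ∈ (graph m b).edgeSet ↔
    (∃ σ j, j ≤ m ∧ n = spoke σ j) ∨ ∃ j, 0 < j ∧ j ≤ m ∧ Long m b j ∧ n = cross j := by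
  constructor
  · intro hn
    obtain ⟨x, y, ⟨σ, j, h, rfl, -⟩ | ⟨σ, j, h0, h, hl, rfl, -⟩⟩ :=
      exists_isLink_of_mem_edgeSet hn
    exacts [Or.inl ⟨σ, j, h, rfl⟩, Or.inr ⟨j, h0, h, hl, rfl⟩]
  · rintro (⟨σ, j, h, rfl⟩ | ⟨j, h0, h, hl, rfl⟩)
    exacts [(isLink_spoke (b := b) h).edge_mem, (isLink_cross (σ := false) h0 h hl).edge_mem]

theorem inc_hub {n : ℕ} : (graph m b).Inc n (hub σ) ↔ ∃ j ≤ m, n = spoke σ j := by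
  rw [inc_iff]
  constructor
  · rintro (⟨τ, j, h, rfl, h' | h'⟩ | ⟨τ, j, -, -, -, -, h'⟩)
    · exact ⟨j, h, by rw [hub_inj.1 h']⟩
    · exact (hub_ne_node h').elim
    · exact (hub_ne_node h').elim
  · rintro ⟨j, h, rfl⟩
    exact Or.inl ⟨σ, j, h, rfl, Or.inl rfl⟩

theorem inc_node {n : ℕ} (hj : j ≤ m) : (graph m b).Inc n (node m b σ j) ↔
    n = spoke σ j ∨ (¬ Long m b j ∧ n = spoke (!σ) j) ∨ (0 < j ∧ Long m b j ∧ n = cross j) := by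
  rw [inc_iff]
  constructor
  · rintro (⟨τ, i, h, rfl, h' | h'⟩ | ⟨τ, i, h0, h, hl, rfl, h'⟩)
    · exact (hub_ne_node h'.symm).elim
    · obtain ⟨rfl, hσ⟩ := node_inj.1 h'
      by_cases hl : Long m b j
      · rw [hσ hl]; exact Or.inl rfl
      · cases σ <;> cases τ <;> simp [hl]
    · obtain ⟨rfl, hσ⟩ := node_inj.1 h'
      exact Or.inr (Or.inr ⟨h0, hl, rfl⟩)
  · rintro (rfl | ⟨hl, rfl⟩ | ⟨h0, hl, rfl⟩)
    exacts [Or.inl ⟨σ, j, hj, rfl, Or.inr rfl⟩,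
      Or.inl ⟨!σ, j, hj, rfl, Or.inr (node_eq_of_not_long hl)⟩, Or.inr ⟨σ, j, h0, hj, hl, rfl, rfl⟩]

/-- The half-edge at a hub. -/
def hubFlag (b : ℕ) (σ : Bool) (h : j ≤ m) : (graph m b).Flag :=
  ⟨(hub σ, spoke σ j), (isLink_spoke h).inc_left⟩

/-- The other half-edge of an edge at a hub. -/
def nodeFlag (b : ℕ) (σ : Bool) (h : j ≤ m) : (graph m b).Flag :=
  ⟨(node m b σ j, spoke σ j), (isLink_spoke h).inc_right⟩

/-- The half-edges of the middle edge of a long path. -/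
def crossFlag (σ : Bool) (h0 : 0 < j) (h : j ≤ m) (hl : Long m b j) : (graph m b).Flag :=
  ⟨(node m b σ j, cross j), (isLink_cross h0 h hl).inc_left⟩

theorem flag_cases {P : (graph m b).Flag → Prop} (h1 : ∀ σ j (h : j ≤ m), P (hubFlag b σ h))
    (h2 : ∀ σ j (h : j ≤ m), P (nodeFlag b σ h))
    (h3 : ∀ σ j (h0 : 0 < j) (h : j ≤ m) (hl : Long m b j), P (crossFlag σ h0 h hl))
    (f : (graph m b).Flag) : P f := by
  obtain ⟨⟨x, n⟩, hf⟩ := f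
  have := inc_iff.1 hf
  dsimp only at this
  rcases this with ⟨σ, j, h, rfl, rfl | rfl⟩ | ⟨σ, j, h0, h, hl, rfl, rfl⟩
  exacts [h1 σ j h, h2 σ j h, h3 σ j h0 h hl]

theorem opp_cases {P : (graph m b).Flag → (graph m b).Flag → Prop}
    (h1 : ∀ σ j (h : j ≤ m), P (hubFlag b σ h) (nodeFlag b σ h))
    (h2 : ∀ σ j (h : j ≤ m), P (nodeFlag b σ h) (hubFlag b σ h))
    (h3 : ∀ σ j (h0 : 0 < j) (h : j ≤ m) (hl : Long m b j),
      P (crossFlag σ h0 h hl) (crossFlag (!σ) h0 h hl))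
    {f g : (graph m b).Flag} (hfg : Opp f g) : P f g := by
  obtain ⟨⟨x, n⟩, hf⟩ := f
  obtain ⟨⟨y, n'⟩, hg⟩ := g
  obtain ⟨h, hl⟩ := hfg
  dsimp only at h hl
  subst h
  rcases hl with ⟨σ, j, h, rfl, ⟨rfl, rfl⟩ | ⟨rfl, rfl⟩⟩ | ⟨σ, j, h0, h, hl, rfl, rfl, rfl⟩
  exacts [h1 σ j h, h2 σ j h, h3 σ j h0 h hl]

/-- The successor of the path `j` in the cyclic order at the hub `σ`. -/
def next (m : ℕ) (σ : Bool) (j : ℕ) : ℕ :=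
  if σ then (if j = 0 then m else j - 1) else if j = m then 0 else j + 1

theorem next_le (h : j ≤ m) : next m σ j ≤ m := by
  unfold next
  split_ifs <;> omega

theorem next_not_next (h : j ≤ m) : next m (!σ) (next m σ j) = j := by
  cases σ <;> simp [next] <;> split_ifs <;> omega

/-- The rotators of the gadget on pairs of labels, with those of the hubs reversed if `ρ`. -/
def rotRaw (m b : ℕ) (ρ : Bool) (p : ℕ × ℕ) : ℕ × ℕ :=
  if p.1 < 2 then (p.1, 3 * next m (ρ ^^ (p.1 == 1)) (p.2 / 3) + p.2 % 3)
  else if p.2 / 3 = 0 then p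
  else if Long m b (p.2 / 3) then
    (p.1, 3 * (p.2 / 3) + if p.2 % 3 = 2 then p.1 % 2 else 2)
  else (p.1, 3 * (p.2 / 3) + (1 - p.2 % 3))

theorem rotRaw_hub (ρ : Bool) :
    rotRaw m b ρ (hub σ, spoke σ j) = (hub σ, spoke σ (next m (ρ ^^ σ) j)) := by
  cases σ <;> (simp [rotRaw, hub, spoke]; try (congr 1; omega))

theorem node_ge : ¬ node m b σ j < 2 := by unfold node; omega

theorem spoke_div : spoke σ j / 3 = j := by cases σ <;> (simp [spoke]; try omega)

theorem spoke_mod : spoke σ j % 3 = σ.toNat := by cases σ <;> simp [spoke]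

theorem cross_div : cross j / 3 = j := by simp [cross]; omega

theorem cross_mod : cross j % 3 = 2 := by simp [cross]

theorem node_mod (h : Long m b j) : node m b σ j % 2 = σ.toNat := by
  cases σ <;> simp [node, h]

theorem rotRaw_node_zero (ρ : Bool) :
    rotRaw m b ρ (node m b σ 0, spoke σ 0) = (node m b σ 0, spoke σ 0) := by
  simp only [rotRaw, node_ge, spoke_div, if_false, if_true]

theorem rotRaw_node_short (ρ : Bool) (h : ¬ Long m b j) :
    rotRaw m b ρ (node m b σ j, spoke σ j) = (node m b (!σ) j, spoke (!σ) j) := by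
  have h0 : j ≠ 0 := fun h0 => h (h0 ▸ long_zero)
  simp only [rotRaw, node_ge, spoke_div, spoke_mod, if_false, h, h0,
    node_eq_of_not_long (σ := σ) (τ := !σ) h]
  cases σ <;> rfl

theorem rotRaw_node_long (ρ : Bool) (h0 : 0 < j) (h : Long m b j) :
    rotRaw m b ρ (node m b σ j, spoke σ j) = (node m b σ j, cross j) := by
  have h2 : σ.toNat ≠ 2 := by cases σ <;> simp
  simp only [rotRaw, node_ge, spoke_div, spoke_mod, if_false, h, h0.ne', if_true, h2, cross]

theorem rotRaw_cross (ρ : Bool) (h0 : 0 < j) (h : Long m b j) :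
    rotRaw m b ρ (node m b σ j, cross j) = (node m b σ j, spoke σ j) := by
  simp only [rotRaw, node_ge, cross_div, cross_mod, if_false, h, h0.ne', if_true, node_mod h, spoke]

/-- Reversing the rotators of the hubs is enough to invert the rotation: all other vertices have
degree at most two, where the successor map is an involution. -/
theorem rotRaw_spec (ρ : Bool) (p : ℕ × ℕ) (hp : (graph m b).Inc p.2 p.1) :
    (graph m b).Inc (rotRaw m b ρ p).2 (rotRaw m b ρ p).1 ∧
      rotRaw m b (!ρ) (rotRaw m b ρ p) = p := by
  have := flag_cases (m := m) (b := b) (P := fun f =>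
    (graph m b).Inc (rotRaw m b ρ f.1).2 (rotRaw m b ρ f.1).1 ∧
      rotRaw m b (!ρ) (rotRaw m b ρ f.1) = f.1) ?_ ?_ ?_ ⟨p, hp⟩
  · exact this
  · intro σ j h
    simp only [hubFlag, rotRaw_hub]
    refine ⟨(isLink_spoke (next_le h)).inc_left, ?_⟩
    rw [Bool.not_xor, next_not_next h]
  · intro σ j h
    simp only [nodeFlag]
    by_cases hl : Long m b j
    · rcases j.eq_zero_or_pos with rfl | h0
      · simp only [rotRaw_node_zero, and_true]
        exact (isLink_spoke h).inc_right
      · simp only [rotRaw_node_long _ h0 hl, rotRaw_cross _ h0 hl, and_true]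
        exact (isLink_cross h0 h hl).inc_left
    · simp only [rotRaw_node_short _ hl, Bool.not_not, and_true]
      exact (isLink_spoke h).inc_right
  · intro σ j h0 h hl
    simp only [crossFlag, rotRaw_node_long _ h0 hl, rotRaw_cross _ h0 hl, and_true]
    exact (isLink_spoke h).inc_right

/-- The rotators of the gadget. -/
def rot (m b : ℕ) : Equiv.Perm (graph m b).Flag :=
  permOfRaw (rotRaw m b false) (rotRaw m b true) (fun p hp => rotRaw_spec false p hp)
    fun p hp => rotRaw_spec true p hp

theorem rot_hubFlag (h : j ≤ m) : rot m b (hubFlag b σ h) = hubFlag b σ (next_le (σ := σ) h) :=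
  Subtype.ext ((rotRaw_hub false).trans (by rw [Bool.false_xor]; rfl))

theorem rot_nodeFlag_zero (h : 0 ≤ m) : rot m b (nodeFlag b σ h) = nodeFlag b σ h :=
  Subtype.ext (rotRaw_node_zero false)

theorem rot_nodeFlag_short (h : j ≤ m) (hl : ¬ Long m b j) :
    rot m b (nodeFlag b σ h) = nodeFlag b (!σ) h :=
  Subtype.ext (rotRaw_node_short false hl)

theorem rot_nodeFlag_long (h0 : 0 < j) (h : j ≤ m) (hl : Long m b j) :
    rot m b (nodeFlag b σ h) = crossFlag σ h0 h hl :=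
  Subtype.ext (rotRaw_node_long false h0 hl)

theorem rot_crossFlag (h0 : 0 < j) (h : j ≤ m) (hl : Long m b j) :
    rot m b (crossFlag σ h0 h hl) = nodeFlag b σ h :=
  Subtype.ext (rotRaw_cross false h0 hl)

theorem rot_vertex (f : (graph m b).Flag) : (rot m b f).1.1 = f.1.1 := by
  induction f using flag_cases with
  | h1 σ j h => rw [rot_hubFlag]; rfl
  | h2 σ j h =>
    by_cases hl : Long m b j
    · rcases j.eq_zero_or_pos with rfl | h0
      · rw [rot_nodeFlag_zero]
      · rw [rot_nodeFlag_long h0 h hl]; rfl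
    · rw [rot_nodeFlag_short h hl]; exact node_eq_of_not_long hl
  | h3 σ j h0 h hl => rw [rot_crossFlag]; rfl

theorem sameCycle_hubFlag (h : j ≤ m) :
    (rot m b).SameCycle (hubFlag b σ (Nat.zero_le m)) (hubFlag b σ h) := by
  induction j with
  | zero => exact Equiv.Perm.SameCycle.refl _ _
  | succ j ih =>
    refine (ih (by omega)).trans ?_
    cases σ
    · have : hubFlag b false h = rot m b (hubFlag b false (j := j) (by omega)) := by
        rw [rot_hubFlag]
        congr 1
        simp only [next]
        simp
        omega
      rw [this, Equiv.Perm.sameCycle_apply_right]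
    · have : hubFlag b true (j := j) (by omega) = rot m b (hubFlag b true h) := by
        rw [rot_hubFlag]
        congr 1
      rw [this, Equiv.Perm.sameCycle_apply_left]

theorem sameCycle_nodeFlag {f : (graph m b).Flag} (h : j ≤ m) (hf : f.1.1 = node m b σ j) :
    (rot m b).SameCycle (nodeFlag b σ h) f := by
  induction f using flag_cases with
  | h1 τ i k => exact (hub_ne_node hf).elim
  | h2 τ i k =>
    obtain ⟨rfl, hσ⟩ := node_inj.1 hf
    by_cases hl : Long m b i
    · rw [hσ hl]
    · by_cases hστ : τ = σ
      · rw [hστ]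
      · have : τ = !σ := by cases σ <;> cases τ <;> simp_all
        rw [this, ← rot_nodeFlag_short h hl, Equiv.Perm.sameCycle_apply_right]
  | h3 τ i k0 k kl =>
    obtain ⟨rfl, hσ⟩ := node_inj.1 hf
    obtain rfl := hσ kl
    rw [← rot_nodeFlag_long k0 k kl, Equiv.Perm.sameCycle_apply_right]

theorem rot_cyclic (f g : (graph m b).Flag) (hfg : f.1.1 = g.1.1) : (rot m b).SameCycle f g := by
  have key : ∀ f : (graph m b).Flag, ∃ f₀ : (graph m b).Flag,
      ∀ g : (graph m b).Flag, g.1.1 = f.1.1 → (rot m b).SameCycle f₀ g := by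
    intro f
    rcases mem_vertexSet.1 f.2.vertex_mem with ⟨σ, hf⟩ | ⟨σ, j, h, hf⟩
    · refine ⟨hubFlag b σ (Nat.zero_le m), fun g hg => ?_⟩
      rw [hf] at hg
      induction g using flag_cases with
      | h1 τ i k =>
        obtain rfl := hub_inj.1 hg
        exact sameCycle_hubFlag k
      | h2 τ i k => exact (hub_ne_node hg.symm).elim
      | h3 τ i k0 k kl => exact (hub_ne_node hg.symm).elim
    · exact ⟨nodeFlag b σ h, fun g hg => sameCycle_nodeFlag h (hg.trans hf)⟩
  obtain ⟨f₀, h⟩ := key f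
  exact (h f rfl).symm.trans (h g hfg.symm)

end

end Theta

/-! ### Faces and planarity of the gadget -/

namespace Theta

variable {m b i j : ℕ} {σ τ : Bool}

theorem finsum_hub (z : ℕ → ZMod 2) :
    ∑ᶠ n ∈ {n | (graph m b).Inc n (hub σ)}, z n = ∑ j ∈ Finset.range (m + 1), z (spoke σ j) := by
  have : {n | (graph m b).Inc n (hub σ)} = ((Finset.range (m + 1)).image (spoke σ) : Finset ℕ) := by
    ext n
    simp only [Set.mem_ofPred_eq, inc_hub, Finset.coe_image, Set.mem_image, Finset.mem_coe,
      Finset.mem_range, Nat.lt_succ_iff, eq_comm]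
  rw [this, finsum_mem_coe_finset, Finset.sum_image]
  intro i _ j _ h
  exact (spoke_inj.1 h).2

theorem finsum_node_zero (z : ℕ → ZMod 2) :
    ∑ᶠ n ∈ {n | (graph m b).Inc n (node m b σ 0)}, z n = z (spoke σ 0) := by
  have : {n | (graph m b).Inc n (node m b σ 0)} = {spoke σ 0} := by
    ext n
    simp [inc_node (Nat.zero_le m), long_zero]
  rw [this, finsum_mem_singleton]

theorem finsum_node_short (z : ℕ → ZMod 2) (h : j ≤ m) (hl : ¬ Long m b j) :
    ∑ᶠ n ∈ {n | (graph m b).Inc n (node m b σ j)}, z n = z (spoke σ j) + z (spoke (!σ) j) := by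
  have : {n | (graph m b).Inc n (node m b σ j)} = {spoke σ j, spoke (!σ) j} := by
    ext n
    simp [inc_node h, hl]
  rw [this, finsum_mem_pair]
  exact fun h => by simp [spoke_inj] at h

theorem finsum_node_long (z : ℕ → ZMod 2) (h0 : 0 < j) (h : j ≤ m) (hl : Long m b j) :
    ∑ᶠ n ∈ {n | (graph m b).Inc n (node m b σ j)}, z n = z (spoke σ j) + z (cross j) := by
  have : {n | (graph m b).Inc n (node m b σ j)} = {spoke σ j, cross j} := by
    ext n
    simp [inc_node h, hl, h0]
  rw [this, finsum_mem_pair]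
  exact spoke_ne_cross

theorem hubFlag_val (h : j ≤ m) : (hubFlag b σ h).1 = (hub σ, spoke σ j) := rfl

theorem nodeFlag_val (h : j ≤ m) : (nodeFlag b σ h).1 = (node m b σ j, spoke σ j) := rfl

theorem crossFlag_val (h0 : 0 < j) (h : j ≤ m) (hl : Long m b j) :
    (crossFlag σ h0 h hl).1 = (node m b σ j, cross j) := rfl

/-- Whether a half-edge belongs to the face after the path of its edge, in the order of the first
hub, rather than to the face before it. -/
def faceSide (p : ℕ × ℕ) : ℕ :=
  if p.1 < 2 then p.1 else if p.2 % 3 = 2 then p.1 % 2 else 1 - p.2 % 3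

/-- The bounding criterion relative to the terminals, where `z` need not be a cycle: it may run
through the gadget from one terminal to the other. The free value `a` allows the face function to be
glued to one outside the gadget. -/
theorem exists_faces (z : ℕ → ZMod 2)
    (hz : ∀ x ∈ (graph m b).vertexSet, (∀ σ, x ≠ node m b σ 0) →
      ∑ᶠ n ∈ {n | (graph m b).Inc n x}, z n = 0) (a : ZMod 2) :
    z (spoke false 0) = z (spoke true 0) ∧ ∃ q : (graph m b).Flag → ZMod 2,
      q (nodeFlag b false (Nat.zero_le m)) = a ∧
      q (nodeFlag b true (Nat.zero_le m)) = a + z (spoke false 0) ∧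
      ∀ f h : (graph m b).Flag, Opp f h → q f + q h = z f.1.2 ∧
        ((∀ σ, h.1.1 ≠ node m b σ 0) → q (rot m b h) = q f) := by
  have hhub : ∀ σ, ∑ j ∈ Finset.range (m + 1), z (spoke σ j) = 0 := fun σ => by
    rw [← finsum_hub (b := b)]
    exact hz _ hub_mem fun τ => hub_ne_node
  have hne : ∀ j, 0 < j → ∀ σ τ, node m b σ j ≠ node m b τ 0 := fun j h0 σ τ h =>
    h0.ne' (node_inj.1 h).1
  have hlong : ∀ j, 0 < j → j ≤ m → Long m b j → ∀ σ, z (spoke σ j) = z (cross j) := by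
    intro j h0 h hl σ
    have := hz _ (node_mem (σ := σ) h) (hne j h0 σ)
    rw [finsum_node_long z h0 h hl] at this
    exact CharTwo.add_eq_zero.1 this
  have hpath' : ∀ j, 0 < j → j ≤ m → z (spoke true j) = z (spoke false j) := by
    intro j h0 h
    by_cases hl : Long m b j
    · rw [hlong j h0 h hl, hlong j h0 h hl]
    · have := hz _ (node_mem (σ := true) h) (hne j h0 true)
      rw [finsum_node_short z h hl] at this
      exact CharTwo.add_eq_zero.1 this
  -- At each hub, the pendant edge carries the sum of the values on the paths, and these values are
  -- the same at both hubs.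
  have hzero : z (spoke true 0) = z (spoke false 0) := by
    have h1 := hhub false
    have h2 := hhub true
    rw [Finset.sum_range_succ'] at h1 h2
    rw [CharTwo.add_eq_zero.1 h1.symm.symm |>.symm, CharTwo.add_eq_zero.1 h2 |>.symm]
    refine Finset.sum_congr rfl fun j hj => hpath' _ (Nat.succ_pos j) ?_
    have := Finset.mem_range.1 hj
    omega
  have hpath : ∀ σ j, j ≤ m → z (spoke σ j) = z (spoke false j) := by
    intro σ j h
    cases σ
    · rfl
    · rcases j.eq_zero_or_pos with rfl | h0
      exacts [hzero, hpath' j h0 h]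
  refine ⟨hzero.symm, ?_⟩
  -- `P j` is the value on the face just before path `j`; crossing the path adds the value of `z` on
  -- it. The pendant path `0` splits the outer face into the sides `P 0` and `P 1 = a`, and the sum
  -- at a hub closes the circle with `P (m + 1) = P 0`.
  let P : ℕ → ZMod 2 := fun j => a + z (spoke false 0) + ∑ i ∈ Finset.range j, z (spoke false i)
  have hP : ∀ j, P j + P (j + 1) = z (spoke false j) := by
    intro j
    simp only [P, Finset.sum_range_succ]
    rw [← add_assoc (a + z (spoke false 0)), ← add_assoc, CharTwo.add_self_eq_zero, zero_add]
  have hPm : P (m + 1) = P 0 := by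
    simp only [P, hhub, Finset.range_zero, Finset.sum_empty]
  have hP1 : P 1 = a := by
    simp only [P, Finset.sum_range_one, add_assoc, CharTwo.add_self_eq_zero, add_zero]
  have hP0 : P 0 = a + z (spoke false 0) := by simp [P]
  let q : (graph m b).Flag → ZMod 2 := fun f => P (f.1.2 / 3 + faceSide f.1)
  have q1 : ∀ σ j (h : j ≤ m), q (hubFlag b σ h) = P (j + σ.toNat) := by
    intro σ j h
    simp only [q, hubFlag_val, spoke_div, faceSide]
    cases σ <;> simp [hub]
  have q2 : ∀ σ j (h : j ≤ m), q (nodeFlag b σ h) = P (j + (!σ).toNat) := by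
    intro σ j h
    simp only [q, nodeFlag_val, spoke_div, faceSide, spoke_mod, node_ge, if_false]
    cases σ <;> simp
  have q3 : ∀ σ j (h0 : 0 < j) (h : j ≤ m) (hl : Long m b j),
      q (crossFlag σ h0 h hl) = P (j + σ.toNat) := by
    intro σ j h0 h hl
    simp only [q, crossFlag_val, cross_div, faceSide, cross_mod, node_ge, if_false, if_true,
      node_mod hl]
  have hPσ : ∀ σ j, P (j + Bool.toNat σ) + P (j + (!σ).toNat) = z (spoke false j) := by
    intro σ j
    cases σ
    · exact hP j
    · exact (add_comm _ _).trans (hP j)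
  refine ⟨q, (q2 _ _ _).trans hP1, (q2 _ _ _).trans hP0, ?_⟩
  intro f h hfh
  refine opp_cases (P := fun f h => q f + q h = z f.1.2 ∧
    ((∀ σ, h.1.1 ≠ node m b σ 0) → q (rot m b h) = q f)) ?_ ?_ ?_ hfh
  · intro σ j h
    refine ⟨?_, fun hn => ?_⟩
    · rw [q1, q2, hPσ, hubFlag_val, hpath σ j h]
    · rcases j.eq_zero_or_pos with rfl | h0
      · exact (hn σ rfl).elim
      by_cases hl : Long m b j
      · rw [rot_nodeFlag_long h0 h hl, q3, q1]
      · rw [rot_nodeFlag_short h hl, q2, q1, Bool.not_not]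
  · intro σ j h
    refine ⟨?_, fun _ => ?_⟩
    · rw [add_comm, q1, q2, hPσ, nodeFlag_val, hpath σ j h]
    · rw [rot_hubFlag, q1, q2]
      cases σ
      · by_cases hj : j = m
        · simp [next, hj, hPm]
        · simp [next, hj]
      · by_cases hj : j = 0
        · simp [next, hj, hPm]
        · simp [next, hj, Nat.sub_add_cancel (Nat.pos_of_ne_zero hj)]
  · intro σ j h0 h hl
    refine ⟨?_, fun _ => ?_⟩
    · rw [q3, q3, hPσ, crossFlag_val, ← hlong j h0 h hl false]
    · rw [rot_crossFlag, q2, q3, Bool.not_not]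

theorem loopless : (graph m b).Loopless where
  not_isLoopAt := by
    rintro n x (⟨σ, j, h, rfl, ⟨h1, h2⟩ | ⟨h1, h2⟩⟩ | ⟨σ, j, h0, h, hl, rfl, h1, h2⟩)
    · exact hub_ne_node (h1.symm.trans h2)
    · exact hub_ne_node (h2.symm.trans h1)
    · have := (node_inj.1 (h1.symm.trans h2)).2 hl
      simp at this

theorem isFinite : (graph m b).IsFinite := by
  constructor
  · refine (Set.finite_Iio (2 * (m + 1) + 2)).subset ?_
    rintro x (⟨σ, rfl⟩ | ⟨σ, j, h, rfl⟩) <;> have := Bool.toNat_le σ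
    · simp only [hub, Set.mem_Iio]; omega
    · simp only [node, Set.mem_Iio]; split_ifs <;> omega
  · refine (Set.finite_Iio (3 * m + 3)).subset ?_
    intro n hn
    rcases mem_edgeSet.1 hn with ⟨σ, j, h, rfl⟩ | ⟨j, h0, h, hl, rfl⟩
    · have := Bool.toNat_le σ
      simp only [spoke, Set.mem_Iio]; omega
    · simp only [cross, Set.mem_Iio]; omega

theorem isConnected (hm : 0 < m) : (graph m b).IsConnected := by
  refine ⟨⟨_, hub_mem (σ := false)⟩, ?_⟩
  have hadj : ∀ σ j, j ≤ m → (graph m b).Adj (hub σ) (node m b σ j) := fun σ j h =>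
    (isLink_spoke h).adj
  have hhub : Relation.ReflTransGen (graph m b).Adj (hub true) (hub false) := by
    have h1 := hadj true 1 hm
    have h2 := (hadj false 1 hm).symm
    by_cases hl : Long m b 1
    · exact ((Relation.ReflTransGen.single h1).tail
        (isLink_cross (σ := true) one_pos hm hl).adj).tail h2
    · rw [node_eq_of_not_long (τ := false) hl] at h1
      exact (Relation.ReflTransGen.single h1).tail h2
  have hto : ∀ x ∈ (graph m b).vertexSet,
      Relation.ReflTransGen (graph m b).Adj x (hub false) := by
    have hub' : ∀ σ, Relation.ReflTransGen (graph m b).Adj (hub σ) (hub false) := by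
      intro σ
      cases σ
      exacts [Relation.ReflTransGen.refl, hhub]
    rintro x (⟨σ, rfl⟩ | ⟨σ, j, h, rfl⟩)
    · exact hub' σ
    · exact (hub' σ).head (hadj σ j h).symm
  intro x hx y hy
  exact (hto x hx).trans (Relation.ReflTransGen.stdSymm.symm _ _ (hto y hy))

/-- The embedding of the gadget. -/
noncomputable def embedding (b : ℕ) (hm : 0 < m) : (graph m b).PlanarEmbedding where
  rot := rot m b
  rot_vertex := rot_vertex
  rot_cyclic := rot_cyclic
  euler := by
    rw [euler_iff_bounding isFinite loopless (isConnected hm) ?_ _ rot_vertex rot_cyclic]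
    · intro z hz
      obtain ⟨h0, q, q1, q2, hq⟩ := exists_faces z (fun x hx _ => hz x hx) 0
      -- In the isolated gadget the terminals have degree one, so a cycle vanishes on the pendant
      -- edges and the two sides of each of them carry the same value.
      have hz0 : ∀ σ, z (spoke σ 0) = 0 := fun σ => by
        rw [← finsum_node_zero (m := m) (b := b) z]
        exact hz _ (node_mem (Nat.zero_le m))
      refine ⟨q, fun f h hfh => ⟨(hq f h hfh).1, ?_⟩⟩
      refine opp_cases (P := fun f h => Opp f h → q (rot m b h) = q f) ?_ ?_ ?_ hfh hfh
      · intro σ j h hfh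
        rcases j.eq_zero_or_pos with rfl | h0
        · rw [rot_nodeFlag_zero]
          have := (hq _ _ hfh).1
          rw [hubFlag_val, hz0] at this
          exact (CharTwo.add_eq_zero.1 this).symm
        · exact (hq _ _ hfh).2 fun τ h => h0.ne' (node_inj.1 h).1
      · exact fun σ j h hfh => (hq _ _ hfh).2 fun τ => hub_ne_node
      · exact fun σ j h0 h hl hfh => (hq _ _ hfh).2 fun τ h => h0.ne' (node_inj.1 h).1
    · rintro x (⟨σ, rfl⟩ | ⟨σ, j, h, rfl⟩)
      · exact ⟨_, (isLink_spoke (Nat.zero_le m)).inc_left⟩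
      · exact ⟨_, (isLink_spoke h).inc_right⟩

/-- The gadget with parameters `m` and `b`. -/
def gadget (m b : ℕ) : Gadget where
  graph := graph m b
  finite := isFinite
  s := node m b false 0
  t := node m b true 0
  s_mem := node_mem (Nat.zero_le m)
  t_mem := node_mem (Nat.zero_le m)
  s_ne_t := fun h => by simpa using (node_inj.1 h).2 long_zero

theorem ncard_inc_node_le (h : j ≤ m) : {n | (graph m b).Inc n (node m b σ j)}.ncard ≤ 2 := by
  by_cases hl : Long m b j
  · have : {n | (graph m b).Inc n (node m b σ j)} ⊆ {spoke σ j, cross j} := by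
      intro n hn
      rcases (inc_node h).1 hn with h | h | h
      exacts [Or.inl h, (h.1 hl).elim, Or.inr h.2.2]
    exact (Set.ncard_le_ncard this).trans ((Set.ncard_insert_le _ _).trans (by simp))
  · have : {n | (graph m b).Inc n (node m b σ j)} ⊆ {spoke σ j, spoke (!σ) j} := by
      intro n hn
      rcases (inc_node h).1 hn with h | h | h
      exacts [Or.inl h, Or.inr h.2, (hl h.2.1).elim]
    exact (Set.ncard_le_ncard this).trans ((Set.ncard_insert_le _ _).trans (by simp))

theorem ncard_inc_hub : {n | (graph m b).Inc n (hub σ)}.ncard = m + 1 := by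
  have : {n | (graph m b).Inc n (hub σ)} = ((Finset.range (m + 1)).image (spoke σ) : Finset ℕ) := by
    ext n
    simp only [Set.mem_ofPred_eq, inc_hub, Finset.coe_image, Set.mem_image, Finset.mem_coe,
      Finset.mem_range, Nat.lt_succ_iff, eq_comm]
  rw [this, Set.ncard_coe_finset, Finset.card_image_of_injective, Finset.card_range]
  exact fun i j h => (spoke_inj.1 h).2

/-- An upper bound for the degrees in the gadget. -/
theorem ncard_inc_le {x : ℕ} (hm : 0 < m) : {n | (graph m b).Inc n x}.ncard ≤ m + 1 := by
  by_cases hx : x ∈ (graph m b).vertexSet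
  · rcases hx with ⟨σ, rfl⟩ | ⟨σ, j, h, rfl⟩
    · exact ncard_inc_hub.le
    · exact (ncard_inc_node_le h).trans (by omega)
  · have : {n | (graph m b).Inc n x} = ∅ := by
      ext n
      exact ⟨fun h => hx h.vertex_mem, fun h => h.elim⟩
    rw [this, Set.ncard_empty]
    omega

end Theta

/-! ### The graph after replacement: incidences, simplicity and size -/

namespace Theta

variable {m b : ℕ}

/-- The vertex `x` of the gadget is not a terminal. -/
def IsInner (m b x : ℕ) : Prop := ∀ σ, x ≠ node m b σ 0

theorem inner_hub {σ : Bool} : IsInner m b (hub σ) := fun _ => hub_ne_node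

theorem inner_node {σ : Bool} {j : ℕ} (h : 0 < j) : IsInner m b (node m b σ j) :=
  fun _ h' => h.ne' (node_inj.1 h').1

theorem exists_inner_of_isLink {n x y : ℕ} (h : (graph m b).IsLink n x y) :
    IsInner m b x ∨ IsInner m b y := by
  rcases h with ⟨σ, j, h, rfl, ⟨rfl, rfl⟩ | ⟨rfl, rfl⟩⟩ | ⟨σ, j, h0, h, hl, rfl, rfl, rfl⟩
  exacts [Or.inl inner_hub, Or.inr inner_hub, Or.inl (inner_node h0)]

theorem eq_of_isLink {n n' x y : ℕ} (h : (graph m b).IsLink n x y)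
    (h' : (graph m b).IsLink n' x y) : n = n' := by
  rcases h with ⟨σ, j, h, rfl, ⟨rfl, rfl⟩ | ⟨rfl, rfl⟩⟩ | ⟨σ, j, h0, h, hl, rfl, rfl, rfl⟩ <;>
  rcases h' with ⟨τ, i, k, rfl, ⟨k1, k2⟩ | ⟨k1, k2⟩⟩ | ⟨τ, i, k0, k, kl, rfl, k1, k2⟩
  · rw [hub_inj.1 k1, (node_inj.1 k2).1]
  · exact (hub_ne_node k1).elim
  · exact (hub_ne_node k1).elim
  · exact (hub_ne_node k2).elim
  · rw [hub_inj.1 k2, (node_inj.1 k1).1]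
  · exact (hub_ne_node k2).elim
  · exact (hub_ne_node k1.symm).elim
  · exact (hub_ne_node k2.symm).elim
  · rw [(node_inj.1 k1).1]

theorem vertex_lt {x : ℕ} (hx : x ∈ (graph m b).vertexSet) : x < 2 * m + 4 := by
  rcases hx with ⟨σ, rfl⟩ | ⟨σ, j, h, rfl⟩ <;> have := Bool.toNat_le σ
  · simp only [hub]; omega
  · simp only [node]; split_ifs <;> omega

theorem edge_lt {n : ℕ} (hn : n ∈ (graph m b).edgeSet) : n < 3 * m + 3 := by
  rcases mem_edgeSet.1 hn with ⟨σ, j, h, rfl⟩ | ⟨j, h0, h, hl, rfl⟩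
  · have := Bool.toNat_le σ
    simp only [spoke]; omega
  · simp only [cross]; omega

end Theta

open Theta

section

variable {α β : Type*} {G : Graph α β}

/-- The end of `e` at which the terminal with index `σ` is placed. -/
def EndOrder.tip (o : G.EndOrder) (σ : Bool) (e : β) : α := if σ then o.head e else o.tail e

theorem EndOrder.isLink_tip (o : G.EndOrder) {e : β} (he : e ∈ G.edgeSet) (σ : Bool) :
    G.IsLink e (o.tip σ e) (o.tip (!σ) e) := by
  cases σ
  exacts [o.isLink e he, (o.isLink e he).symm]

theorem EndOrder.tip_inj (o : G.EndOrder) (hl : G.Loopless) {e : β} (he : e ∈ G.edgeSet)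
    {σ τ : Bool} : o.tip σ e = o.tip τ e ↔ σ = τ := by
  refine ⟨fun h => ?_, fun h => by rw [h]⟩
  by_contra hne
  have hτ : τ = !σ := by cases σ <;> cases τ <;> simp_all
  have := o.isLink_tip he σ
  rw [← hτ, ← h] at this
  exact hl.not_isLoopAt _ _ this

theorem EndOrder.exists_tip (o : G.EndOrder) {e : β} {v : α} (h : G.Inc e v) :
    ∃ σ, v = o.tip σ e := by
  rcases h.eq_or_eq_of_isLink (o.isLink_tip h.edge_mem false) with h | h
  exacts [⟨_, h⟩, ⟨_, h⟩]

/-- The graph obtained by replacing each edge `e` by a gadget with parameters `m e` and `b e`. -/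
def thetaReplace (o : G.EndOrder) (m b : β → ℕ) : Graph (α ⊕ (β × ℕ)) (β × ℕ) :=
  G.replaceEdges o fun e => gadget (m e) (b e)

variable {o : G.EndOrder} {m b : β → ℕ} {e : β}

/-- Where the vertex `x` of the gadget replacing `e` goes. -/
def EndOrder.thetaPlace (o : G.EndOrder) (m b : β → ℕ) (e : β) (x : ℕ) : α ⊕ (β × ℕ) :=
  o.place (gadget (m e) (b e)) e x

theorem thetaPlace_node_zero (σ : Bool) :
    o.thetaPlace m b e (node (m e) (b e) σ 0) = Sum.inl (o.tip σ e) := by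
  have : node (m e) (b e) true 0 ≠ node (m e) (b e) false 0 := fun h => by
    simpa using (node_inj.1 h).2 long_zero
  cases σ <;> simp [EndOrder.thetaPlace, EndOrder.place, gadget, EndOrder.tip, this]

theorem thetaPlace_of_inner {x : ℕ} (h : IsInner (m e) (b e) x) :
    o.thetaPlace m b e x = Sum.inr (e, x) :=
  (if_neg (h false)).trans (if_neg (h true))

theorem inner_or_eq (m b x : ℕ) : IsInner m b x ∨ ∃ σ, x = node m b σ 0 := by
  by_cases h : IsInner m b x
  · exact Or.inl h
  · right
    simpa [IsInner, or_iff_not_imp_left] using h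

theorem thetaPlace_injective (hl : G.Loopless) (he : e ∈ G.edgeSet) :
    Function.Injective (o.thetaPlace m b e) := by
  intro x y h
  rcases inner_or_eq (m e) (b e) x with hx | ⟨σ, rfl⟩ <;>
  rcases inner_or_eq (m e) (b e) y with hy | ⟨τ, rfl⟩
  · rw [thetaPlace_of_inner hx, thetaPlace_of_inner hy] at h
    simpa using h
  · rw [thetaPlace_of_inner hx, thetaPlace_node_zero] at h
    simp at h
  · rw [thetaPlace_of_inner hy, thetaPlace_node_zero] at h
    simp at h
  · rw [thetaPlace_node_zero, thetaPlace_node_zero, Sum.inl.injEq, o.tip_inj hl he] at h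
    rw [h]

theorem thetaReplace_isLink {p : β × ℕ} {v w : α ⊕ (β × ℕ)} :
    (thetaReplace o m b).IsLink p v w ↔ p.1 ∈ G.edgeSet ∧
      ∃ x y, (graph (m p.1) (b p.1)).IsLink p.2 x y ∧
        v = o.thetaPlace m b p.1 x ∧ w = o.thetaPlace m b p.1 y := Iff.rfl

theorem thetaReplace_inc {p : β × ℕ} {v : α ⊕ (β × ℕ)} :
    (thetaReplace o m b).Inc p v ↔ p.1 ∈ G.edgeSet ∧
      ∃ x, (graph (m p.1) (b p.1)).Inc p.2 x ∧ v = o.thetaPlace m b p.1 x := by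
  constructor
  · rintro ⟨w, hp, x, y, h, hv, -⟩
    exact ⟨hp, x, h.inc_left, hv⟩
  · rintro ⟨hp, x, ⟨y, h⟩, hv⟩
    exact ⟨_, hp, x, y, h, hv, rfl⟩

theorem thetaReplace_mem_edgeSet {p : β × ℕ} : p ∈ (thetaReplace o m b).edgeSet ↔
    p.1 ∈ G.edgeSet ∧ p.2 ∈ (graph (m p.1) (b p.1)).edgeSet := by
  constructor
  · intro h
    obtain ⟨v, w, hp, x, y, h, -⟩ := exists_isLink_of_mem_edgeSet h
    exact ⟨hp, h.edge_mem⟩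
  · rintro ⟨hp, h⟩
    obtain ⟨x, y, h⟩ := exists_isLink_of_mem_edgeSet h
    exact IsLink.edge_mem (thetaReplace_isLink.2 ⟨hp, x, y, h, rfl, rfl⟩)

theorem isLink_thetaPlace (he : e ∈ G.edgeSet) {n x y : ℕ}
    (h : (graph (m e) (b e)).IsLink n x y) : (thetaReplace o m b).IsLink (e, n)
      (o.thetaPlace m b e x) (o.thetaPlace m b e y) :=
  ⟨he, x, y, h, rfl, rfl⟩

theorem thetaReplace_inc_inr {e' : β} {n x : ℕ} :
    (thetaReplace o m b).Inc (e', n) (Sum.inr (e, x)) ↔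
      e ∈ G.edgeSet ∧ IsInner (m e) (b e) x ∧ e' = e ∧ (graph (m e) (b e)).Inc n x := by
  rw [thetaReplace_inc]
  constructor
  · rintro ⟨he, y, h, h'⟩
    dsimp only at he h h'
    rcases inner_or_eq (m e') (b e') y with hy | ⟨σ, rfl⟩
    · rw [thetaPlace_of_inner hy, Sum.inr.injEq, Prod.mk.injEq] at h'
      obtain ⟨rfl, rfl⟩ := h'
      exact ⟨he, hy, rfl, h⟩
    · rw [thetaPlace_node_zero] at h'
      simp at h'
  · rintro ⟨he, hx, rfl, h⟩
    exact ⟨he, x, h, (thetaPlace_of_inner hx).symm⟩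

theorem thetaReplace_inc_inl {n : ℕ} {u : α} :
    (thetaReplace o m b).Inc (e, n) (Sum.inl u) ↔
      e ∈ G.edgeSet ∧ ∃ σ, u = o.tip σ e ∧ n = spoke σ 0 := by
  rw [thetaReplace_inc]
  constructor
  · rintro ⟨he, y, h, h'⟩
    dsimp only at he h h'
    rcases inner_or_eq (m e) (b e) y with hy | ⟨σ, rfl⟩
    · rw [thetaPlace_of_inner hy] at h'
      simp at h'
    · rw [thetaPlace_node_zero, Sum.inl.injEq] at h'
      refine ⟨he, σ, h', ?_⟩
      simpa [inc_node (Nat.zero_le _), long_zero] using h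
  · rintro ⟨he, σ, rfl, rfl⟩
    exact ⟨he, _, (isLink_spoke (Nat.zero_le _)).inc_right, (thetaPlace_node_zero σ).symm⟩

theorem thetaReplace_inl_mem {u : α} :
    Sum.inl u ∈ (thetaReplace o m b).vertexSet ↔ u ∈ G.vertexSet := by
  constructor
  · rintro (⟨u', h, h'⟩ | ⟨e, he, x, hx, h'⟩)
    · exact Sum.inl_injective h' ▸ h
    · change _ = o.thetaPlace m b e x at h'
      rcases inner_or_eq (m e) (b e) x with hy | ⟨σ, rfl⟩
      · rw [thetaPlace_of_inner hy] at h'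
        simp at h'
      · rw [thetaPlace_node_zero, Sum.inl.injEq] at h'
        exact h' ▸ (o.isLink_tip he σ).left_mem
  · exact fun h => Or.inl ⟨u, h, rfl⟩

theorem thetaReplace_inr_mem {x : ℕ} : Sum.inr (e, x) ∈ (thetaReplace o m b).vertexSet ↔
    e ∈ G.edgeSet ∧ x ∈ (graph (m e) (b e)).vertexSet ∧ IsInner (m e) (b e) x := by
  constructor
  · rintro (⟨u', h, h'⟩ | ⟨e', he, y, hy, h'⟩)
    · simp at h'
    · change _ = o.thetaPlace m b e' y at h'
      rcases inner_or_eq (m e') (b e') y with h | ⟨σ, rfl⟩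
      · rw [thetaPlace_of_inner h, Sum.inr.injEq, Prod.mk.injEq] at h'
        obtain ⟨rfl, rfl⟩ := h'
        exact ⟨he, hy, h⟩
      · rw [thetaPlace_node_zero] at h'
        simp at h'
  · rintro ⟨he, hx, h⟩
    exact Or.inr ⟨e, he, x, hx, (thetaPlace_of_inner h).symm⟩

/-- Every edge of a gadget has an inner end, and this end determines the gadget. So parallel edges
would lie in one gadget, which is simple. -/
theorem thetaReplace_simple (hl : G.Loopless) : (thetaReplace o m b).Simple where
  not_isLoopAt := by
    rintro ⟨e, n⟩ v ⟨he, x, y, h, rfl, h'⟩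
    obtain rfl := thetaPlace_injective hl he h'
    exact loopless.not_isLoopAt _ _ h
  eq_of_isLink := by
    rintro ⟨e, n⟩ ⟨e', n'⟩ v w ⟨he, x, y, h, hv, hw⟩ ⟨he', x', y', h', hv', hw'⟩
    dsimp only at he he' h h' hv hw hv' hw'
    have key : ∀ {x x'}, o.thetaPlace m b e x = o.thetaPlace m b e' x' → IsInner (m e) (b e) x →
        e = e' := by
      intro x x' h hx
      rw [thetaPlace_of_inner hx] at h
      rcases inner_or_eq (m e') (b e') x' with hx' | ⟨σ, rfl⟩
      · rw [thetaPlace_of_inner hx', Sum.inr.injEq, Prod.mk.injEq] at h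
        exact h.1
      · rw [thetaPlace_node_zero] at h
        simp at h
    obtain rfl : e = e' := by
      rcases exists_inner_of_isLink h with hx | hy
      · exact key (hv.symm.trans hv') hx
      · exact key (hw.symm.trans hw') hy
    obtain rfl := thetaPlace_injective hl he (hv.symm.trans hv')
    obtain rfl := thetaPlace_injective hl he (hw.symm.trans hw')
    rw [eq_of_isLink h h']

theorem thetaReplace_vertexSet_subset {C : ℕ} (hC : ∀ e ∈ G.edgeSet, m e ≤ C) :
    (thetaReplace o m b).vertexSet ⊆
      Sum.inl '' G.vertexSet ∪ Sum.inr '' (G.edgeSet ×ˢ Set.Iio (2 * C + 4)) := by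
  rintro (u | ⟨e, x⟩) h
  · exact Or.inl ⟨u, thetaReplace_inl_mem.1 h, rfl⟩
  · obtain ⟨he, hx, -⟩ := thetaReplace_inr_mem.1 h
    have h1 := vertex_lt hx
    have h2 := hC e he
    exact Or.inr ⟨(e, x), ⟨he, by simp only [Set.mem_Iio]; omega⟩, rfl⟩

theorem thetaReplace_edgeSet_subset {C : ℕ} (hC : ∀ e ∈ G.edgeSet, m e ≤ C) :
    (thetaReplace o m b).edgeSet ⊆ G.edgeSet ×ˢ Set.Iio (3 * C + 3) := by
  rintro ⟨e, n⟩ h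
  obtain ⟨he, hn⟩ := thetaReplace_mem_edgeSet.1 h
  have h1 := edge_lt hn
  have h2 := hC e he
  exact ⟨he, by dsimp only at h1; simp only [Set.mem_Iio]; omega⟩

theorem thetaReplace_isFinite (hG : G.IsFinite) {C : ℕ} (hC : ∀ e ∈ G.edgeSet, m e ≤ C) :
    (thetaReplace o m b).IsFinite :=
  ⟨((hG.1.image _).union ((hG.2.prod (Set.finite_Iio _)).image _)).subset
    (thetaReplace_vertexSet_subset hC),
    (hG.2.prod (Set.finite_Iio _)).subset (thetaReplace_edgeSet_subset hC)⟩

/-- A gadget of length at most `C` contributes at most `2 * C + 4` vertices and `3 * C + 3` edges.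
-/
theorem thetaReplace_size_le (hG : G.IsFinite) {C : ℕ} (hC : ∀ e ∈ G.edgeSet, m e ≤ C) :
    (thetaReplace o m b).vertexSet.ncard + (thetaReplace o m b).edgeSet.ncard ≤
      G.vertexSet.ncard + G.edgeSet.ncard * (5 * C + 7) := by
  have hIio : ∀ k : ℕ, (Set.Iio k).ncard = k := fun k => by
    rw [Set.ncard_eq_toFinset_card']; simp
  have hf : (G.edgeSet ×ˢ Set.Iio (2 * C + 4)).Finite := hG.2.prod (Set.finite_Iio _)
  have h1 := Set.ncard_le_ncard (thetaReplace_vertexSet_subset (o := o) (b := b) hC)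
    ((hG.1.image _).union (hf.image _))
  have h2 := Set.ncard_le_ncard (thetaReplace_edgeSet_subset (o := o) (b := b) hC)
    (hG.2.prod (Set.finite_Iio _))
  have h3 := Set.ncard_union_le (Sum.inl '' G.vertexSet : Set (α ⊕ (β × ℕ)))
    (Sum.inr '' (G.edgeSet ×ˢ Set.Iio (2 * C + 4)))
  rw [Set.ncard_image_of_injective _ Sum.inl_injective,
    Set.ncard_image_of_injective _ Sum.inr_injective, Set.ncard_prod, hIio] at h3
  rw [Set.ncard_prod, hIio] at h2
  nlinarith

end

/-! ### Replacement preserves 2-connectedness -/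

section

variable {α β : Type*} {G : Graph α β}

theorem deleteVerts_adj {v x y : α} :
    (G.deleteVerts {v}).Adj x y ↔ G.Adj x y ∧ x ≠ v ∧ y ≠ v := by
  constructor
  · rintro ⟨e, he⟩
    obtain ⟨h, hx, hy⟩ := (deleteVerts_isLink G {v}).1 he
    exact ⟨⟨e, h⟩, hx, hy⟩
  · rintro ⟨⟨e, h⟩, hx, hy⟩
    exact ⟨e, (deleteVerts_isLink G {v}).2 ⟨h, hx, hy⟩⟩

/-- `x` and `y` are joined by a walk that avoids `v`. -/
def JoinedOff (G : Graph α β) (v : α) : α → α → Prop :=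
  Relation.ReflTransGen (G.deleteVerts {v}).Adj

theorem JoinedOff.symm {v x y : α} (h : G.JoinedOff v x y) : G.JoinedOff v y x := by
  have : Std.Symm (G.deleteVerts {v}).Adj := inferInstance
  exact Relation.ReflTransGen.stdSymm.symm _ _ h

theorem JoinedOff.trans {v x y z : α} (h : G.JoinedOff v x y) (h' : G.JoinedOff v y z) :
    G.JoinedOff v x z :=
  Relation.ReflTransGen.trans h h'

theorem JoinedOff.refl {v x : α} : G.JoinedOff v x x := Relation.ReflTransGen.refl

theorem JoinedOff.of_adj {v x y : α} (h : G.Adj x y) (hx : x ≠ v) (hy : y ≠ v) :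
    G.JoinedOff v x y :=
  Relation.ReflTransGen.single (deleteVerts_adj.2 ⟨h, hx, hy⟩)

theorem exists_vertex_ne (h : 3 ≤ G.vertexSet.encard) (x y : α) :
    ∃ v ∈ G.vertexSet, v ≠ x ∧ v ≠ y := by
  by_contra! hcon
  have hsub : G.vertexSet ⊆ {x, y} := fun v hv => by
    by_cases hx : v = x
    · exact Or.inl hx
    · exact Or.inr (hcon v hv hx)
  have := (h.trans (Set.encard_le_encard hsub)).trans (Set.encard_insert_le _ _)
  rw [Set.encard_singleton] at this
  norm_num at this

/-- Connectedness itself comes for free: to join `x` and `y`, delete a third vertex. -/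
theorem isTwoConnected_of_joinedOff (hl : G.Loopless) (h3 : 3 ≤ G.vertexSet.encard)
    (h : ∀ v ∈ G.vertexSet, ∀ x ∈ G.vertexSet, x ≠ v → ∀ y ∈ G.vertexSet, y ≠ v →
      G.JoinedOff v x y) : G.IsTwoConnected where
  loopless := hl
  three_le := h3
  connected := by
    refine ⟨?_, fun x hx y hy => ?_⟩
    · rw [← Set.encard_pos]
      exact lt_of_lt_of_le (by norm_num) h3
    · obtain ⟨v, hv, hvx, hvy⟩ := exists_vertex_ne h3 x y
      exact Relation.ReflTransGen.mono (fun _ _ h => (deleteVerts_adj.1 h).1) _ _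
        (h v hv x hx hvx.symm y hy hvy.symm)
  connected_deleteVerts := by
    intro v hv
    refine ⟨?_, fun x hx y hy => ?_⟩
    · obtain ⟨w, hw, hwv, -⟩ := exists_vertex_ne h3 v v
      exact ⟨w, hw, hwv⟩
    · rw [vertexSet_deleteVerts] at hx hy
      exact h v hv x hx.1 hx.2 y hy.1 hy.2

theorem IsTwoConnected.joinedOff (hG : G.IsTwoConnected) {v x y : α} (hv : v ∈ G.vertexSet)
    (hx : x ∈ G.vertexSet) (hxv : x ≠ v) (hy : y ∈ G.vertexSet) (hyv : y ≠ v) :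
    G.JoinedOff v x y := by
  refine (hG.connected_deleteVerts v hv).2 x ?_ y ?_ <;> rw [vertexSet_deleteVerts]
  exacts [⟨hx, hxv⟩, ⟨hy, hyv⟩]

/-- Adjacency by an edge other than `e`. -/
def AdjOff (G : Graph α β) (e : β) (x y : α) : Prop := ∃ f, f ≠ e ∧ G.IsLink f x y

/-- A 2-connected graph has no bridges. -/
theorem IsTwoConnected.reflTransGen_adjOff (hG : G.IsTwoConnected) (e : β) {x y : α}
    (hx : x ∈ G.vertexSet) (hy : y ∈ G.vertexSet) : Relation.ReflTransGen (G.AdjOff e) x y := by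
  have hoff : ∀ {v w}, G.IsLink e v w → ∀ {x y}, G.JoinedOff v x y →
      Relation.ReflTransGen (G.AdjOff e) x y := by
    intro v w hvw x y h
    refine Relation.ReflTransGen.mono ?_ _ _ h
    intro a c hac
    obtain ⟨⟨f, hf⟩, ha, hc⟩ := deleteVerts_adj.1 hac
    refine ⟨f, ?_, hf⟩
    rintro rfl
    rcases hvw.left_eq_or_eq hf with h | h
    exacts [ha h.symm, hc h.symm]
  -- With a third vertex `u`, go from `v` to `u` avoiding `w` and on to `w` avoiding `v`; neither
  -- part can use `e`.
  have hends : ∀ {v w}, G.IsLink e v w → Relation.ReflTransGen (G.AdjOff e) v w := by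
    intro v w h
    obtain ⟨u, hu, huv, huw⟩ := exists_vertex_ne hG.three_le v w
    have hne : v ≠ w := fun hvw => hG.loopless.not_isLoopAt e v (by rwa [← hvw] at h)
    exact (hoff h.symm (hG.joinedOff h.right_mem h.left_mem hne hu huw)).trans
      (hoff h (hG.joinedOff h.left_mem hu huv h.right_mem hne.symm))
  induction hG.connected.2 x hx y hy with
  | refl => exact Relation.ReflTransGen.refl
  | @tail a c _ hac ih =>
    obtain ⟨f, hf⟩ := hac
    refine (ih hf.left_mem).trans ?_
    by_cases hfe : f = e
    · subst hfe
      exact hends hf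
    · exact Relation.ReflTransGen.single ⟨f, hfe, hf⟩

theorem IsTwoConnected.exists_ne_inc (hG : G.IsTwoConnected) (e : β) {v : α}
    (hv : v ∈ G.vertexSet) : ∃ f, f ≠ e ∧ G.Inc f v := by
  obtain ⟨w, hw, hwv, -⟩ := exists_vertex_ne hG.three_le v v
  obtain ⟨x, ⟨f, hf, h⟩, -⟩ := (Relation.ReflTransGen.cases_head
    (hG.reflTransGen_adjOff e hv hw)).resolve_left hwv.symm
  exact ⟨f, hf, h.inc_left⟩

theorem IsTwoConnected.exists_inc (hG : G.IsTwoConnected) {v : α} (hv : v ∈ G.vertexSet) :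
    ∃ e, G.Inc e v := by
  obtain ⟨w, hw, hwv, -⟩ := exists_vertex_ne hG.three_le v v
  obtain ⟨x, ⟨e, h⟩, -⟩ := (Relation.ReflTransGen.cases_head
    (hG.connected.2 v hv w hw)).resolve_left hwv.symm
  exact ⟨e, h.inc_left⟩

theorem IsTwoConnected.euler_iff_bounding (hG : G.IsTwoConnected) (hfin : G.IsFinite)
    (rot : Equiv.Perm G.Flag) (rot_vertex : ∀ f : G.Flag, (rot f).1.1 = f.1.1)
    (rot_cyclic : ∀ f g : G.Flag, f.1.1 = g.1.1 → rot.SameCycle f g) :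
    (G.vertexSet.ncard +
      (Nat.card (Quot (G.FaceStep rot)) + {v ∈ G.vertexSet | ∀ e, ¬ G.Inc e v}.ncard) =
    G.edgeSet.ncard + 2 * Nat.card (Quot fun x y : G.vertexSet => G.Adj x y)) ↔
      G.Bounding rot :=
  Graph.euler_iff_bounding hfin hG.loopless hG.connected (fun _ hv => hG.exists_inc hv) rot
    rot_vertex rot_cyclic

variable {o : G.EndOrder} {m b : β → ℕ} {e : β}

theorem adj_thetaPlace (he : e ∈ G.edgeSet) {x y : ℕ}
    (h : (graph (m e) (b e)).Adj x y) : (thetaReplace o m b).Adj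
      (o.thetaPlace m b e x) (o.thetaPlace m b e y) := by
  obtain ⟨n, h⟩ := h
  exact (isLink_thetaPlace he h).adj

theorem joinedOff_node_hub {v : α ⊕ (β × ℕ)} (he : e ∈ G.edgeSet) {σ : Bool} {j : ℕ}
    (hj : j ≤ m e) (h1 : o.thetaPlace m b e (node (m e) (b e) σ j) ≠ v)
    (h2 : o.thetaPlace m b e (hub σ) ≠ v) : (thetaReplace o m b).JoinedOff v
      (o.thetaPlace m b e (node (m e) (b e) σ j)) (o.thetaPlace m b e (hub σ)) :=
  JoinedOff.of_adj (adj_thetaPlace he (isLink_spoke hj).symm.adj) h1 h2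

theorem joinedOff_hub_hub {v : α ⊕ (β × ℕ)} (he : e ∈ G.edgeSet) (hm : 0 < m e)
    (hv : ∀ x, v ≠ Sum.inr (e, x)) : (thetaReplace o m b).JoinedOff v
      (o.thetaPlace m b e (hub false)) (o.thetaPlace m b e (hub true)) := by
  have hne : ∀ {x}, IsInner (m e) (b e) x → o.thetaPlace m b e x ≠ v := fun {x} hx => by
    rw [thetaPlace_of_inner hx]
    exact (hv x).symm
  have hn : ∀ σ, (thetaReplace o m b).JoinedOff v
      (o.thetaPlace m b e (node (m e) (b e) σ 1)) (o.thetaPlace m b e (hub σ)) := fun σ =>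
    joinedOff_node_hub he hm (hne (inner_node one_pos)) (hne inner_hub)
  refine (hn false).symm.trans (JoinedOff.trans ?_ (hn true))
  by_cases hl : Long (m e) (b e) 1
  · exact JoinedOff.of_adj (adj_thetaPlace he (isLink_cross one_pos hm hl).adj)
      (hne (inner_node one_pos)) (hne (inner_node one_pos))
  · rw [node_eq_of_not_long (τ := true) hl]
    exact JoinedOff.refl

theorem joinedOff_hub_tip {v : α ⊕ (β × ℕ)} (he : e ∈ G.edgeSet) (σ : Bool)
    (hv : ∀ x, v ≠ Sum.inr (e, x)) (h : Sum.inl (o.tip σ e) ≠ v) :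
    (thetaReplace o m b).JoinedOff v (o.thetaPlace m b e (hub σ)) (Sum.inl (o.tip σ e)) := by
  have := joinedOff_node_hub (o := o) (v := v) (m := m) (b := b) he (σ := σ) (Nat.zero_le _)
    (by rwa [thetaPlace_node_zero])
    (by rw [thetaPlace_of_inner inner_hub]; exact (hv _).symm)
  rw [thetaPlace_node_zero] at this
  exact this.symm

theorem joinedOff_tips {v : α ⊕ (β × ℕ)} (he : e ∈ G.edgeSet) (hm : 0 < m e)
    (hv : ∀ x, v ≠ Sum.inr (e, x)) (h : ∀ σ, Sum.inl (o.tip σ e) ≠ v) :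
    (thetaReplace o m b).JoinedOff v (Sum.inl (o.tip false e)) (Sum.inl (o.tip true e)) :=
  (joinedOff_hub_tip he false hv (h false)).symm.trans
    ((joinedOff_hub_hub he hm hv).trans (joinedOff_hub_tip he true hv (h true)))

theorem joinedOff_of_isLink {v : α ⊕ (β × ℕ)} {x y : α} (h : G.IsLink e x y) (hm : 0 < m e)
    (hv : ∀ x, v ≠ Sum.inr (e, x)) (hx : Sum.inl x ≠ v) (hy : Sum.inl y ≠ v) :
    (thetaReplace o m b).JoinedOff v (Sum.inl x) (Sum.inl y) := by
  have hj := joinedOff_tips (o := o) (m := m) (b := b) (v := v) h.edge_mem hm hv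
  rcases (o.isLink_tip h.edge_mem false).eq_and_eq_or_eq_and_eq h with ⟨rfl, rfl⟩ | ⟨rfl, rfl⟩
  · exact hj fun σ => by cases σ <;> assumption
  · exact (hj fun σ => by cases σ <;> assumption).symm

/-- If an original vertex is deleted, a walk in `G` avoiding it is followed through the gadgets. If
an inner vertex of the gadget of `e` is deleted, the walk has to avoid `e`, and it can since `e` is
not a bridge. -/
theorem joinedOff_inl_inl (hG : G.IsTwoConnected) (hm : ∀ e ∈ G.edgeSet, 0 < m e)
    {v : α ⊕ (β × ℕ)} (hv : v ∈ (thetaReplace o m b).vertexSet) {x y : α} (hx : x ∈ G.vertexSet)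
    (hy : y ∈ G.vertexSet) (hxv : Sum.inl x ≠ v) (hyv : Sum.inl y ≠ v) :
    (thetaReplace o m b).JoinedOff v (Sum.inl x) (Sum.inl y) := by
  rcases v with u | ⟨e, z⟩
  · have := hG.joinedOff (thetaReplace_inl_mem.1 hv) hx (fun h => hxv (h ▸ rfl)) hy
      (fun h => hyv (h ▸ rfl))
    clear hx hy
    induction this with
    | refl => exact JoinedOff.refl
    | tail _ hac ih =>
      obtain ⟨⟨f, hf⟩, ha, hc⟩ := deleteVerts_adj.1 hac
      have ha' : (Sum.inl _ : α ⊕ (β × ℕ)) ≠ Sum.inl u := fun h => ha (Sum.inl_injective h)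
      exact (ih ha').trans (joinedOff_of_isLink hf (hm f hf.edge_mem) (by simp) ha' hyv)
  · induction hG.reflTransGen_adjOff e hx hy with
    | refl => exact JoinedOff.refl
    | tail _ hac ih =>
      obtain ⟨f, hfe, hf⟩ := hac
      exact (ih hf.left_mem (by simp)).trans
        (joinedOff_of_isLink hf (hm f hf.edge_mem) (by simp [hfe.symm]) (by simp) (by simp))

/-- A deletion outside the interior of a gadget leaves that interior connected and at least one
terminal alive. After a deletion inside, each remaining inner vertex still reaches a hub and from
there a terminal. -/
theorem exists_joinedOff_inl (hl : G.Loopless) (hm : ∀ e ∈ G.edgeSet, 0 < m e)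
    {v w : α ⊕ (β × ℕ)} (hw : w ∈ (thetaReplace o m b).vertexSet) (hwv : w ≠ v) :
    ∃ u ∈ G.vertexSet, Sum.inl u ≠ v ∧ (thetaReplace o m b).JoinedOff v w (Sum.inl u) := by
  rcases w with u | ⟨e, y⟩
  · exact ⟨u, thetaReplace_inl_mem.1 hw, hwv, JoinedOff.refl⟩
  obtain ⟨he, hy, hyi⟩ := thetaReplace_inr_mem.1 hw
  have htip : ∀ σ, o.tip σ e ∈ G.vertexSet := fun σ => (o.isLink_tip he σ).left_mem
  rw [← thetaPlace_of_inner (o := o) (m := m) (b := b) hyi] at hwv ⊢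
  by_cases hv : ∀ x, v ≠ Sum.inr (e, x)
  · have hhub : ∀ σ, o.thetaPlace m b e (hub σ) ≠ v := fun σ => by
      rw [thetaPlace_of_inner inner_hub]
      exact (hv _).symm
    obtain ⟨τ, hτ⟩ : ∃ τ, Sum.inl (o.tip τ e) ≠ v := by
      by_contra! h
      have := Sum.inl_injective ((h false).trans (h true).symm)
      simpa using (o.tip_inj hl he).1 this
    refine ⟨_, htip τ, hτ, JoinedOff.trans ?_ (joinedOff_hub_tip he τ hv hτ)⟩
    have hhh := joinedOff_hub_hub (o := o) (b := b) he (hm e he) hv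
    have hhub' : ∀ σ, (thetaReplace o m b).JoinedOff v (o.thetaPlace m b e (hub σ))
        (o.thetaPlace m b e (hub τ)) := by
      intro σ
      cases σ <;> cases τ
      exacts [JoinedOff.refl, hhh, hhh.symm, JoinedOff.refl]
    rcases hy with ⟨σ, rfl⟩ | ⟨σ, j, h, rfl⟩
    · exact hhub' σ
    · exact (joinedOff_node_hub he h hwv (hhub σ)).trans (hhub' σ)
  · push Not at hv
    obtain ⟨x, rfl⟩ := hv
    have hub_tip : ∀ σ, o.thetaPlace m b e (hub σ) ≠ Sum.inr (e, x) →
        (thetaReplace o m b).JoinedOff (Sum.inr (e, x)) (o.thetaPlace m b e (hub σ))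
          (Sum.inl (o.tip σ e)) := by
      intro σ h
      have := joinedOff_node_hub (o := o) (m := m) (b := b) (v := Sum.inr (e, x)) he (σ := σ)
        (Nat.zero_le _) (by rw [thetaPlace_node_zero]; simp) h
      rw [thetaPlace_node_zero] at this
      exact this.symm
    rcases hy with ⟨σ, rfl⟩ | ⟨σ, j, h, rfl⟩
    · exact ⟨_, htip σ, by simp, hub_tip σ hwv⟩
    · have hj : 0 < j := Nat.pos_of_ne_zero fun h0 => hyi σ (by rw [h0])
      by_cases hσ : o.thetaPlace m b e (hub σ) = Sum.inr (e, x)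
      · obtain rfl : hub σ = x := by simpa [thetaPlace_of_inner inner_hub] using hσ
        have hσ' : o.thetaPlace m b e (hub (!σ)) ≠ Sum.inr (e, hub σ) := by
          rw [thetaPlace_of_inner inner_hub]
          simp [hub_inj]
        have hn : o.thetaPlace m b e (node (m e) (b e) (!σ) j) ≠ Sum.inr (e, hub σ) := by
          rw [thetaPlace_of_inner (inner_node hj)]
          simp [hub_ne_node.symm]
        refine ⟨_, htip (!σ), by simp, JoinedOff.trans ?_
          ((joinedOff_node_hub he h hn hσ').trans (hub_tip (!σ) hσ'))⟩
        by_cases hlong : Long (m e) (b e) j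
        · exact JoinedOff.of_adj (adj_thetaPlace he (isLink_cross hj h hlong).adj) hwv hn
        · rw [node_eq_of_not_long (τ := !σ) hlong]
          exact JoinedOff.refl
      · exact ⟨_, htip σ, by simp, (joinedOff_node_hub he h hwv hσ).trans (hub_tip σ hσ)⟩

theorem thetaReplace_isTwoConnected (hG : G.IsTwoConnected) (hm : ∀ e ∈ G.edgeSet, 0 < m e) :
    (thetaReplace o m b).IsTwoConnected := by
  refine isTwoConnected_of_joinedOff (thetaReplace_simple hG.loopless).toLoopless ?_ ?_
  · refine hG.three_le.trans ?_
    rw [← Sum.inl_injective.encard_image (s := G.vertexSet) (f := (Sum.inl : α → α ⊕ (β × ℕ)))]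
    refine Set.encard_le_encard ?_
    rintro _ ⟨u, hu, rfl⟩
    exact thetaReplace_inl_mem.2 hu
  · intro v hv x hx hxv y hy hyv
    obtain ⟨x', hx', hxv', h1⟩ := exists_joinedOff_inl hG.loopless hm hx hxv
    obtain ⟨y', hy', hyv', h2⟩ := exists_joinedOff_inl hG.loopless hm hy hyv
    exact h1.trans ((joinedOff_inl_inl hG hm hv hx' hy' hxv' hyv').trans h2.symm)

end

/-! ### Half-edges after replacement and the lift of an embedding -/

theorem exists_perm_comm {X Y : Type*} [Finite X] {ι : X → Y} (hι : Function.Injective ι)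
    (ρ' : Equiv.Perm Y) (h : ∀ x, ∃ y, ι y = ρ' (ι x)) :
    ∃ ρ : Equiv.Perm X, ∀ x, ι (ρ x) = ρ' (ι x) := by
  choose f hf using h
  have hf' : Function.Injective f := fun x y hxy =>
    hι (ρ'.injective (by rw [← hf, ← hf, hxy]))
  exact ⟨Equiv.ofBijective f (Finite.injective_iff_bijective.1 hf'), hf⟩

theorem pow_comm_of_forall {X Y : Type*} {ι : X → Y} {ρ : Equiv.Perm X} {ρ' : Equiv.Perm Y}
    (p : X → Prop) (hp : ∀ x, p x → p (ρ x)) (h : ∀ x, p x → ρ' (ι x) = ι (ρ x)) {x : X} (hx : p x)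
    (k : ℕ) : (ρ' ^ k) (ι x) = ι ((ρ ^ k) x) := by
  have : p ((ρ ^ k) x) ∧ (ρ' ^ k) (ι x) = ι ((ρ ^ k) x) := by
    induction k with
    | zero => exact ⟨hx, rfl⟩
    | succ k ih =>
      rw [pow_succ', pow_succ', Equiv.Perm.mul_apply, Equiv.Perm.mul_apply, ih.2, h _ ih.1]
      exact ⟨hp _ ih.1, rfl⟩
  exact this.2

section

variable {α β : Type*} {G : Graph α β} {o : G.EndOrder} {m b : β → ℕ} {e : β}

/-- The half-edge of `e` at the end with index `σ`. -/
def tipFlag (o : G.EndOrder) (he : e ∈ G.edgeSet) (σ : Bool) : G.Flag :=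
  ⟨(o.tip σ e, e), (o.isLink_tip he σ).inc_left⟩

theorem tipFlag_cases {P : G.Flag → Prop} (o : G.EndOrder)
    (h : ∀ e (he : e ∈ G.edgeSet) σ, P (tipFlag o he σ)) (f : G.Flag) : P f := by
  obtain ⟨⟨v, e⟩, hf⟩ := f
  have hf' : G.Inc e v := hf
  obtain ⟨σ, rfl⟩ := o.exists_tip hf'
  exact h e hf'.edge_mem σ

theorem tipFlag_opp {he : e ∈ G.edgeSet} {σ : Bool} : Opp (tipFlag o he σ) (tipFlag o he (!σ)) :=
  ⟨rfl, o.isLink_tip he σ⟩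

/-- The index of the end of its edge at which a half-edge sits. -/
noncomputable def EndOrder.side (o : G.EndOrder) (f : G.Flag) : Bool := (o.exists_tip f.2).choose

theorem tipFlag_side (f : G.Flag) : tipFlag o f.2.edge_mem (o.side f) = f :=
  Subtype.ext (Prod.ext (o.exists_tip f.2).choose_spec.symm rfl)

theorem side_tipFlag (hl : G.Loopless) {he : e ∈ G.edgeSet} {σ : Bool} :
    o.side (tipFlag o he σ) = σ := by
  have := (o.exists_tip (tipFlag o he σ).2).choose_spec
  exact ((o.tip_inj hl he).1 this).symm

/-- The half-edges of the gadget that replaces `e`. -/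
def gadgetFlag (o : G.EndOrder) (m b : β → ℕ) (he : e ∈ G.edgeSet)
    (f : (graph (m e) (b e)).Flag) : (thetaReplace o m b).Flag :=
  ⟨(o.thetaPlace m b e f.1.1, (e, f.1.2)), thetaReplace_inc.2 ⟨he, _, f.2, rfl⟩⟩

/-- The half-edge that replaces a half-edge of `G`. -/
noncomputable def outerFlag (o : G.EndOrder) (m b : β → ℕ) (f : G.Flag) :
    (thetaReplace o m b).Flag :=
  gadgetFlag o m b f.2.edge_mem (nodeFlag (b f.1.2) (o.side f) (Nat.zero_le (m f.1.2)))

theorem outerFlag_val (f : G.Flag) :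
    (outerFlag o m b f).1 = (Sum.inl f.1.1, (f.1.2, spoke (o.side f) 0)) := by
  refine Prod.ext ?_ rfl
  refine (thetaPlace_node_zero (o.side f)).trans ?_
  conv_rhs => rw [← tipFlag_side (o := o) f]
  rfl

theorem outerFlag_tipFlag (hl : G.Loopless) {he : e ∈ G.edgeSet} {σ : Bool} :
    outerFlag o m b (tipFlag o he σ) = gadgetFlag o m b he (nodeFlag (b e) σ (Nat.zero_le _)) := by
  unfold outerFlag
  rw [side_tipFlag hl]
  rfl

theorem outerFlag_injective : Function.Injective (outerFlag o m b) := by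
  intro f g h
  have := congrArg Subtype.val h
  rw [outerFlag_val, outerFlag_val] at this
  simp only [Prod.mk.injEq, Sum.inl.injEq] at this
  exact Subtype.ext (Prod.ext this.1 this.2.1)

theorem gadgetFlag_inj (hl : G.Loopless) {he : e ∈ G.edgeSet} {f g : (graph (m e) (b e)).Flag} :
    gadgetFlag o m b he f = gadgetFlag o m b he g ↔ f = g := by
  refine ⟨fun h => ?_, fun h => by rw [h]⟩
  have := congrArg Subtype.val h
  simp only [gadgetFlag, Prod.mk.injEq, true_and] at this
  exact Subtype.ext (Prod.ext (thetaPlace_injective hl he this.1) this.2)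

/-- All half-edges of the gadgets. -/
def gadgetFlags (o : G.EndOrder) (m b : β → ℕ)
    (p : Σ e : G.edgeSet, (graph (m e) (b e)).Flag) : (thetaReplace o m b).Flag :=
  gadgetFlag o m b p.1.2 p.2

theorem gadgetFlags_bijective (hl : G.Loopless) : Function.Bijective (gadgetFlags o m b) := by
  constructor
  · rintro ⟨⟨e, he⟩, f⟩ ⟨⟨e', he'⟩, f'⟩ h
    obtain rfl : e = e' := congrArg (fun f : (thetaReplace o m b).Flag => f.1.2.1) h
    obtain rfl : f = f' := (gadgetFlag_inj (he := he) hl).1 h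
    rfl
  · rintro ⟨⟨v, ⟨e, n⟩⟩, h⟩
    obtain ⟨he, x, hx, hv⟩ := thetaReplace_inc.1 h
    exact ⟨⟨⟨e, he⟩, ⟨(x, n), hx⟩⟩, Subtype.ext (Prod.ext hv.symm rfl)⟩

theorem gadgetFlag_cases {P : (thetaReplace o m b).Flag → Prop}
    (h : ∀ e (he : e ∈ G.edgeSet) f, P (gadgetFlag o m b he f)) (f : (thetaReplace o m b).Flag) :
    P f := by
  obtain ⟨⟨v, ⟨e, n⟩⟩, hf⟩ := f
  obtain ⟨he, x, hx, hv⟩ := thetaReplace_inc.1 hf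
  have := h e he ⟨(x, n), hx⟩
  dsimp only at hv
  subst hv
  exact this

theorem flag_inner_or_eq {m b : ℕ} (f : (graph m b).Flag) :
    IsInner m b f.1.1 ∨ ∃ σ, f = nodeFlag b σ (Nat.zero_le m) := by
  refine flag_cases (P := fun f => IsInner m b f.1.1 ∨ ∃ σ, f = nodeFlag b σ (Nat.zero_le m))
    ?_ ?_ ?_ f
  · exact fun σ j h => Or.inl inner_hub
  · intro σ j h
    rcases j.eq_zero_or_pos with rfl | h0
    exacts [Or.inr ⟨σ, rfl⟩, Or.inl (inner_node h0)]
  · exact fun σ j h0 h hl => Or.inl (inner_node h0)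

theorem outer_inner_cases (hl : G.Loopless) {P : (thetaReplace o m b).Flag → Prop}
    (h1 : ∀ f, P (outerFlag o m b f))
    (h2 : ∀ e (he : e ∈ G.edgeSet) f, IsInner (m e) (b e) f.1.1 → P (gadgetFlag o m b he f))
    (f : (thetaReplace o m b).Flag) : P f := by
  refine gadgetFlag_cases (fun e he f => ?_) f
  rcases flag_inner_or_eq f with hf | ⟨σ, rfl⟩
  · exact h2 e he f hf
  · rw [← outerFlag_tipFlag hl]
    exact h1 _

theorem gadgetFlag_val_of_inner {he : e ∈ G.edgeSet} {f : (graph (m e) (b e)).Flag}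
    (hf : IsInner (m e) (b e) f.1.1) :
    (gadgetFlag o m b he f).1 = (Sum.inr (e, f.1.1), (e, f.1.2)) :=
  Prod.ext (thetaPlace_of_inner hf) rfl

theorem exists_outerFlag (hl : G.Loopless) {f : (thetaReplace o m b).Flag} {u : α}
    (hf : f.1.1 = Sum.inl u) : ∃ g : G.Flag, outerFlag o m b g = f ∧ g.1.1 = u := by
  revert hf
  refine outer_inner_cases hl (P := fun f => f.1.1 = Sum.inl u → ∃ g : G.Flag,
    outerFlag o m b g = f ∧ g.1.1 = u) ?_ ?_ f
  · intro g hg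
    rw [outerFlag_val] at hg
    exact ⟨g, rfl, Sum.inl_injective hg⟩
  · intro e he g hg h
    rw [gadgetFlag_val_of_inner hg] at h
    simp at h

theorem gadgetFlag_opp {he : e ∈ G.edgeSet} {f h : (graph (m e) (b e)).Flag} (hf : Opp f h) :
    Opp (gadgetFlag o m b he f) (gadgetFlag o m b he h) :=
  ⟨Prod.ext rfl hf.1, isLink_thetaPlace he hf.2⟩

theorem exists_opp_of_gadgetFlag_opp {he : e ∈ G.edgeSet} {f : (graph (m e) (b e)).Flag}
    {h : (thetaReplace o m b).Flag} (hf : Opp (gadgetFlag o m b he f) h) :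
    ∃ g, Opp f g ∧ h = gadgetFlag o m b he g := by
  obtain ⟨g, hg⟩ := exists_opp f
  refine ⟨g, hg, Subtype.ext (Prod.ext ?_ (hf.1.trans (Prod.ext rfl hg.1.symm)))⟩
  exact hf.2.right_unique (gadgetFlag_opp hg).2

/-- The edges at an original vertex after replacement are pendant edges, exactly one for each old
edge. Hence cycles of the new graph restrict to cycles of the old one. -/
theorem finsum_inl (hl : G.Loopless) (z' : β × ℕ → ZMod 2) (z : β → ZMod 2)
    (h : ∀ e ∈ G.edgeSet, ∀ σ, z' (e, spoke σ 0) = z e) (u : α) :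
    ∑ᶠ p ∈ {p | (thetaReplace o m b).Inc p (Sum.inl u)}, z' p =
      ∑ᶠ e ∈ {e | G.Inc e u}, z e := by
  refine finsum_mem_eq_of_bijOn Prod.fst ⟨?_, ?_, ?_⟩ ?_
  · rintro ⟨e, n⟩ hp
    obtain ⟨he, σ, rfl, rfl⟩ := thetaReplace_inc_inl.1 hp
    exact (o.isLink_tip he σ).inc_left
  · rintro ⟨e, n⟩ hp ⟨e', n'⟩ hp' (rfl : e = e')
    obtain ⟨he, σ, rfl, rfl⟩ := thetaReplace_inc_inl.1 hp
    obtain ⟨-, τ, hτ, rfl⟩ := thetaReplace_inc_inl.1 hp'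
    rw [(o.tip_inj hl he).1 hτ]
  · intro e (he : G.Inc e u)
    obtain ⟨σ, rfl⟩ := o.exists_tip he
    exact ⟨(e, spoke σ 0), thetaReplace_inc_inl.2 ⟨he.edge_mem, σ, rfl, rfl⟩, rfl⟩
  · rintro ⟨e, n⟩ hp
    obtain ⟨he, σ, rfl, rfl⟩ := thetaReplace_inc_inl.1 hp
    exact h e he σ

theorem finsum_inr (z' : β × ℕ → ZMod 2) (he : e ∈ G.edgeSet) {x : ℕ}
    (hx : IsInner (m e) (b e) x) :
    ∑ᶠ p ∈ {p | (thetaReplace o m b).Inc p (Sum.inr (e, x))}, z' p =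
      ∑ᶠ n ∈ {n | (graph (m e) (b e)).Inc n x}, z' (e, n) := by
  symm
  refine finsum_mem_eq_of_bijOn (Prod.mk e) ⟨?_, ?_, ?_⟩ fun _ _ => rfl
  · exact fun n hn => thetaReplace_inc_inr.2 ⟨he, hx, rfl, hn⟩
  · exact fun n _ n' _ h => congrArg Prod.snd h
  · rintro ⟨e', n⟩ hp
    obtain ⟨-, -, rfl, hn⟩ := thetaReplace_inc_inr.1 hp
    exact ⟨n, hn, rfl⟩

/-- `φ'` is obtained from `φ` by replacing the edges by embedded gadgets. -/
def IsLift (φ : G.PlanarEmbedding) (φ' : (thetaReplace o m b).PlanarEmbedding) : Prop :=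
  (∀ f, φ'.rot (outerFlag o m b f) = outerFlag o m b (φ.rot f)) ∧
  ∀ e (he : e ∈ G.edgeSet) f, IsInner (m e) (b e) f.1.1 →
    φ'.rot (gadgetFlag o m b he f) = gadgetFlag o m b he (Theta.rot (m e) (b e) f)

theorem exists_rot_lift (hl : G.Loopless) (ρ : Equiv.Perm G.Flag) :
    ∃ ρ' : Equiv.Perm (thetaReplace o m b).Flag,
      (∀ f, ρ' (outerFlag o m b f) = outerFlag o m b (ρ f)) ∧
      ∀ e (he : e ∈ G.edgeSet) f, IsInner (m e) (b e) f.1.1 →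
        ρ' (gadgetFlag o m b he f) = gadgetFlag o m b he (Theta.rot (m e) (b e) f) := by
  let J := Equiv.ofBijective _ (gadgetFlags_bijective (o := o) (m := m) (b := b) hl)
  let ι : G.Flag ↪ (thetaReplace o m b).Flag := ⟨outerFlag o m b, outerFlag_injective⟩
  let ρ₁ : Equiv.Perm (thetaReplace o m b).Flag :=
    J.permCongr (Equiv.sigmaCongrRight fun e : G.edgeSet => Theta.rot (m e) (b e))
  have hρ₁ : ∀ e (he : e ∈ G.edgeSet) f, ρ₁ (gadgetFlag o m b he f) =
      gadgetFlag o m b he (Theta.rot (m e) (b e) f) := by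
    intro e he f
    have : gadgetFlag o m b he f = J ⟨⟨e, he⟩, f⟩ := rfl
    rw [this]
    simp only [ρ₁, Equiv.permCongr_apply, Equiv.symm_apply_apply]
    rfl
  -- The two factors do not interfere: `ρ₁` fixes the half-edges at terminals, and the other factor
  -- moves only these.
  refine ⟨ρ₁ * ρ.viaEmbedding ι, fun f => ?_, fun e he f hf => ?_⟩
  · have h1 : ρ.viaEmbedding ι (outerFlag o m b f) = outerFlag o m b (ρ f) :=
      ρ.viaEmbedding_apply ι f
    rw [Equiv.Perm.mul_apply, h1, outerFlag, hρ₁, rot_nodeFlag_zero]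
  · rw [Equiv.Perm.mul_apply, ρ.viaEmbedding_apply_of_notMem ι, hρ₁]
    rintro ⟨g, hg⟩
    have h1 := congrArg (fun f : (thetaReplace o m b).Flag => f.1.1) hg
    simp only [gadgetFlag_val_of_inner hf] at h1
    have h2 : (outerFlag o m b g).1.1 = Sum.inr (e, f.1.1) := h1
    rw [outerFlag_val] at h2
    simp at h2

/-- A cycle of the new graph has the same value on both pendant edges of a gadget, so it induces a
cycle of `G`. Its face function on `G` prescribes the values at the terminals, and `exists_faces`
extends it into each gadget. -/
theorem exists_lift (hG : G.IsTwoConnected) (hfin : G.IsFinite)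
    (hfin' : (thetaReplace o m b).IsFinite) (hm : ∀ e ∈ G.edgeSet, 0 < m e)
    (φ : G.PlanarEmbedding) : ∃ φ' : (thetaReplace o m b).PlanarEmbedding, IsLift φ φ' := by
  have hl := hG.loopless
  have hG' := thetaReplace_isTwoConnected (o := o) (b := b) hG hm
  obtain ⟨ρ', h1, h2⟩ := exists_rot_lift (o := o) (m := m) (b := b) hl φ.rot
  have := hfin.finite_flag
  have hv : ∀ f, (ρ' f).1.1 = f.1.1 := by
    refine outer_inner_cases hl (fun f => ?_) fun e he f hf => ?_
    · rw [h1, outerFlag_val, outerFlag_val, φ.rot_vertex]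
    · rw [h2 e he f hf]
      change o.thetaPlace m b e _ = o.thetaPlace m b e _
      rw [Theta.rot_vertex]
  have hinner : ∀ {e}, ∀ f : (graph (m e) (b e)).Flag, IsInner (m e) (b e) f.1.1 →
      IsInner (m e) (b e) (Theta.rot (m e) (b e) f).1.1 := fun f hf => by
    rwa [Theta.rot_vertex]
  have hc : ∀ f g : (thetaReplace o m b).Flag, f.1.1 = g.1.1 → ρ'.SameCycle f g := by
    refine outer_inner_cases hl (fun f => ?_) fun e he f hf => ?_ <;>
      refine outer_inner_cases hl (fun g => ?_) fun e' he' g hg => ?_ <;> intro hfg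
    · rw [outerFlag_val, outerFlag_val] at hfg
      obtain ⟨k, -, hk⟩ := (φ.rot_cyclic f g (Sum.inl_injective hfg)).exists_pow_eq'
      refine ⟨k, ?_⟩
      rw [zpow_natCast, pow_comm_of_forall (fun _ => True) (fun _ _ => trivial)
        (fun x _ => h1 x) trivial, hk]
    · rw [outerFlag_val, gadgetFlag_val_of_inner hg] at hfg
      simp at hfg
    · rw [outerFlag_val, gadgetFlag_val_of_inner hf] at hfg
      simp at hfg
    · rw [gadgetFlag_val_of_inner hf, gadgetFlag_val_of_inner hg, Sum.inr.injEq,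
        Prod.mk.injEq] at hfg
      obtain ⟨rfl, hfg⟩ := hfg
      have := (isFinite (m := m e) (b := b e)).finite_flag
      obtain ⟨k, -, hk⟩ := (Theta.rot_cyclic f g hfg).exists_pow_eq'
      refine ⟨k, ?_⟩
      rw [zpow_natCast, pow_comm_of_forall (fun f => IsInner (m e) (b e) f.1.1) hinner
        (fun x hx => h2 e he x hx) hf, hk]
  have hφ := (hG.euler_iff_bounding hfin φ.rot φ.rot_vertex φ.rot_cyclic).1 φ.euler
  refine ⟨⟨ρ', hv, hc, (hG'.euler_iff_bounding hfin' ρ' hv hc).2 ?_⟩, h1, h2⟩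
  intro z' hz'
  let z : β → ZMod 2 := fun e => z' (e, spoke false 0)
  have hg : ∀ e : G.edgeSet, ∀ a, _ := fun e a =>
    exists_faces (m := m e) (b := b e) (fun n => z' (e, n)) (fun x hx hxi => by
      rw [← finsum_inr (o := o) z' e.2 hxi]
      exact hz' _ (thetaReplace_inr_mem.2 ⟨e.2, hx, hxi⟩)) a
  have hz0 : ∀ e ∈ G.edgeSet, ∀ σ, z' (e, spoke σ 0) = z e := by
    intro e he σ
    cases σ
    exacts [rfl, (hg ⟨e, he⟩ 0).1.symm]
  obtain ⟨q, hq⟩ := hφ z (fun u hu => by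
    rw [← finsum_inl hl z' z hz0]
    exact hz' _ (thetaReplace_inl_mem.2 hu))
  choose qe hqf hqt hqe using fun e : G.edgeSet => (hg e (q (tipFlag o e.2 false))).2
  -- The face function of the gadget is normalised at the first terminal only. At the second one it
  -- agrees with `q` because both change by `z e` across the edge.
  have hqterm : ∀ e (he : e ∈ G.edgeSet) σ,
      qe ⟨e, he⟩ (nodeFlag (b e) σ (Nat.zero_le _)) = q (tipFlag o he σ) := by
    intro e he σ
    cases σ
    · exact hqf ⟨e, he⟩
    · refine (hqt ⟨e, he⟩).trans ?_
      have : _ = z e := (hq _ _ (tipFlag_opp (o := o) (he := he) (σ := false))).1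
      change _ + z e = _
      rw [← this, ← add_assoc, CharTwo.add_self_eq_zero, zero_add]
      rfl
  let J := Equiv.ofBijective _ (gadgetFlags_bijective (o := o) (m := m) (b := b) hl)
  let q' : (thetaReplace o m b).Flag → ZMod 2 := fun f => qe (J.symm f).1 (J.symm f).2
  have hq' : ∀ e (he : e ∈ G.edgeSet) f, q' (gadgetFlag o m b he f) = qe ⟨e, he⟩ f := by
    intro e he f
    have : J.symm (gadgetFlag o m b he f) = ⟨⟨e, he⟩, f⟩ := J.symm_apply_apply ⟨⟨e, he⟩, f⟩
    change qe (J.symm _).1 (J.symm _).2 = _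
    rw [this]
  refine ⟨q', fun f h hfh => ?_⟩
  revert hfh
  refine gadgetFlag_cases (P := fun f => Opp f h → q' f + q' h = z' f.1.2 ∧ q' (ρ' h) = q' f) ?_ f
  intro e he f hfh
  obtain ⟨g, hfg, rfl⟩ := exists_opp_of_gadgetFlag_opp hfh
  have hqfg := hqe ⟨e, he⟩ f g hfg
  refine ⟨?_, ?_⟩
  · rw [hq', hq', hqfg.1]
    rfl
  · rcases flag_inner_or_eq g with hgi | ⟨σ, rfl⟩
    · rw [h2 e he g hgi, hq', hq', hqfg.2 hgi]
    · rw [← outerFlag_tipFlag hl, h1]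
      obtain ⟨e', he', τ, h3⟩ : ∃ e', ∃ he' : e' ∈ G.edgeSet, ∃ τ,
          φ.rot (tipFlag o he σ) = tipFlag o he' τ :=
        tipFlag_cases (P := fun f => ∃ e', ∃ he' : e' ∈ G.edgeSet, ∃ τ, f = tipFlag o he' τ) o
          (fun e he σ => ⟨e, he, σ, rfl⟩) _
      rw [h3, outerFlag_tipFlag hl, hq', hqterm, ← h3, hq',
        (hq _ _ (tipFlag_opp (o := o) (he := he) (σ := σ)).symm).2]
      -- The step of face tracing in `G` identifies the face after the turn as that of the far end
      -- of `e`. It remains to see that `q'` carries this value at `f`, the hub's half of the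
      -- pendant edge.
      have h4 := (hq _ _ (tipFlag_opp (o := o) (he := he) (σ := σ)).symm).1
      have h5 := hqfg.1
      rw [hqterm] at h5
      have h6 : z' (e, f.1.2) = z e := by
        have : f.1.2 = spoke σ 0 := hfg.1.symm
        rw [this]
        exact hz0 e he σ
      have h7 : q (tipFlag o he !σ) + q (tipFlag o he σ) = z e := h4
      have h8 : qe ⟨e, he⟩ f + q (tipFlag o he σ) = z e := h5.trans h6
      exact add_right_cancel (h7.trans h8.symm)

end

/-! ### The restriction of an embedding to the original graph -/

/-- If the differences of consecutive values of `F` along a cycle of `ρ` vanish except at two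
elements, then the values at these two elements differ by the difference at the first one. -/
theorem eq_add_of_two_support {X : Type*} [Finite X] {ρ : Equiv.Perm X} {F g : X → ZMod 2}
    (hF : ∀ x, F (ρ x) = F x + g x) {x y : X} (hxy : ρ.SameCycle x y) (hne : x ≠ y)
    (hg : ∀ w, ρ.SameCycle x w → w ≠ x → w ≠ y → g w = 0) : F y = F x + g x := by
  classical
  have hex : ∃ k : ℕ, (ρ ^ k) x = y := by
    obtain ⟨k, -, hk⟩ := hxy.exists_pow_eq'
    exact ⟨k, hk⟩
  have key : ∀ j, j < Nat.find hex → F ((ρ ^ (j + 1)) x) = F x + g x := by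
    intro j
    induction j with
    | zero => exact fun _ => hF x
    | succ j ih =>
      intro hj
      rw [pow_succ', Equiv.Perm.mul_apply, hF, ih (by omega), hg ((ρ ^ (j + 1)) x), add_zero]
      · exact ⟨(j + 1 : ℕ), by rw [zpow_natCast]⟩
      -- A return to `x` before the first visit to `y` would make `y` reachable in fewer steps.
      · intro h
        refine Nat.find_min hex (m := Nat.find hex - (j + 1)) (by omega) ?_
        have := Nat.find_spec hex
        rwa [← Nat.sub_add_cancel hj.le, pow_add, Equiv.Perm.mul_apply, h] at this
      · exact Nat.find_min hex hj
  have hpos : 0 < Nat.find hex := by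
    rw [Nat.find_pos]
    exact hne
  have := key (Nat.find hex - 1) (by omega)
  rwa [Nat.sub_add_cancel hpos, Nat.find_spec hex] at this

section

variable {α β : Type*} {G : Graph α β} {o : G.EndOrder} {m b : β → ℕ} {e : β}

/-- The edges of a path between the terminals whose middle part is the path with index `j`. -/
def OnPath (j n : ℕ) : Prop := ∃ σ, n = spoke σ 0 ∨ n = spoke σ j

theorem onPath_spoke {i j : ℕ} {σ : Bool} : OnPath j (spoke σ i) ↔ i = 0 ∨ i = j := by
  constructor
  · rintro ⟨τ, h | h⟩
    exacts [Or.inl (spoke_inj.1 h).2, Or.inr (spoke_inj.1 h).2]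
  · rintro (rfl | rfl)
    exacts [⟨σ, Or.inl rfl⟩, ⟨σ, Or.inr rfl⟩]

theorem not_onPath_cross {i j : ℕ} : ¬ OnPath j (cross i) := by
  rintro ⟨τ, h | h⟩ <;> exact spoke_ne_cross h.symm

-- Each inner vertex of the gadget meets either none or exactly two edges of the path through the
-- pendant edges and the short path `j`.
open Classical in
theorem path_sum {m b j : ℕ} (h0 : 0 < j) (hj : j ≤ m) (hl : ¬ Long m b j) (c : ZMod 2) {x : ℕ}
    (hx : x ∈ (graph m b).vertexSet) (hxi : IsInner m b x) :
    ∑ᶠ n ∈ {n | (graph m b).Inc n x}, (if OnPath j n then c else 0) = 0 := by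
  rcases hx with ⟨σ, rfl⟩ | ⟨σ, i, hi, rfl⟩
  · rw [finsum_hub]
    simp only [onPath_spoke]
    rw [← Finset.sum_filter]
    have : (Finset.range (m + 1)).filter (fun i => i = 0 ∨ i = j) = {0, j} := by
      ext i
      simp only [Finset.mem_filter, Finset.mem_range, Finset.mem_insert, Finset.mem_singleton]
      omega
    rw [this, Finset.sum_pair h0.ne, CharTwo.add_self_eq_zero]
  · have hi0 : 0 < i := Nat.pos_of_ne_zero fun h => hxi σ (by rw [h])
    by_cases hil : Long m b i
    · rw [finsum_node_long _ hi0 hi hil, if_neg not_onPath_cross, if_neg, add_zero]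
      rw [onPath_spoke]
      rintro (rfl | rfl)
      exacts [hi0.ne' rfl, hl hil]
    · rw [finsum_node_short _ hi hil]
      simp only [onPath_spoke, CharTwo.add_self_eq_zero]

/-- Nothing is known about how the gadgets are embedded. A cycle of `G` is therefore routed through
one short path of each gadget; the face values beside such a route are constant along each of its
sides, so they can be read off at the terminals. -/
theorem exists_restriction (hG : G.IsTwoConnected) (hfin : G.IsFinite)
    (hfin' : (thetaReplace o m b).IsFinite) (hm : ∀ e ∈ G.edgeSet, 2 * b e < m e)
    (φ' : (thetaReplace o m b).PlanarEmbedding) :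
    ∃ φ : G.PlanarEmbedding, ∀ f, φ'.rot (outerFlag o m b f) = outerFlag o m b (φ.rot f) := by
  classical
  have hl := hG.loopless
  have hG' := thetaReplace_isTwoConnected (o := o) (b := b) hG fun e he =>
    (Nat.zero_le _).trans_lt (hm e he)
  have := hfin.finite_flag
  have := hfin'.finite_flag
  obtain ⟨ρ, hρ⟩ := exists_perm_comm (outerFlag_injective (o := o) (m := m) (b := b)) φ'.rot
    fun f => by
      obtain ⟨g, hg, -⟩ := exists_outerFlag hl (f := φ'.rot (outerFlag o m b f)) (u := f.1.1)
        (by rw [φ'.rot_vertex, outerFlag_val])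
      exact ⟨g, hg⟩
  have hv : ∀ f, (ρ f).1.1 = f.1.1 := by
    intro f
    have := φ'.rot_vertex (outerFlag o m b f)
    rw [← hρ, outerFlag_val, outerFlag_val] at this
    exact Sum.inl_injective this
  have hc : ∀ f g : G.Flag, f.1.1 = g.1.1 → ρ.SameCycle f g := by
    intro f g hfg
    obtain ⟨k, -, hk⟩ := (φ'.rot_cyclic (outerFlag o m b f) (outerFlag o m b g) (by
      rw [outerFlag_val, outerFlag_val, hfg])).exists_pow_eq'
    refine ⟨k, ?_⟩
    rw [zpow_natCast]
    rw [pow_comm_of_forall (fun _ => True) (fun _ _ => trivial) (fun x _ => (hρ x).symm)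
      trivial] at hk
    exact outerFlag_injective hk
  have hφ' := (hG'.euler_iff_bounding hfin' φ'.rot φ'.rot_vertex φ'.rot_cyclic).1 φ'.euler
  refine ⟨⟨ρ, hv, hc, (hG.euler_iff_bounding hfin ρ hv hc).2 ?_⟩, fun f => (hρ f).symm⟩
  intro z hz
  -- Path `b + 1` is the first one after the initial long paths; it exists and is short because `2 *
  -- b < m`.
  let z' : β × ℕ → ZMod 2 := fun p => if OnPath (b p.1 + 1) p.2 then z p.1 else 0
  have hz0 : ∀ e ∈ G.edgeSet, ∀ σ, z' (e, spoke σ 0) = z e := fun e _ σ =>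
    if_pos (onPath_spoke.2 (Or.inl rfl))
  have hshort : ∀ e ∈ G.edgeSet, ¬ Long (m e) (b e) (b e + 1) := by
    intro e he
    have := hm e he
    unfold Long
    omega
  obtain ⟨q', hq'⟩ := hφ' z' (by
    rintro (u | ⟨e, x⟩) hv
    · rw [finsum_inl hl z' z hz0]
      exact hz u (thetaReplace_inl_mem.1 hv)
    · obtain ⟨he, hx, hxi⟩ := thetaReplace_inr_mem.1 hv
      rw [finsum_inr z' he hxi]
      have := hm e he
      exact path_sum (Nat.succ_pos _) (by omega) (hshort e he) (z e) hx hxi)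
  have hadd : ∀ f h, Opp f h → q' h = q' f + z' f.1.2 := by
    intro f h hfh
    rw [← (hq' f h hfh).1, ← add_assoc, CharTwo.add_self_eq_zero, zero_add]
  have hrot : ∀ f, q' (φ'.rot f) = q' f + z' f.1.2 := by
    intro f
    obtain ⟨h, hfh⟩ := exists_opp f
    rw [(hq' h f hfh.symm).2, hadd f h hfh]
  -- Of the half-edges at an inner vertex, only `f` and `g` can lie on the route. All other turns
  -- leave the face value unchanged, so going round from `f` to `g` changes it by the value at `f`
  -- alone.
  have hturn : ∀ e (he : e ∈ G.edgeSet) (f g : (graph (m e) (b e)).Flag),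
      IsInner (m e) (b e) f.1.1 → f.1.1 = g.1.1 → f ≠ g →
      (∀ h : (graph (m e) (b e)).Flag, h.1.1 = f.1.1 → h ≠ f → h ≠ g →
        ¬ OnPath (b e + 1) h.1.2) →
      q' (gadgetFlag o m b he g) = q' (gadgetFlag o m b he f) + z' (e, f.1.2) := by
    intro e he f g hf hfg hne hon
    have hv : (gadgetFlag o m b he f).1.1 = (gadgetFlag o m b he g).1.1 := by
      rw [gadgetFlag_val_of_inner hf, gadgetFlag_val_of_inner (hfg ▸ hf), hfg]
    refine eq_add_of_two_support hrot (φ'.rot_cyclic _ _ hv)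
      (fun h => hne ((gadgetFlag_inj hl).1 h)) ?_
    intro w hw hwf hwg
    have hwv : w.1.1 = Sum.inr (e, f.1.1) := by
      obtain ⟨k, -, rfl⟩ := hw.exists_pow_eq'
      have : ∀ k : ℕ, ((φ'.rot ^ k) (gadgetFlag o m b he f)).1.1 =
          (gadgetFlag o m b he f).1.1 := by
        intro k
        induction k with
        | zero => rfl
        | succ k ih => rw [pow_succ', Equiv.Perm.mul_apply, φ'.rot_vertex, ih]
      rw [this, gadgetFlag_val_of_inner hf]
    revert hwv hwf hwg
    refine outer_inner_cases hl (P := fun w => w ≠ gadgetFlag o m b he f →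
      w ≠ gadgetFlag o m b he g → w.1.1 = Sum.inr (e, f.1.1) → z' w.1.2 = 0) ?_ ?_ w
    · intro w _ _ hw
      rw [outerFlag_val] at hw
      simp at hw
    · intro e' he' w hwi h1 h2 hw
      rw [gadgetFlag_val_of_inner hwi, Sum.inr.injEq, Prod.mk.injEq] at hw
      obtain ⟨rfl, hw⟩ := hw
      exact if_neg (hon w hw (fun h => h1 (by rw [h])) (fun h => h2 (by rw [h])))
  -- The route consists of four edges with three turns between them. Each of the seven moves adds `z
  -- e`, and `7 * z e = z e` modulo 2.
  have hpass : ∀ e (he : e ∈ G.edgeSet),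
      q' (outerFlag o m b (tipFlag o he true)) =
        q' (outerFlag o m b (tipFlag o he false)) + z e := by
    intro e he
    have h0 : 0 ≤ m e := Nat.zero_le _
    have hj : b e + 1 ≤ m e := by have := hm e he; omega
    have hs := hshort e he
    have hzj : ∀ σ, z' (e, spoke σ (b e + 1)) = z e := fun σ =>
      if_pos (onPath_spoke.2 (Or.inr rfl))
    have hopp : ∀ σ {j} (h : j ≤ m e),
        Opp (gadgetFlag o m b he (nodeFlag (b e) σ h)) (gadgetFlag o m b he (hubFlag (b e) σ h)) :=
      fun σ j h => gadgetFlag_opp ⟨rfl, (isLink_spoke h).symm⟩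
    have hubturn : ∀ σ {i j} (hi : i ≤ m e) (hj : j ≤ m e), i ≠ j →
        (∀ k, k = 0 ∨ k = b e + 1 → k = i ∨ k = j) →
        q' (gadgetFlag o m b he (hubFlag (b e) σ hj)) =
          q' (gadgetFlag o m b he (hubFlag (b e) σ hi)) + z' (e, spoke σ i) := by
      intro σ i j hi hj hij hk
      refine hturn e he (hubFlag (b e) σ hi) (hubFlag (b e) σ hj) inner_hub rfl ?_ ?_
      · intro h
        have := congrArg (fun f : (graph (m e) (b e)).Flag => f.1.2) h
        exact hij (spoke_inj.1 this).2
      · rintro ⟨⟨x, n⟩, hxn⟩ h h1 h2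
        have hx : x = hub σ := h
        subst hx
        obtain ⟨k, hkm, rfl⟩ := inc_hub.1 hxn
        rw [onPath_spoke]
        intro hk'
        rcases hk k hk' with rfl | rfl
        exacts [h1 rfl, h2 rfl]
    have hz2 : ∀ a : ZMod 2, a + z e + z e = a := fun a => by
      rw [add_assoc, CharTwo.add_self_eq_zero, add_zero]
    rw [outerFlag_tipFlag hl, outerFlag_tipFlag hl]
    have e1 := hadd _ _ (hopp false h0)
    have e2 := hubturn false h0 hj (by omega) (by omega)
    have e3 := hadd _ _ (hopp false hj).symm
    have e4 := hturn e he (nodeFlag (b e) false hj) (nodeFlag (b e) true hj)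
      (inner_node (Nat.succ_pos _)) (node_eq_of_not_long hs) (by
        intro h
        have := congrArg (fun f : (graph (m e) (b e)).Flag => f.1.2) h
        simpa using (spoke_inj.1 this).1) (by
        rintro ⟨⟨x, n⟩, hxn⟩ h h1 h2
        have hx : x = node (m e) (b e) false (b e + 1) := h
        subst hx
        rcases (inc_node hj).1 hxn with rfl | ⟨-, rfl⟩ | ⟨-, hl, -⟩
        · exact (h1 rfl).elim
        · exact (h2 (Subtype.ext (Prod.ext (node_eq_of_not_long hs) rfl))).elim
        · exact (hs hl).elim)
    have e5 := hadd _ _ (hopp true hj)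
    have e6 := hubturn true hj h0 (by omega) (by omega)
    have e7 := hadd _ _ (hopp true h0).symm
    change _ = _ + z' (e, spoke false 0) at e1
    change _ = _ + z' (e, spoke false (b e + 1)) at e3 e4
    change _ = _ + z' (e, spoke true (b e + 1)) at e5
    change _ = _ + z' (e, spoke true 0) at e7
    rw [hz0 e he] at e1 e2 e7
    rw [hzj] at e3 e4 e5 e6
    rw [e7, e6, e5, e4, e3, e2, e1]
    simp only [hz2]
  have hpass' : ∀ e (he : e ∈ G.edgeSet) σ, q' (outerFlag o m b (tipFlag o he (!σ))) =
      q' (outerFlag o m b (tipFlag o he σ)) + z e := by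
    intro e he σ
    cases σ
    · exact hpass e he
    · change q' (outerFlag o m b (tipFlag o he false)) = _
      rw [hpass e he, add_assoc, CharTwo.add_self_eq_zero, add_zero]
  refine ⟨fun f => q' (outerFlag o m b f), fun f h hfh => ?_⟩
  obtain ⟨e, he, σ, rfl⟩ : ∃ e, ∃ he : e ∈ G.edgeSet, ∃ σ, f = tipFlag o he σ :=
    tipFlag_cases (P := fun f => ∃ e, ∃ he : e ∈ G.edgeSet, ∃ σ, f = tipFlag o he σ) o
      (fun e he σ => ⟨e, he, σ, rfl⟩) _
  obtain rfl : h = tipFlag o he (!σ) :=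
    Subtype.ext (Prod.ext (hfh.2.right_unique (o.isLink_tip he σ)) hfh.1)
  refine ⟨?_, ?_⟩ <;> beta_reduce
  · rw [hpass', ← add_assoc, CharTwo.add_self_eq_zero, zero_add]
    rfl
  · rw [hρ, hrot, outerFlag_val, hpass']
    have : z' ((tipFlag o he (!σ)).1.2, spoke (o.side (tipFlag o he (!σ))) 0) = z e := hz0 e he _
    rw [this, add_assoc, CharTwo.add_self_eq_zero, add_zero]

end

/-! ### Embeddings between gadgets -/

namespace Theta

/-- The reversal of the order of the paths. -/
def flip (m : ℕ) (τ : Bool) (j : ℕ) : ℕ := if j = 0 then 0 else if τ then m + 1 - j else j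

/-- The shift of the paths by `d`. -/
def shift (d j : ℕ) : ℕ := if j = 0 then 0 else j + d

/-- The gadget with parameters `m` and `b` embeds into that with parameters `m'` and `b'` so that
the paths are shifted by `d`. -/
def Fits (m b m' b' d : ℕ) : Prop := d = 0 ∧ m' = m ∧ b' = b ∨ b = 0 ∧ d = b' ∧ m + 2 * b' ≤ m'

section Arc

variable {m m' d x y : ℕ} {σ τ : Bool} {R : ℕ → Prop}

/-- In the cyclic order at the hub `σ`, the path `y` is the first one with property `R` after `x`
(provided that it has this property). -/
def Arc (m : ℕ) (σ : Bool) (R : ℕ → Prop) (x y : ℕ) : Prop :=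
  ∃ k, 0 < k ∧ (next m σ)^[k] x = y ∧ ∀ i, 0 < i → i < k → ¬ R ((next m σ)^[i] x)

theorem iterate_next_false (i : ℕ) (h : x + i ≤ m) : (next m false)^[i] x = x + i := by
  induction i with
  | zero => rfl
  | succ i ih =>
    rw [Function.iterate_succ_apply', ih (by omega)]
    simp only [next, Bool.false_eq_true, if_false]
    split_ifs <;> omega

theorem iterate_next_true (i : ℕ) (h : i ≤ x) : (next m true)^[i] x = x - i := by
  induction i with
  | zero => rfl
  | succ i ih =>
    rw [Function.iterate_succ_apply', ih (by omega)]
    simp only [next, if_true]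
    split_ifs <;> omega

theorem iterate_next_true_zero (i : ℕ) (h : i ≤ m) : (next m true)^[i + 1] 0 = m - i := by
  rw [Function.iterate_succ_apply]
  exact iterate_next_true i h

theorem arc_up (hxy : x < y) (hy : y ≤ m) (h : ∀ w, x < w → w < y → ¬ R w) :
    Arc m false R x y := by
  refine ⟨y - x, by omega, by rw [iterate_next_false _ (by omega)]; omega, fun i h0 hi => ?_⟩
  rw [iterate_next_false _ (by omega)]
  exact h _ (by omega) (by omega)

theorem arc_down (hxy : x < y) (h : ∀ w, x < w → w < y → ¬ R w) : Arc m true R y x := by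
  refine ⟨y - x, by omega, by rw [iterate_next_true _ (by omega)]; omega, fun i h0 hi => ?_⟩
  rw [iterate_next_true _ (by omega)]
  exact h _ (by omega) (by omega)

theorem arc_wrap_up (hx : x ≤ m) (h : ∀ w, x < w → w ≤ m → ¬ R w) : Arc m false R x 0 := by
  refine ⟨m - x + 1, by omega, ?_, fun i h0 hi => ?_⟩
  · rw [Function.iterate_succ_apply', iterate_next_false _ (by omega)]
    simp [next]
    omega
  · rw [iterate_next_false _ (by omega)]
    exact h _ (by omega) (by omega)

theorem arc_wrap_down (hx : x ≤ m) (h : ∀ w, x < w → w ≤ m → ¬ R w) : Arc m true R 0 x := by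
  refine ⟨m - x + 1, by omega, ?_, fun i h0 hi => ?_⟩
  · rw [iterate_next_true_zero _ (by omega)]
    omega
  · obtain ⟨i, rfl⟩ := Nat.exists_eq_succ_of_ne_zero h0.ne'
    rw [iterate_next_true_zero _ (by omega)]
    exact h _ (by omega) (by omega)

/-- The paths that are not hit have indices `1, …, d` and `m + d + 1, …, m'`. They form one cyclic
interval interrupted only by index `0`, so skipping them preserves the cyclic order of the others.
-/
theorem arc_shift (hm : 0 < m) (hmd : m + d ≤ m') {j : ℕ} (hj : j ≤ m) :
    Arc m' σ (fun w => ∃ i ≤ m, w = shift d i) (shift d j) (shift d (next m σ j)) := by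
  have hR : ∀ w, (0 < w ∧ w ≤ d) ∨ m + d < w → ¬ ∃ i ≤ m, w = shift d i := by
    rintro w hw ⟨i, hi, rfl⟩
    unfold shift at hw
    split_ifs at hw <;> omega
  cases σ
  · by_cases hjm : j = m
    · simp only [next, hjm, shift, hm.ne', if_true, if_false, Bool.false_eq_true]
      exact arc_wrap_up hmd fun w h _ => hR w (Or.inr h)
    · simp only [next, hjm, if_false, Bool.false_eq_true]
      refine arc_up ?_ ?_ fun w h1 h2 => hR w ?_
      · unfold shift; split_ifs <;> first | contradiction | omega
      · unfold shift; split_ifs <;> omega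
      · unfold shift at h1 h2; split_ifs at h1 h2 <;> omega
  · by_cases hj0 : j = 0
    · simp only [next, hj0, shift, hm.ne', if_true, if_false]
      exact arc_wrap_down hmd fun w h _ => hR w (Or.inr h)
    · simp only [next, hj0, if_true, if_false]
      refine arc_down ?_ fun w h1 h2 => hR w ?_
      · unfold shift; split_ifs <;> omega
      · unfold shift at h1 h2; split_ifs at h1 h2 <;> omega

theorem flip_le {j : ℕ} (hj : j ≤ m) : flip m τ j ≤ m := by
  unfold flip; split_ifs <;> omega

/-- The half-turn symmetry: exchanging the hubs reverses the direction of their rotators, and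
reversing the numbering of the paths compensates for this. -/
theorem flip_next {j : ℕ} (hj : j ≤ m) :
    flip m τ (next m σ j) = next m (σ ^^ τ) (flip m τ j) := by
  cases σ <;> cases τ <;> simp [flip, next] <;> split_ifs <;> omega

end Arc

section

variable {m b m' b' d j : ℕ} {σ τ : Bool}

/-- The path of the larger gadget to which the path `j` is mapped. -/
def pathMap (m d : ℕ) (τ : Bool) (j : ℕ) : ℕ := shift d (flip m τ j)

theorem pathMap_zero : pathMap m d τ 0 = 0 := by simp [pathMap, flip, shift]

theorem pathMap_pos (h0 : 0 < j) (hj : j ≤ m) : 0 < pathMap m d τ j := by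
  unfold pathMap shift flip; split_ifs <;> omega

theorem pathMap_le (hf : Fits m b m' b' d) (hj : j ≤ m) : pathMap m d τ j ≤ m' := by
  rcases hf with ⟨rfl, rfl, rfl⟩ | ⟨rfl, rfl, h⟩ <;> unfold pathMap shift flip <;> split_ifs <;>
    omega

/-- Either the gadgets are equal and the pattern of long paths is symmetric under reversal, or the
source has no long path of positive index and the shift puts its paths strictly between the long
ones of the target. -/
theorem long_pathMap (hf : Fits m b m' b' d) (h0 : 0 < j) (hj : j ≤ m) :
    Long m' b' (pathMap m d τ j) ↔ Long m b j := by
  rcases hf with ⟨rfl, rfl, rfl⟩ | ⟨rfl, rfl, h⟩ <;> unfold Long pathMap shift flip <;>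
    split_ifs <;> omega

theorem long_pathMap' (hf : Fits m b m' b' d) (hj : j ≤ m) :
    Long m' b' (pathMap m d τ j) ↔ Long m b j := by
  rcases j.eq_zero_or_pos with rfl | h0
  · simp [pathMap_zero, long_zero]
  · exact long_pathMap hf h0 hj

theorem pathMap_inj {i : ℕ} (hi : i ≤ m) (hj : j ≤ m) (h : pathMap m d τ i = pathMap m d τ j) :
    i = j := by
  unfold pathMap shift flip at h; split_ifs at h <;> omega

/-- The embedding of gadgets on vertices. -/
def vertexMap (m m' b' d : ℕ) (τ : Bool) (x : ℕ) : ℕ :=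
  if x < 2 then hub ((x == 1) ^^ τ)
  else node m' b' ((x % 2 == 1) ^^ τ) (pathMap m d τ (x / 2 - 1))

/-- The embedding of gadgets on edges. -/
def edgeMap (m d : ℕ) (τ : Bool) (n : ℕ) : ℕ :=
  if n % 3 = 2 then cross (pathMap m d τ (n / 3))
  else spoke ((n % 3 == 1) ^^ τ) (pathMap m d τ (n / 3))

theorem vertexMap_hub : vertexMap m m' b' d τ (hub σ) = hub (σ ^^ τ) := by
  cases σ <;> simp [vertexMap, hub]

theorem vertexMap_node (hf : Fits m b m' b' d) (hj : j ≤ m) :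
    vertexMap m m' b' d τ (node m b σ j) = node m' b' (σ ^^ τ) (pathMap m d τ j) := by
  have h1 : node m b σ j / 2 - 1 = j := by
    have := Bool.toNat_le σ
    unfold node; split_ifs <;> omega
  rw [vertexMap, if_neg node_ge, h1]
  by_cases hl : Long m b j
  · rw [node_mod hl]
    cases σ <;> rfl
  -- On a short path the index `σ` cannot be recovered from the vertex, but there both indices name
  -- the same vertex, and the image path is short as well.
  · exact node_eq_of_not_long fun h => hl ((long_pathMap' hf hj).1 h)

theorem edgeMap_spoke : edgeMap m d τ (spoke σ j) = spoke (σ ^^ τ) (pathMap m d τ j) := by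
  have h2 : σ.toNat ≠ 2 := by cases σ <;> simp
  rw [edgeMap, spoke_mod, spoke_div, if_neg h2]
  cases σ <;> rfl

theorem edgeMap_cross : edgeMap m d τ (cross j) = cross (pathMap m d τ j) := by
  rw [edgeMap, cross_mod, cross_div, if_pos rfl]

theorem isLink_map (hf : Fits m b m' b' d) {n x y : ℕ} (h : (graph m b).IsLink n x y) :
    (graph m' b').IsLink (edgeMap m d τ n) (vertexMap m m' b' d τ x)
      (vertexMap m m' b' d τ y) := by
  rcases h with ⟨σ, j, h, rfl, ⟨rfl, rfl⟩ | ⟨rfl, rfl⟩⟩ | ⟨σ, j, h0, h, hl, rfl, rfl, rfl⟩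
  · rw [edgeMap_spoke, vertexMap_hub, vertexMap_node hf h]
    exact isLink_spoke (pathMap_le hf h)
  · rw [edgeMap_spoke, vertexMap_hub, vertexMap_node hf h]
    exact (isLink_spoke (pathMap_le hf h)).symm
  · rw [edgeMap_cross, vertexMap_node hf h, vertexMap_node hf h, Bool.not_xor]
    exact isLink_cross (pathMap_pos h0 h) (pathMap_le hf h) ((long_pathMap hf h0 h).2 hl)

theorem vertexMap_inj (hf : Fits m b m' b' d) {x y : ℕ} (hx : x ∈ (graph m b).vertexSet)
    (hy : y ∈ (graph m b).vertexSet)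
    (h : vertexMap m m' b' d τ x = vertexMap m m' b' d τ y) : x = y := by
  rcases hx with ⟨σ, rfl⟩ | ⟨σ, j, hj, rfl⟩ <;> rcases hy with ⟨ρ, rfl⟩ | ⟨ρ, i, hi, rfl⟩
  · rw [vertexMap_hub, vertexMap_hub, hub_inj, Bool.xor_left_inj] at h
    rw [h]
  · rw [vertexMap_hub, vertexMap_node hf hi] at h
    exact (hub_ne_node h).elim
  · rw [vertexMap_hub, vertexMap_node hf hj] at h
    exact (hub_ne_node h.symm).elim
  · rw [vertexMap_node hf hi, vertexMap_node hf hj, node_inj, long_pathMap' hf hj,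
      Bool.xor_left_inj] at h
    obtain rfl := pathMap_inj hj hi h.1
    exact node_inj.2 ⟨rfl, h.2⟩

theorem edgeMap_inj {n k : ℕ} (hn : n ∈ (graph m b).edgeSet) (hk : k ∈ (graph m b).edgeSet)
    (h : edgeMap m d τ n = edgeMap m d τ k) : n = k := by
  rcases mem_edgeSet.1 hn with ⟨σ, j, hj, rfl⟩ | ⟨j, h0, hj, hl, rfl⟩ <;>
    rcases mem_edgeSet.1 hk with ⟨ρ, i, hi, rfl⟩ | ⟨i, k0, hi, kl, rfl⟩
  · rw [edgeMap_spoke, edgeMap_spoke, spoke_inj, Bool.xor_left_inj] at h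
    rw [h.1, pathMap_inj hj hi h.2]
  · rw [edgeMap_spoke, edgeMap_cross] at h
    exact (spoke_ne_cross h).elim
  · rw [edgeMap_spoke, edgeMap_cross] at h
    exact (spoke_ne_cross h.symm).elim
  · rw [edgeMap_cross, edgeMap_cross, cross_inj] at h
    rw [pathMap_inj hj hi h]

/-- The embedding of gadgets. -/
def subIso (hf : Fits m b m' b' d) (τ : Bool) : SubIso (graph m b) (graph m' b') where
  toV x := ⟨vertexMap m m' b' d τ x, by
    obtain ⟨x, ⟨σ, rfl⟩ | ⟨σ, j, hj, rfl⟩⟩ := x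
    · rw [vertexMap_hub]; exact hub_mem
    · rw [vertexMap_node hf hj]; exact node_mem (pathMap_le hf hj)⟩
  toE n := ⟨edgeMap m d τ n, by
    obtain ⟨x, y, h⟩ := exists_isLink_of_mem_edgeSet n.2
    exact (isLink_map hf h).edge_mem⟩
  toV_injective x y h := Subtype.ext (vertexMap_inj hf x.2 y.2 (congrArg Subtype.val h))
  toE_injective x y h := Subtype.ext (edgeMap_inj x.2 y.2 (congrArg Subtype.val h))
  isLink _ _ _ h := isLink_map hf h

theorem subIso_hubFlag (hf : Fits m b m' b' d) (hj : j ≤ m) :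
    (subIso hf τ).flag (hubFlag b σ hj) = hubFlag b' (σ ^^ τ) (pathMap_le (τ := τ) hf hj) :=
  Subtype.ext (Prod.ext vertexMap_hub edgeMap_spoke)

theorem subIso_nodeFlag (hf : Fits m b m' b' d) (hj : j ≤ m) :
    (subIso hf τ).flag (nodeFlag b σ hj) = nodeFlag b' (σ ^^ τ) (pathMap_le (τ := τ) hf hj) :=
  Subtype.ext (Prod.ext (vertexMap_node hf hj) edgeMap_spoke)

theorem subIso_crossFlag (hf : Fits m b m' b' d) (h0 : 0 < j) (hj : j ≤ m) (hl : Long m b j) :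
    (subIso hf τ).flag (crossFlag σ h0 hj hl) = crossFlag (σ ^^ τ) (pathMap_pos h0 hj)
      (pathMap_le (τ := τ) hf hj) ((long_pathMap hf h0 hj).2 hl) :=
  Subtype.ext (Prod.ext (vertexMap_node hf hj) edgeMap_cross)

theorem rot_pow_hubFlag_val (hj : j ≤ m) (k : ℕ) :
    ((rot m b ^ k) (hubFlag b σ hj)).1 = (hub σ, spoke σ ((next m σ)^[k] j)) := by
  have : ∃ h : (next m σ)^[k] j ≤ m, (rot m b ^ k) (hubFlag b σ hj) = hubFlag b σ h := by
    induction k with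
    | zero => exact ⟨hj, rfl⟩
    | succ k ih =>
      obtain ⟨h, ih⟩ := ih
      rw [pow_succ', Equiv.Perm.mul_apply, ih, rot_hubFlag, Function.iterate_succ_apply']
      exact ⟨next_le h, rfl⟩
  obtain ⟨h, hk⟩ := this
  rw [hk]
  rfl

theorem exists_of_mem_range (hf : Fits m b m' b' d) {i : ℕ} {g : (graph m' b').Flag}
    (hg : g ∈ Set.range (subIso hf τ).flag) (hgv : g.1 = (hub σ, spoke σ i)) :
    ∃ j ≤ m, i = shift d j := by
  obtain ⟨f, rfl⟩ := hg
  revert hgv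
  refine flag_cases (P := fun f => ((subIso hf τ).flag f).1 = (hub σ, spoke σ i) →
    ∃ j ≤ m, i = shift d j) ?_ ?_ ?_ f
  · intro ρ j hj h
    rw [subIso_hubFlag hf hj] at h
    exact ⟨flip m τ j, flip_le hj, (spoke_inj.1 (congrArg Prod.snd h)).2.symm⟩
  · intro ρ j hj h
    rw [subIso_nodeFlag hf hj] at h
    exact (hub_ne_node (congrArg Prod.fst h).symm).elim
  · intro ρ j h0 hj hl h
    rw [subIso_crossFlag hf h0 hj hl] at h
    exact (hub_ne_node (congrArg Prod.fst h).symm).elim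

/-- Half-edges are skipped only at the hubs, where `arc_shift` applies. At all other vertices the
isomorphism commutes with one step of the rotation. -/
theorem subIso_induces (hf : Fits m b m' b' d) (hm : 0 < m) (hm' : 0 < m') :
    (subIso hf τ).Induces (embedding b' hm') (embedding b hm) := by
  have hone : ∀ f : (graph m b).Flag,
      rot m' b' ((subIso hf τ).flag f) = (subIso hf τ).flag (rot m b f) →
      ∃ k : ℕ, 0 < k ∧ (rot m' b' ^ k) ((subIso hf τ).flag f) = (subIso hf τ).flag (rot m b f) ∧
        ∀ j : ℕ, 0 < j → j < k →
          (rot m' b' ^ j) ((subIso hf τ).flag f) ∉ Set.range (subIso hf τ).flag := by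
    intro f h
    exact ⟨1, one_pos, by rw [pow_one, h], fun j h0 h1 => by omega⟩
  intro f
  change ∃ k : ℕ, 0 < k ∧ (rot m' b' ^ k) ((subIso hf τ).flag f) =
    (subIso hf τ).flag (rot m b f) ∧ ∀ j : ℕ, 0 < j → j < k →
      (rot m' b' ^ j) ((subIso hf τ).flag f) ∉ Set.range (subIso hf τ).flag
  induction f using flag_cases with
  | h1 σ j hj =>
    have hmd : m + d ≤ m' := by
      rcases hf with ⟨rfl, rfl, rfl⟩ | ⟨rfl, rfl, h⟩ <;> omega
    obtain ⟨k, h0, hk, hR⟩ := arc_shift (σ := σ ^^ τ) hm hmd (flip_le (τ := τ) hj)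
    rw [← flip_next hj] at hk
    rw [rot_hubFlag, subIso_hubFlag hf hj, subIso_hubFlag hf (next_le hj)]
    refine ⟨k, h0, Subtype.ext ?_, fun i h1 h2 hi => hR i h1 h2 ?_⟩
    · rw [rot_pow_hubFlag_val]
      exact Prod.ext rfl (congrArg (spoke _) hk)
    · exact exists_of_mem_range hf hi (rot_pow_hubFlag_val _ i)
  | h2 σ j hj =>
    apply hone
    rcases j.eq_zero_or_pos with rfl | h0
    · rw [rot_nodeFlag_zero, subIso_nodeFlag hf hj]
      have : ∀ {i} (hi : i ≤ m'), i = 0 → ∀ σ, rot m' b' (nodeFlag b' σ hi) = nodeFlag b' σ hi := by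
        rintro i hi rfl σ
        exact rot_nodeFlag_zero hi
      exact this _ pathMap_zero _
    · by_cases hl : Long m b j
      · rw [rot_nodeFlag_long h0 hj hl, subIso_nodeFlag hf hj, subIso_crossFlag hf h0 hj hl,
          rot_nodeFlag_long (pathMap_pos h0 hj) _ ((long_pathMap hf h0 hj).2 hl)]
      · rw [rot_nodeFlag_short hj hl, subIso_nodeFlag hf hj, subIso_nodeFlag hf hj,
          rot_nodeFlag_short _ fun h => hl ((long_pathMap hf h0 hj).1 h)]
        simp only [Bool.not_xor]
  | h3 σ j h0 hj hl =>
    apply hone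
    rw [rot_crossFlag, subIso_crossFlag hf h0 hj hl, subIso_nodeFlag hf hj, rot_crossFlag]

end

end Theta

/-! ### Extending isomorphisms over the gadgets -/

section

variable {α β : Type*} {G H : Graph α β} {o : G.EndOrder} {o' : H.EndOrder} {m b : β → ℕ}

/-- The end orders of the two graphs are chosen independently. The bit `τ` records whether they
disagree on `e`, in which case the gadget has to be mapped with its hubs exchanged. -/
theorem SubIso.exists_xor (θ : SubIso G H) (o : G.EndOrder) (o' : H.EndOrder) (e : G.edgeSet) :
    ∃ τ, ∀ σ, (θ.toV ⟨o.tip σ e, (o.isLink_tip e.2 σ).left_mem⟩ : α) =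
      o'.tip (σ ^^ τ) (θ.toE e) := by
  have h := θ.isLink e ⟨o.tip false e, (o.isLink_tip e.2 false).left_mem⟩
    ⟨o.tip true e, (o.isLink_tip e.2 true).left_mem⟩ (o.isLink_tip e.2 false)
  rcases h.eq_and_eq_or_eq_and_eq (o'.isLink_tip (θ.toE e).2 false) with ⟨h1, h2⟩ | ⟨h1, h2⟩
  · refine ⟨false, fun σ => ?_⟩
    cases σ
    exacts [h1, h2]
  · refine ⟨true, fun σ => ?_⟩
    cases σ
    exacts [h1, h2]

/-- Whether an isomorphism onto a subgraph exchanges the indices of the ends of an edge. -/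
noncomputable def SubIso.swap (θ : SubIso G H) (o : G.EndOrder) (o' : H.EndOrder) (e : G.edgeSet) :
    Bool :=
  (θ.exists_xor o o' e).choose

theorem SubIso.toV_tip (θ : SubIso G H) (o : G.EndOrder) (o' : H.EndOrder) (e : G.edgeSet)
    (σ : Bool) : (θ.toV ⟨o.tip σ e, (o.isLink_tip e.2 σ).left_mem⟩ : α) =
      o'.tip (σ ^^ θ.swap o o' e) (θ.toE e) :=
  (θ.exists_xor o o' e).choose_spec σ

variable (θ : SubIso G H) {d : G.edgeSet → ℕ}
  (hf : ∀ e : G.edgeSet, Fits (m e) (b e) (m (θ.toE e)) (b (θ.toE e)) (d e))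

theorem vertexMap_node_zero {m b m' b' d : ℕ} {σ τ : Bool} (hf : Fits m b m' b' d) :
    vertexMap m m' b' d τ (node m b σ 0) = node m' b' (σ ^^ τ) 0 := by
  rw [vertexMap_node hf (Nat.zero_le m), pathMap_zero]

theorem isInner_vertexMap {m b m' b' d x : ℕ} {τ : Bool} (hf : Fits m b m' b' d)
    (hx : x ∈ (graph m b).vertexSet) (hxi : IsInner m b x) :
    IsInner m' b' (vertexMap m m' b' d τ x) := by
  intro σ h
  have : σ = ((σ ^^ τ) ^^ τ) := by simp
  rw [this, ← vertexMap_node_zero hf] at h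
  exact hxi _ (vertexMap_inj hf hx (node_mem (Nat.zero_le m)) h)

/-- The map on vertices that extends `θ` to the gadgets. -/
noncomputable def liftVertex (o : G.EndOrder) (o' : H.EndOrder) (m b : β → ℕ) (θ : SubIso G H)
    (d : G.edgeSet → ℕ) (hf : ∀ e : G.edgeSet, Fits (m e) (b e) (m (θ.toE e)) (b (θ.toE e)) (d e)) :
    (thetaReplace o m b).vertexSet → (thetaReplace o' m b).vertexSet
  | ⟨Sum.inl u, h⟩ => ⟨Sum.inl (θ.toV ⟨u, thetaReplace_inl_mem.1 h⟩),
      thetaReplace_inl_mem.2 (Subtype.prop _)⟩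
  | ⟨Sum.inr (e, x), h⟩ =>
    have h' := thetaReplace_inr_mem.1 h
    ⟨Sum.inr (θ.toE ⟨e, h'.1⟩, (subIso (hf ⟨e, h'.1⟩) (θ.swap o o' ⟨e, h'.1⟩)).toV ⟨x, h'.2.1⟩),
      thetaReplace_inr_mem.2 ⟨Subtype.prop _, Subtype.prop _,
        isInner_vertexMap (hf ⟨e, h'.1⟩) h'.2.1 h'.2.2⟩⟩

theorem liftVertex_inl {u : α} {v} (hv : v = Sum.inl u) (h) :
    (liftVertex o o' m b θ d hf ⟨v, h⟩ : α ⊕ (β × ℕ)) =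
    Sum.inl (θ.toV ⟨u, thetaReplace_inl_mem.1 (hv ▸ h)⟩ : α) := by
  subst hv
  rfl

theorem liftVertex_inr {e : β} {x : ℕ} {v} (hv : v = Sum.inr (e, x)) (he : e ∈ G.edgeSet) (h) :
    (liftVertex o o' m b θ d hf ⟨v, h⟩ : α ⊕ (β × ℕ)) =
    Sum.inr ((θ.toE ⟨e, he⟩ : β), vertexMap (m e) (m (θ.toE ⟨e, he⟩)) (b (θ.toE ⟨e, he⟩))
      (d ⟨e, he⟩) (θ.swap o o' ⟨e, he⟩) x) := by
  subst hv
  rfl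

theorem liftVertex_place (e : G.edgeSet) {x : ℕ} (hx : x ∈ (graph (m e) (b e)).vertexSet) (h) :
    (liftVertex o o' m b θ d hf ⟨o.thetaPlace m b e x, h⟩ : α ⊕ (β × ℕ)) =
      o'.thetaPlace m b (θ.toE e) (vertexMap (m e) (m (θ.toE e)) (b (θ.toE e))
        (d e) (θ.swap o o' e) x) := by
  rcases inner_or_eq (m e) (b e) x with hxi | ⟨σ, rfl⟩
  · rw [thetaPlace_of_inner (isInner_vertexMap (hf e) hx hxi),
      liftVertex_inr θ hf (thetaPlace_of_inner hxi) e.2]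
  · rw [vertexMap_node_zero (hf e), thetaPlace_node_zero (o := o'),
      liftVertex_inl θ hf (thetaPlace_node_zero σ), θ.toV_tip o o' e]

/-- The extension of `θ` to the gadgets. -/
noncomputable def SubIso.lift (o : G.EndOrder) (o' : H.EndOrder) (m b : β → ℕ) (θ : SubIso G H)
    (d : G.edgeSet → ℕ) (hf : ∀ e : G.edgeSet, Fits (m e) (b e) (m (θ.toE e)) (b (θ.toE e)) (d e)) :
    SubIso (thetaReplace o m b) (thetaReplace o' m b) where
  toV := liftVertex o o' m b θ d hf
  toE p :=
    have h' := thetaReplace_mem_edgeSet.1 p.2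
    ⟨(θ.toE ⟨p.1.1, h'.1⟩, (subIso (hf ⟨p.1.1, h'.1⟩) (θ.swap o o' ⟨p.1.1, h'.1⟩)).toE
      ⟨p.1.2, h'.2⟩), thetaReplace_mem_edgeSet.2 ⟨Subtype.prop _, Subtype.prop _⟩⟩
  toV_injective := by
    rintro ⟨u | ⟨e, x⟩, h⟩ ⟨u' | ⟨e', x'⟩, h'⟩ hh <;> have hh := congrArg Subtype.val hh
    · have := θ.toV_injective (Subtype.ext (Sum.inl_injective hh))
      simpa using this
    · simp [liftVertex] at hh
    · simp [liftVertex] at hh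
    · obtain ⟨he, hx, -⟩ := thetaReplace_inr_mem.1 h
      obtain ⟨he', hx', -⟩ := thetaReplace_inr_mem.1 h'
      rw [liftVertex_inr θ hf rfl he, liftVertex_inr θ hf rfl he', Sum.inr.injEq,
        Prod.mk.injEq] at hh
      obtain rfl : e = e' := by
        have := θ.toE_injective (Subtype.ext hh.1)
        simpa using this
      have := vertexMap_inj (hf ⟨e, he⟩) hx hx' hh.2
      simp [this]
  toE_injective := by
    rintro ⟨⟨e, n⟩, h⟩ ⟨⟨e', n'⟩, h'⟩ hh
    have hh := congrArg Subtype.val hh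
    obtain ⟨he, hn⟩ := thetaReplace_mem_edgeSet.1 h
    obtain ⟨he', hn'⟩ := thetaReplace_mem_edgeSet.1 h'
    obtain rfl : e = e' := by
      have := θ.toE_injective (Subtype.ext (congrArg Prod.fst hh))
      simpa using this
    have := edgeMap_inj hn hn' (congrArg Prod.snd hh)
    dsimp only at this
    simp [this]
  isLink := by
    rintro ⟨⟨e, n⟩, hp⟩ ⟨v, hv⟩ ⟨w, hw⟩ ⟨he, x, y, h, h1, h2⟩
    dsimp only at he h h1 h2
    subst h1 h2
    have key := isLink_thetaPlace (o := o') (θ.toE ⟨e, he⟩).2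
      (isLink_map (τ := θ.swap o o' ⟨e, he⟩) (hf ⟨e, he⟩) h)
    rw [← liftVertex_place θ hf ⟨e, he⟩ h.left_mem hv,
      ← liftVertex_place θ hf ⟨e, he⟩ h.right_mem hw] at key
    exact key

theorem lift_gadgetFlag {e : β} (he : e ∈ G.edgeSet) (f : (graph (m e) (b e)).Flag) :
    (θ.lift o o' m b d hf).flag (gadgetFlag o m b he f) =
      gadgetFlag o' m b (θ.toE ⟨e, he⟩).2
        ((subIso (hf ⟨e, he⟩) (θ.swap o o' ⟨e, he⟩)).flag f) :=
  Subtype.ext (Prod.ext (liftVertex_place θ hf ⟨e, he⟩ f.2.vertex_mem _) rfl)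

theorem flag_tipFlag {e : β} (he : e ∈ G.edgeSet) (σ : Bool) : θ.flag (tipFlag o he σ) =
    tipFlag o' (θ.toE ⟨e, he⟩).2 (σ ^^ θ.swap o o' ⟨e, he⟩) :=
  Subtype.ext (Prod.ext (θ.toV_tip o o' ⟨e, he⟩ σ) rfl)

theorem lift_outerFlag (hG : G.Loopless) (hH : H.Loopless) (f : G.Flag) :
    (θ.lift o o' m b d hf).flag (outerFlag o m b f) = outerFlag o' m b (θ.flag f) := by
  refine tipFlag_cases (P := fun f => (θ.lift o o' m b d hf).flag (outerFlag o m b f) =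
    outerFlag o' m b (θ.flag f)) o (fun e he σ => ?_) f
  rw [outerFlag_tipFlag hG, lift_gadgetFlag, flag_tipFlag, outerFlag_tipFlag hH,
    subIso_nodeFlag (hf ⟨e, he⟩)]
  congr 1

/-- At original vertices the lifted rotations copy those of `G` and `H`; at inner vertices they copy
those of the gadgets. So the number of steps comes from `hθ` in the first case and from
`subIso_induces` in the second. -/
theorem lift_induces (hG : G.Loopless) (hH : H.Loopless) (hm : ∀ e ∈ G.edgeSet, 0 < m e)
    (hm' : ∀ e ∈ H.edgeSet, 0 < m e)
    {φ : G.PlanarEmbedding} {ψ : H.PlanarEmbedding} {φ' : (thetaReplace o m b).PlanarEmbedding}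
    {ψ' : (thetaReplace o' m b).PlanarEmbedding} (hφ : IsLift φ φ') (hψ : IsLift ψ ψ')
    (hθ : θ.Induces ψ φ) : (θ.lift o o' m b d hf).Induces ψ' φ' := by
  refine outer_inner_cases hG (fun f => ?_) fun e he f hfi => ?_
  · obtain ⟨k, h0, hk, hn⟩ := hθ f
    have hpow : ∀ j : ℕ, (ψ'.rot ^ j) ((θ.lift o o' m b d hf).flag (outerFlag o m b f)) =
        outerFlag o' m b ((ψ.rot ^ j) (θ.flag f)) := fun j => by
      rw [lift_outerFlag θ hf hG hH]
      exact pow_comm_of_forall (fun _ => True) (fun _ _ => trivial) (fun x _ => hψ.1 x) trivial j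
    refine ⟨k, h0, ?_, fun j h1 h2 => ?_⟩
    · rw [hpow, hk, hφ.1, lift_outerFlag θ hf hG hH]
    · rw [hpow]
      rintro ⟨g, hg⟩
      refine hn j h1 h2 ?_
      revert hg
      refine outer_inner_cases hG (P := fun g => (θ.lift o o' m b d hf).flag g =
        outerFlag o' m b ((ψ.rot ^ j) (θ.flag f)) → (ψ.rot ^ j) (θ.flag f) ∈ Set.range θ.flag)
        (fun g hg => ?_) (fun e he g hgi hg => ?_) g
      · rw [lift_outerFlag θ hf hG hH] at hg
        exact ⟨g, outerFlag_injective hg⟩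
      · rw [lift_gadgetFlag] at hg
        have := congrArg (fun f : (thetaReplace o' m b).Flag => f.1.1) hg
        dsimp only at this
        rw [outerFlag_val, gadgetFlag_val_of_inner
          (isInner_vertexMap (hf ⟨e, he⟩) g.2.vertex_mem hgi)] at this
        simp at this
  · have hpi : ∀ g : (graph (m e) (b e)).Flag, IsInner (m e) (b e) g.1.1 →
        IsInner _ _ ((subIso (hf ⟨e, he⟩) (θ.swap o o' ⟨e, he⟩)).flag g).1.1 := fun g hg =>
      isInner_vertexMap (hf ⟨e, he⟩) g.2.vertex_mem hg
    obtain ⟨k, h0, hk, hn⟩ := subIso_induces (τ := θ.swap o o' ⟨e, he⟩) (hf ⟨e, he⟩) (hm e he)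
      (hm' _ (θ.toE ⟨e, he⟩).2) f
    have hpow : ∀ j : ℕ, (ψ'.rot ^ j) ((θ.lift o o' m b d hf).flag (gadgetFlag o m b he f)) =
        gadgetFlag o' m b (θ.toE ⟨e, he⟩).2 ((Theta.rot _ _ ^ j)
          ((subIso (hf ⟨e, he⟩) (θ.swap o o' ⟨e, he⟩)).flag f)) := fun j => by
      rw [lift_gadgetFlag]
      exact pow_comm_of_forall (fun g => IsInner _ _ g.1.1)
        (fun g hg => by rwa [Theta.rot_vertex]) (fun x hx => hψ.2 _ _ x hx) (hpi f hfi) j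
    refine ⟨k, h0, ?_, fun j h1 h2 => ?_⟩
    · rw [hpow, hφ.2 e he f hfi, lift_gadgetFlag]
      exact congrArg _ hk
    · rw [hpow]
      rintro ⟨g, hg⟩
      refine hn j h1 h2 ?_
      revert hg
      refine gadgetFlag_cases (P := fun g => (θ.lift o o' m b d hf).flag g = _ → _)
        (fun e' he' g hg => ?_) g
      rw [lift_gadgetFlag] at hg
      obtain rfl : e' = e := by
        have h3 := congrArg (fun f : (thetaReplace o' m b).Flag => f.1.2.1) hg
        have := θ.toE_injective (Subtype.ext h3)
        simpa using this
      exact ⟨g, (gadgetFlag_inj hH).1 hg⟩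

end

/-! ### Degrees and numbers of edges as obstructions -/

section

variable {α β α' β' : Type*} {G : Graph α β} {H : Graph α' β'}

theorem SubIso.ncard_edgeSet_le (θ : SubIso G H) (hH : H.IsFinite) :
    G.edgeSet.ncard ≤ H.edgeSet.ncard := by
  have : Finite H.edgeSet := hH.2
  rw [← Nat.card_coe_set_eq, ← Nat.card_coe_set_eq]
  exact Nat.card_le_card_of_injective θ.toE θ.toE_injective

theorem SubIso.inc (θ : SubIso G H) {e : β} {v : α} (h : G.Inc e v) :
    H.Inc (θ.toE ⟨e, h.edge_mem⟩) (θ.toV ⟨v, h.vertex_mem⟩) := by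
  obtain ⟨w, h⟩ := h
  exact ⟨_, θ.isLink ⟨e, h.edge_mem⟩ ⟨v, h.left_mem⟩ ⟨w, h.right_mem⟩ h⟩

theorem SubIso.adj (θ : SubIso G H) {v w : α} (h : G.Adj v w) :
    H.Adj (θ.toV ⟨v, h.left_mem⟩) (θ.toV ⟨w, h.right_mem⟩) := by
  obtain ⟨e, h⟩ := h
  exact ⟨_, θ.isLink ⟨e, h.edge_mem⟩ ⟨v, h.left_mem⟩ ⟨w, h.right_mem⟩ h⟩

theorem SubIso.ncard_inc_le (θ : SubIso G H) (hH : H.IsFinite) (v : G.vertexSet) :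
    {e | G.Inc e v}.ncard ≤ {e | H.Inc e (θ.toV v)}.ncard := by
  have : Finite {e | H.Inc e (θ.toV v)} := hH.2.subset fun e he => Inc.edge_mem he
  rw [← Nat.card_coe_set_eq, ← Nat.card_coe_set_eq]
  refine Nat.card_le_card_of_injective
    (fun e : {e | G.Inc e v} => (⟨θ.toE ⟨e, Inc.edge_mem e.2⟩, θ.inc e.2⟩ :
      {e | H.Inc e (θ.toV v)})) ?_
  intro e f h
  have h' := congrArg Subtype.val h
  have h'' := congrArg Subtype.val (θ.toE_injective (Subtype.ext h'))
  exact Subtype.ext h''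

end

namespace Theta

variable {m b m' b' : ℕ}

/-- There are `2 * (m + 1)` edges at the hubs, and `2 * b` middle edges because the hypothesis keeps
the two ranges of long paths disjoint. -/
theorem ncard_edgeSet (h : 2 * b ≤ m) : (graph m b).edgeSet.ncard = 2 * (m + 1) + 2 * b := by
  have hset : (graph m b).edgeSet = (((Finset.range (m + 1)).image (spoke false) ∪
      (Finset.range (m + 1)).image (spoke true)) ∪
      ((Finset.Icc 1 b).image cross ∪ (Finset.Icc (m + 1 - b) m).image cross) : Finset ℕ) := by
    ext n
    simp only [mem_edgeSet, Finset.coe_union, Finset.coe_image, Finset.coe_range, Finset.coe_Icc,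
      Set.mem_union, Set.mem_image, Set.mem_Iio, Set.mem_Icc, Long]
    constructor
    · rintro (⟨σ, j, hj, rfl⟩ | ⟨j, h0, hj, hl | hl, rfl⟩)
      · cases σ
        exacts [Or.inl (Or.inl ⟨j, by omega, rfl⟩), Or.inl (Or.inr ⟨j, by omega, rfl⟩)]
      · exact Or.inr (Or.inl ⟨j, by omega, rfl⟩)
      · exact Or.inr (Or.inr ⟨j, by omega, rfl⟩)
    · rintro ((⟨j, hj, rfl⟩ | ⟨j, hj, rfl⟩) | ⟨j, hj, rfl⟩ | ⟨j, hj, rfl⟩)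
      · exact Or.inl ⟨false, j, by omega, rfl⟩
      · exact Or.inl ⟨true, j, by omega, rfl⟩
      · exact Or.inr ⟨j, by omega, by omega, Or.inl hj.2, rfl⟩
      · exact Or.inr ⟨j, by omega, by omega, Or.inr (by omega), rfl⟩
  have hs : ∀ σ, Function.Injective (spoke σ) := fun σ i j h => (spoke_inj.1 h).2
  have hc : Function.Injective cross := fun i j h => cross_inj.1 h
  rw [hset, Set.ncard_coe_finset, Finset.card_union_of_disjoint, Finset.card_union_of_disjoint,
    Finset.card_union_of_disjoint, Finset.card_image_of_injective _ (hs false),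
    Finset.card_image_of_injective _ (hs true), Finset.card_image_of_injective _ hc,
    Finset.card_image_of_injective _ hc]
  · simp
    omega
  · rw [Finset.disjoint_image hc, Finset.disjoint_left]
    intro i hi hi'
    rw [Finset.mem_Icc] at hi hi'
    omega
  · rw [Finset.disjoint_left]
    intro n hn hn'
    obtain ⟨i, -, rfl⟩ := Finset.mem_image.1 hn
    obtain ⟨j, -, h⟩ := Finset.mem_image.1 hn'
    simpa using (spoke_inj.1 h).1
  · rw [Finset.disjoint_left]
    intro n hn hn'
    rw [← Finset.image_union] at hn'
    obtain ⟨j, -, rfl⟩ := Finset.mem_image.1 hn'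
    rcases Finset.mem_union.1 hn with hn | hn <;> obtain ⟨i, -, h⟩ := Finset.mem_image.1 hn <;>
      exact spoke_ne_cross h

theorem le_of_subIso (θ : SubIso (graph m b) (graph m' b')) (hm' : 0 < m') : m ≤ m' := by
  have h1 := θ.ncard_inc_le isFinite ⟨hub false, hub_mem⟩
  rw [ncard_inc_hub] at h1
  have h2 := h1.trans (ncard_inc_le hm')
  omega

/-- The second obstruction besides `le_of_subIso`. In the strict family it is monotone in the
opposite direction, so together they exclude all proper containments. -/
theorem add_le_of_subIso (θ : SubIso (graph m b) (graph m' b')) (h : 2 * b ≤ m)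
    (h' : 2 * b' ≤ m') : m + b ≤ m' + b' := by
  have := θ.ncard_edgeSet_le isFinite
  rw [ncard_edgeSet h, ncard_edgeSet h'] at this
  omega

end Theta

/-! ### Descent of isomorphisms to the original graphs -/

section Descent

variable {α β : Type*} {G H : Graph α β} {o : G.EndOrder} {o' : H.EndOrder} {m b : β → ℕ}

theorem ncard_thetaReplace_inc_inr {e : β} (he : e ∈ G.edgeSet) {x : ℕ}
    (hx : IsInner (m e) (b e) x) : {p | (thetaReplace o m b).Inc p (Sum.inr (e, x))}.ncard =
      {n | (graph (m e) (b e)).Inc n x}.ncard := by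
  rw [← Set.ncard_image_of_injective {n | (graph (m e) (b e)).Inc n x}
    (Prod.mk_right_injective e)]
  congr 1
  ext ⟨e', n⟩
  simp only [Set.mem_ofPred_eq, thetaReplace_inc_inr, Set.mem_image, Prod.mk.injEq]
  constructor
  · rintro ⟨-, -, rfl, h⟩
    exact ⟨n, h, rfl, rfl⟩
  · rintro ⟨n, h, rfl, rfl⟩
    exact ⟨he, hx, rfl, h⟩

theorem ncard_thetaReplace_inc_inl_le (hfin : G.IsFinite) (hl : G.Loopless) (u : α) :
    {p | (thetaReplace o m b).Inc p (Sum.inl u)}.ncard ≤ G.edgeSet.ncard := by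
  refine Set.ncard_le_ncard_of_injOn Prod.fst ?_ ?_ hfin.2
  · rintro ⟨e, n⟩ h
    exact (thetaReplace_inc_inl.1 h).1
  · rintro ⟨e, n⟩ hp ⟨e', n'⟩ hp' (rfl : e = e')
    obtain ⟨he, σ, rfl, rfl⟩ := thetaReplace_inc_inl.1 hp
    obtain ⟨-, τ, hτ, rfl⟩ := thetaReplace_inc_inl.1 hp'
    rw [(o.tip_inj hl he).1 hτ]

/-- Only hubs have large degree. -/
theorem exists_hub_of_lt_ncard (hfin : G.IsFinite) (hl : G.Loopless) {v : α ⊕ (β × ℕ)}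
    (hv : v ∈ (thetaReplace o m b).vertexSet)
    (h : G.edgeSet.ncard < {p | (thetaReplace o m b).Inc p v}.ncard)
    (h2 : 2 < {p | (thetaReplace o m b).Inc p v}.ncard) :
    ∃ e ∈ G.edgeSet, ∃ σ, v = Sum.inr (e, hub σ) := by
  rcases v with u | ⟨e, x⟩
  · exact (h.not_ge (ncard_thetaReplace_inc_inl_le hfin hl u)).elim
  · obtain ⟨he, hx, hxi⟩ := thetaReplace_inr_mem.1 hv
    rw [ncard_thetaReplace_inc_inr he hxi] at h2
    rcases hx with ⟨σ, rfl⟩ | ⟨σ, j, hj, rfl⟩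
    · exact ⟨e, he, σ, rfl⟩
    · exact (h2.not_ge (ncard_inc_node_le hj)).elim

theorem adj_hub {e : β} {σ : Bool} {w : α ⊕ (β × ℕ)}
    (h : (thetaReplace o m b).Adj (Sum.inr (e, hub σ)) w) :
    w = Sum.inl (o.tip σ e) ∨
      ∃ j, 0 < j ∧ j ≤ m e ∧ w = Sum.inr (e, node (m e) (b e) σ j) := by
  obtain ⟨⟨e', n⟩, h⟩ := h
  obtain ⟨he, x, y, h, hx, rfl⟩ := thetaReplace_isLink.1 h
  dsimp only at he h hx
  rcases inner_or_eq (m e') (b e') x with hxi | ⟨τ, rfl⟩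
  · rw [thetaPlace_of_inner hxi, Sum.inr.injEq, Prod.mk.injEq] at hx
    obtain ⟨rfl, rfl⟩ := hx
    obtain ⟨j, hj, rfl⟩ := inc_hub.1 h.inc_left
    obtain rfl := (isLink_spoke hj).right_unique h
    rcases j.eq_zero_or_pos with rfl | h0
    · exact Or.inl (thetaPlace_node_zero σ)
    · exact Or.inr ⟨j, h0, hj, thetaPlace_of_inner (inner_node h0)⟩
  · rw [thetaPlace_node_zero] at hx
    simp at hx

theorem hub_vertex_mem {e : β} (he : e ∈ G.edgeSet) (σ : Bool) :
    Sum.inr (e, hub σ) ∈ (thetaReplace o m b).vertexSet :=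
  thetaReplace_inr_mem.2 ⟨he, hub_mem, inner_hub⟩

theorem tip_vertex_mem {e : β} (he : e ∈ G.edgeSet) (σ : Bool) :
    Sum.inl (o.tip σ e) ∈ (thetaReplace o m b).vertexSet :=
  thetaReplace_inl_mem.2 (o.isLink_tip he σ).left_mem

theorem isLink_hub_tip {e : β} (he : e ∈ G.edgeSet) (σ : Bool) :
    (thetaReplace o m b).IsLink (e, spoke σ 0) (Sum.inr (e, hub σ)) (Sum.inl (o.tip σ e)) := by
  have := isLink_thetaPlace (o := o) (m := m) (b := b) he
    (isLink_spoke (σ := σ) (Nat.zero_le (m e)))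
  rwa [thetaPlace_node_zero, thetaPlace_of_inner inner_hub] at this

theorem isLink_hub_node {e : β} (he : e ∈ G.edgeSet) (σ : Bool) {j : ℕ} (h0 : 0 < j)
    (hj : j ≤ m e) : (thetaReplace o m b).IsLink (e, spoke σ j) (Sum.inr (e, hub σ))
      (Sum.inr (e, node (m e) (b e) σ j)) := by
  have := isLink_thetaPlace (o := o) (m := m) (b := b) he (isLink_spoke (σ := σ) hj)
  rwa [thetaPlace_of_inner (inner_node h0), thetaPlace_of_inner inner_hub] at this

/-- The degree `m e + 1` of a hub exceeds both `N` and `2`, so its image is a hub. The inner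
vertices of two short paths are common neighbours of the hubs of `e`, which forces the two images
into one gadget. -/
theorem exists_hub_image (hH : H.IsTwoConnected) (hHfin : H.IsFinite)
    (hHfin' : (thetaReplace o' m b).IsFinite) {N : ℕ} (hN : H.edgeSet.ncard ≤ N)
    (hG : ∀ e ∈ G.edgeSet, N + 2 + 2 * b e ≤ m e)
    (θ' : SubIso (thetaReplace o m b) (thetaReplace o' m b)) (e : G.edgeSet) :
    ∃ (e' : H.edgeSet) (τ : Bool), ∀ σ,
      (θ'.toV ⟨Sum.inr ((e : β), hub σ), hub_vertex_mem e.2 σ⟩ : α ⊕ (β × ℕ)) =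
        Sum.inr ((e' : β), hub (σ ^^ τ)) := by
  obtain ⟨e, he⟩ := e
  have hm := hG e he
  have h1 : ∀ σ, ∃ e' ∈ H.edgeSet, ∃ ρ, (θ'.toV ⟨Sum.inr (e, hub σ), hub_vertex_mem he σ⟩ :
      α ⊕ (β × ℕ)) = Sum.inr (e', hub ρ) := by
    intro σ
    have := θ'.ncard_inc_le hHfin' ⟨Sum.inr (e, hub σ), hub_vertex_mem he σ⟩
    rw [ncard_thetaReplace_inc_inr he inner_hub, ncard_inc_hub] at this
    exact exists_hub_of_lt_ncard hHfin hH.loopless (Subtype.prop _) (by omega) (by omega)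
  obtain ⟨e₁, he₁, ρ₁, h₁⟩ := h1 false
  obtain ⟨e₂, he₂, ρ₂, h₂⟩ := h1 true
  have hnode : ∀ j, b e < j → j ≤ b e + 2 → ∃ (y : (thetaReplace o m b).vertexSet),
      (y : α ⊕ (β × ℕ)) = Sum.inr (e, node (m e) (b e) false j) ∧
      (thetaReplace o' m b).Adj (Sum.inr (e₁, hub ρ₁)) (θ'.toV y) ∧
      (thetaReplace o' m b).Adj (Sum.inr (e₂, hub ρ₂)) (θ'.toV y) := by
    intro j hj1 hj2
    have hl : ¬ Long (m e) (b e) j := by unfold Long; omega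
    have a1 := isLink_hub_node (o := o) (m := m) (b := b) he false (j := j) (by omega) (by omega)
    have a2 := isLink_hub_node (o := o) (m := m) (b := b) he true (j := j) (by omega) (by omega)
    rw [node_eq_of_not_long (σ := true) (τ := false) hl] at a2
    refine ⟨⟨_, a1.right_mem⟩, rfl, ?_, ?_⟩
    · rw [← h₁]; exact θ'.adj a1.adj
    · rw [← h₂]; exact θ'.adj a2.adj
  -- Hubs of different gadgets can have at most one common neighbour, namely a common terminal,
  -- whereas the short paths `b e + 1` and `b e + 2` provide two.
  obtain rfl : e₁ = e₂ := by
    by_contra hne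
    have hcommon : ∀ y, (thetaReplace o' m b).Adj (Sum.inr (e₁, hub ρ₁)) y →
        (thetaReplace o' m b).Adj (Sum.inr (e₂, hub ρ₂)) y → y = Sum.inl (o'.tip ρ₁ e₁) := by
      intro y hy1 hy2
      rcases adj_hub hy1 with h | ⟨j, -, -, rfl⟩
      · exact h
      · rcases adj_hub hy2 with h | ⟨i, -, -, h⟩
        · simp at h
        · simp [hne] at h
    obtain ⟨y, hy, hy1, hy2⟩ := hnode (b e + 1) (by omega) (by omega)
    obtain ⟨w, hw, hw1, hw2⟩ := hnode (b e + 2) (by omega) (by omega)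
    have hyw : y = w := θ'.toV_injective (Subtype.ext
      ((hcommon _ hy1 hy2).trans (hcommon _ hw1 hw2).symm))
    rw [hyw, hw, Sum.inr.injEq, Prod.mk.injEq, node_inj] at hy
    omega
  have hρ : ρ₂ = !ρ₁ := by
    have : ρ₁ ≠ ρ₂ := by
      rintro rfl
      have := θ'.toV_injective (Subtype.ext (h₁.trans h₂.symm))
      simp [hub] at this
    cases ρ₁ <;> cases ρ₂ <;> simp_all
  refine ⟨⟨e₁, he₁⟩, ρ₁, fun σ => ?_⟩
  cases σ
  · rw [h₁, Bool.false_xor]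
  · rw [h₂, hρ, Bool.true_xor]

/-- An isomorphism between graphs with gadgets maps gadgets to gadgets, so it comes from an
isomorphism between the original graphs. -/
theorem exists_descent (hG : G.IsTwoConnected) (hH : H.IsTwoConnected) (hHfin : H.IsFinite)
    (hHfin' : (thetaReplace o' m b).IsFinite) {N : ℕ} (hN : H.edgeSet.ncard ≤ N)
    (hmG : ∀ e ∈ G.edgeSet, N + 2 + 2 * b e ≤ m e) (hmH : ∀ e ∈ H.edgeSet, N + 2 + 2 * b e ≤ m e)
    (θ' : SubIso (thetaReplace o m b) (thetaReplace o' m b)) :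
    ∃ θ : SubIso G H, (∀ f, θ'.flag (outerFlag o m b f) = outerFlag o' m b (θ.flag f)) ∧
      ∀ e : G.edgeSet, m e ≤ m (θ.toE e) ∧ m e + b e ≤ m (θ.toE e) + b (θ.toE e) := by
  have hsimp := thetaReplace_simple (o := o') (m := m) (b := b) hH.loopless
  choose E τ hE using exists_hub_image (o := o) hH hHfin hHfin' hN hmG θ'
  have hEinj : Function.Injective E := by
    intro e f hef
    have h1 := hE e (τ f)
    have h2 := hE f (τ e)
    rw [hef, Bool.xor_comm, ← h2] at h1
    have := θ'.toV_injective (Subtype.ext h1)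
    simp only [Subtype.mk.injEq, Sum.inr.injEq, Prod.mk.injEq] at this
    exact Subtype.ext this.1
  have htip : ∀ (e : G.edgeSet) σ,
      (θ'.toV ⟨Sum.inl (o.tip σ e), tip_vertex_mem e.2 σ⟩ : α ⊕ (β × ℕ)) =
        Sum.inl (o'.tip (σ ^^ τ e) (E e)) := by
    intro e σ
    have h1 := θ'.adj (isLink_hub_tip e.2 σ).adj
    rw [hE e σ] at h1
    rcases adj_hub h1 with h | ⟨j, -, -, h⟩
    · exact h
    -- By 2-connectedness a second edge `f` meets this vertex. If the vertex went to an inner vertex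
    -- of the gadget `E e`, the image of a hub of `f`, which lies in the different gadget `E f`,
    -- could not be adjacent to it.
    · obtain ⟨f, hfe, hf⟩ := hG.exists_ne_inc e (o.isLink_tip e.2 σ).left_mem
      obtain ⟨ρ, hρ⟩ := o.exists_tip hf
      have h2 := θ'.adj (isLink_hub_tip (o := o) (m := m) (b := b) hf.edge_mem ρ).adj
      rw [hE ⟨f, hf.edge_mem⟩ ρ] at h2
      simp only [← hρ, h] at h2
      rcases adj_hub h2 with h3 | ⟨i, -, -, h3⟩
      · simp at h3
      · simp only [Sum.inr.injEq, Prod.mk.injEq] at h3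
        have := hEinj (Subtype.ext h3.1)
        exact (hfe (congrArg Subtype.val this).symm).elim
  have hV : ∀ u : G.vertexSet, ∃ w : H.vertexSet,
      (θ'.toV ⟨Sum.inl (u : α), thetaReplace_inl_mem.2 u.2⟩ : α ⊕ (β × ℕ)) = Sum.inl (w : α) := by
    rintro ⟨u, hu⟩
    obtain ⟨e, he⟩ := hG.exists_inc hu
    obtain ⟨σ, rfl⟩ := o.exists_tip he
    exact ⟨⟨_, (o'.isLink_tip (E ⟨e, he.edge_mem⟩).2 _).left_mem⟩, htip ⟨e, he.edge_mem⟩ σ⟩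
  choose W hW using hV
  have hWtip : ∀ (e : G.edgeSet) σ (h : o.tip σ e ∈ G.vertexSet),
      (W ⟨o.tip σ e, h⟩ : α) = o'.tip (σ ^^ τ e) (E e) := by
    intro e σ h
    exact Sum.inl_injective ((hW ⟨o.tip σ e, h⟩).symm.trans (htip e σ))
  let θ : SubIso G H :=
    { toV := W
      toE := E
      toV_injective := by
        intro u v huv
        have := θ'.toV_injective (Subtype.ext ((hW u).trans ((congrArg (fun w : H.vertexSet =>
          (Sum.inl (w : α) : α ⊕ (β × ℕ))) huv).trans (hW v).symm)))
        simp only [Subtype.mk.injEq, Sum.inl.injEq] at this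
        exact Subtype.ext this
      toE_injective := hEinj
      isLink := by
        rintro e ⟨x, hx⟩ ⟨y, hy⟩ h
        obtain ⟨σ, rfl⟩ := o.exists_tip h.inc_left
        obtain rfl := h.right_unique (o.isLink_tip e.2 σ)
        rw [hWtip, hWtip, Bool.not_xor]
        exact o'.isLink_tip (E e).2 _ }
  -- The target is simple, so the images of the ends of a pendant edge determine the image of the
  -- edge.
  have hspoke : ∀ (e : G.edgeSet) σ (h : ((e : β), spoke σ 0) ∈ (thetaReplace o m b).edgeSet),
      (θ'.toE ⟨((e : β), spoke σ 0), h⟩ : β × ℕ) = ((E e : β), spoke (σ ^^ τ e) 0) := by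
    intro e σ h
    have h1 := θ'.isLink ⟨_, h⟩ ⟨_, hub_vertex_mem e.2 σ⟩ ⟨_, tip_vertex_mem e.2 σ⟩
      (isLink_hub_tip e.2 σ)
    rw [hE e σ, htip e σ] at h1
    exact hsimp.eq_of_isLink h1 (isLink_hub_tip (E e).2 _)
  refine ⟨θ, fun f => ?_, fun e => ⟨?_, ?_⟩⟩
  · refine tipFlag_cases (P := fun f => θ'.flag (outerFlag o m b f) =
      outerFlag o' m b (θ.flag f)) o (fun e he σ => ?_) f
    have h1 : θ.flag (tipFlag o he σ) = tipFlag o' (E ⟨e, he⟩).2 (σ ^^ τ ⟨e, he⟩) :=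
      Subtype.ext (Prod.ext (hWtip ⟨e, he⟩ σ _) rfl)
    rw [h1, outerFlag_tipFlag hH.loopless]
    have h2 : (outerFlag o m b (tipFlag o he σ)).1 = (Sum.inl (o.tip σ e), (e, spoke σ 0)) := by
      rw [outerFlag_val, side_tipFlag hG.loopless]
      rfl
    have h3 : ∀ (f : (thetaReplace o m b).Flag), f.1 = (Sum.inl (o.tip σ e), (e, spoke σ 0)) →
        (θ'.flag f).1 = (Sum.inl (o'.tip (σ ^^ τ ⟨e, he⟩) (E ⟨e, he⟩)),
          ((E ⟨e, he⟩ : β), spoke (σ ^^ τ ⟨e, he⟩) 0)) := by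
      rintro ⟨f, hf⟩ rfl
      exact Prod.ext (htip ⟨e, he⟩ σ) (hspoke ⟨e, he⟩ σ _)
    refine Subtype.ext ((h3 _ h2).trans ?_)
    exact Prod.ext (thetaPlace_node_zero _).symm rfl
  · have h1 := θ'.ncard_inc_le hHfin' ⟨_, hub_vertex_mem e.2 false⟩
    rw [hE e false, ncard_thetaReplace_inc_inr e.2 inner_hub, ncard_inc_hub,
      ncard_thetaReplace_inc_inr (E e).2 inner_hub, ncard_inc_hub] at h1
    exact Nat.le_of_succ_le_succ h1
  · have hmem : ∀ n, n ∈ (graph (m e) (b e)).edgeSet →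
        ((e : β), n) ∈ (thetaReplace o m b).edgeSet := fun n hn =>
      thetaReplace_mem_edgeSet.2 ⟨e.2, hn⟩
    -- An inner end whose image is an inner vertex of `E e` forces the edge into that gadget. Edges
    -- at hubs have such an end. For a middle edge, its node is adjacent to a hub, and its image is
    -- not the terminal, which is already taken.
    have hfst : ∀ n (hn : n ∈ (graph (m e) (b e)).edgeSet),
        (θ'.toE ⟨((e : β), n), hmem n hn⟩ : β × ℕ).1 = E e := by
      intro n hn
      have hinc : ∀ x, IsInner (m e) (b e) x → (graph (m e) (b e)).Inc n x → ∀ hx x',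
          (θ'.toV ⟨Sum.inr ((e : β), x), hx⟩ : α ⊕ (β × ℕ)) = Sum.inr ((E e : β), x') →
          (θ'.toE ⟨((e : β), n), hmem n hn⟩ : β × ℕ).1 = E e := by
        intro x hxi h hx x' hx'
        have h1 := θ'.inc (thetaReplace_inc_inr.2 ⟨e.2, hxi, rfl, h⟩)
        rw [hx'] at h1
        exact (thetaReplace_inc_inr.1 h1).2.2.1
      rcases mem_edgeSet.1 hn with ⟨σ, j, hj, rfl⟩ | ⟨j, h0, hj, hl, rfl⟩
      · exact hinc _ inner_hub (isLink_spoke hj).inc_left _ _ (hE e σ)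
      · have h1 := θ'.adj (isLink_hub_node (o := o) (m := m) (b := b) e.2 false h0 hj).adj
        rw [hE e false] at h1
        rcases adj_hub h1 with h | ⟨i, -, -, h⟩
        · have := θ'.toV_injective (Subtype.ext (h.trans (htip e false).symm))
          simp at this
        · exact hinc _ (inner_node h0) (isLink_cross h0 hj hl).inc_left _ _ h
    have h2 : (graph (m e) (b e)).edgeSet.ncard ≤ (graph (m (E e)) (b (E e))).edgeSet.ncard := by
      have : Finite (graph (m (E e)) (b (E e))).edgeSet := isFinite.2
      rw [← Nat.card_coe_set_eq, ← Nat.card_coe_set_eq]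
      refine Nat.card_le_card_of_injective (fun n : (graph (m e) (b e)).edgeSet =>
        (⟨(θ'.toE ⟨((e : β), (n : ℕ)), hmem n n.2⟩ : β × ℕ).2, by
          have := (thetaReplace_mem_edgeSet.1 (θ'.toE ⟨((e : β), (n : ℕ)), hmem n n.2⟩).2).2
          rwa [hfst n n.2] at this⟩ : (graph (m (E e)) (b (E e))).edgeSet)) ?_
      intro n k hnk
      have h1 := congrArg Subtype.val hnk
      have := θ'.toE_injective (Subtype.ext
        (Prod.ext ((hfst n n.2).trans (hfst k k.2).symm) h1))
      simp only [Subtype.mk.injEq, Prod.mk.injEq, true_and] at this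
      exact Subtype.ext this
    have h3 := hmG e e.2
    have h4 := hmH (E e) (E e).2
    rw [ncard_edgeSet (by omega), ncard_edgeSet (by omega)] at h2
    change m e + b e ≤ m (E e) + b (E e)
    omega

end Descent

/-! ### Inverting isomorphisms between mutual hybrid subgraphs -/

section

variable {α β α' : Type*} {G : Graph α β} {H : Graph α' β}

theorem SubIso.Fixes.subset {A : Set β} {θ : SubIso G H} (hθ : θ.Fixes A) :
    G.edgeSet ∩ A ⊆ H.edgeSet := fun e he => by
  have h : (θ.toE ⟨e, he.1⟩ : β) = e := hθ ⟨e, he.1⟩ he.2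
  exact h ▸ (θ.toE ⟨e, he.1⟩).2

/-- If each of two finite graphs is isomorphic to a subgraph of the other, then an isomorphism
to a subgraph is invertible. -/
theorem SubIso.exists_inverse {β' : Type*} {H : Graph α' β'} (θ : SubIso G H) (η : SubIso H G)
    (hG : G.IsFinite) (hH : H.IsFinite) : ∃ θ' : SubIso H G,
      (∀ v, θ'.toV (θ.toV v) = v) ∧ (∀ v, θ.toV (θ'.toV v) = v) ∧
      (∀ e, θ'.toE (θ.toE e) = e) ∧ ∀ e, θ.toE (θ'.toE e) = e := by
  have : Finite G.vertexSet := hG.1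
  have : Finite G.edgeSet := hG.2
  have : Finite H.vertexSet := hH.1
  have : Finite H.edgeSet := hH.2
  have hV : Function.Bijective θ.toV := (Nat.bijective_iff_injective_and_card _).2
    ⟨θ.toV_injective, (Nat.card_le_card_of_injective _ θ.toV_injective).antisymm
      (Nat.card_le_card_of_injective _ η.toV_injective)⟩
  have hE : Function.Bijective θ.toE := (Nat.bijective_iff_injective_and_card _).2
    ⟨θ.toE_injective, (Nat.card_le_card_of_injective _ θ.toE_injective).antisymm
      (Nat.card_le_card_of_injective _ η.toE_injective)⟩
  refine ⟨⟨(Equiv.ofBijective _ hV).symm, (Equiv.ofBijective _ hE).symm,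
    (Equiv.ofBijective _ hV).symm.injective, (Equiv.ofBijective _ hE).symm.injective,
    fun e x y h => ?_⟩, (Equiv.ofBijective _ hV).symm_apply_apply,
    (Equiv.ofBijective _ hV).apply_symm_apply, (Equiv.ofBijective _ hE).symm_apply_apply,
    (Equiv.ofBijective _ hE).apply_symm_apply⟩
  obtain ⟨e, rfl⟩ := hE.2 e
  obtain ⟨x, rfl⟩ := hV.2 x
  obtain ⟨y, rfl⟩ := hV.2 y
  rw [show (Equiv.ofBijective _ hE).symm (θ.toE e) = e from
      (Equiv.ofBijective _ hE).symm_apply_apply e,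
    show (Equiv.ofBijective _ hV).symm (θ.toV x) = x from
      (Equiv.ofBijective _ hV).symm_apply_apply x,
    show (Equiv.ofBijective _ hV).symm (θ.toV y) = y from
      (Equiv.ofBijective _ hV).symm_apply_apply y]
  obtain ⟨u, v, huv⟩ := exists_isLink_of_mem_edgeSet e.2
  rcases h.eq_and_eq_or_eq_and_eq (θ.isLink e ⟨u, huv.left_mem⟩ ⟨v, huv.right_mem⟩ huv) with
    ⟨h1, h2⟩ | ⟨h1, h2⟩
  · rw [θ.toV_injective (Subtype.ext h1), θ.toV_injective (Subtype.ext h2)]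
    exact huv
  · rw [θ.toV_injective (Subtype.ext h1), θ.toV_injective (Subtype.ext h2)]
    exact huv.symm

/-- When each graph is a hybrid subgraph of the other, the hybrid condition concerns one direction
only but the weak condition both. Since `θ` is bijective, no half-edge is skipped and the rotations
correspond step by step. The map `η` serves to bound the sizes and to show that strict edges of `H`
occur in `G`. -/
theorem SubIso.Induces.exists_inverse {A : Set β} {θ : SubIso G H}
    (hθ : θ.Fixes (G.edgeSet ∩ A)) {η : SubIso H G} (hη : η.Fixes (H.edgeSet ∩ A))
    (hG : G.IsFinite) (hH : H.IsFinite) {φ : G.PlanarEmbedding} {ψ : H.PlanarEmbedding}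
    (h : θ.Induces ψ φ) : ∃ θ' : SubIso H G, θ'.Fixes (H.edgeSet ∩ A) ∧ θ'.Induces φ ψ := by
  obtain ⟨θ', hV, hV', hE, hE'⟩ := θ.exists_inverse η hG hH
  have hf : ∀ f, θ'.flag (θ.flag f) = f := fun f => Subtype.ext (Prod.ext
    (congrArg Subtype.val (hV ⟨f.1.1, f.2.vertex_mem⟩))
    (congrArg Subtype.val (hE ⟨f.1.2, f.2.edge_mem⟩)))
  have hf' : ∀ f, θ.flag (θ'.flag f) = f := fun f => Subtype.ext (Prod.ext
    (congrArg Subtype.val (hV' ⟨f.1.1, f.2.vertex_mem⟩))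
    (congrArg Subtype.val (hE' ⟨f.1.2, f.2.edge_mem⟩)))
  refine ⟨θ', fun e he => ?_, fun g => ⟨1, one_pos, ?_, fun j h1 h2 => by omega⟩⟩
  · have heG : (e : β) ∈ G.edgeSet := hη.subset ⟨e.2, he⟩
    have h1 : θ.toE ⟨e, heG⟩ = e := Subtype.ext (hθ ⟨e, heG⟩ ⟨heG, he.2⟩)
    rw [← h1, hE, h1]
  · obtain ⟨k, h0, hk, hn⟩ := h (θ'.flag g)
    obtain rfl : k = 1 := by
      by_contra hk1
      exact hn 1 one_pos (by omega) ⟨_, hf' _⟩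
    rw [hf', pow_one] at hk
    rw [pow_one, hk, hf]

end

/-! ### The parameters of the gadgets -/

section

variable {α β : Type*} (S : Set β) (c : β → ℕ) (N : ℕ)

open Classical in
/-- The length of the gadget replacing `e`. -/
noncomputable def gadgetLength (e : β) : ℕ := if e ∈ S then 5 * N + 2 + c e else N + 2

open Classical in
/-- The number of cross edges at each end of the gadget replacing `e`. -/
noncomputable def gadgetWidth (e : β) : ℕ := if e ∈ S then 2 * (N - c e) else 0

variable {S c N} {G H : Graph α β} {o : G.EndOrder} {o' : H.EndOrder}

theorem gadgetOf_eq :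
    gadgetOf S c (gadget (N + 2) 0) (fun k => gadget (5 * N + 2 + k) (2 * (N - k))) =
      fun e => gadget (gadgetLength S c N e) (gadgetWidth S c N e) := by
  funext e
  unfold gadgetOf gadgetLength gadgetWidth
  split_ifs <;> rfl

/-- For a strict edge the difference `gadgetLength - 2 * gadgetWidth` is `N + 2 + 5 * c e`. The
bound makes room for the non-strict gadget, makes hubs recognisable by their degree and provides the
two short paths used in `exists_hub_image`. -/
theorem add_two_le_gadgetLength {e : β} (hc : e ∈ S → c e < N) :
    N + 2 + 2 * gadgetWidth S c N e ≤ gadgetLength S c N e := by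
  unfold gadgetLength gadgetWidth
  split_ifs with h
  · have := hc h
    omega
  · omega

theorem gadgetLength_le {e : β} (hc : e ∈ S → c e < N) : gadgetLength S c N e ≤ 6 * N + 2 := by
  unfold gadgetLength
  split_ifs with h
  · have := hc h
    omega
  · omega

theorem gadgetLength_pos (e : β) : 0 < gadgetLength S c N e := by
  unfold gadgetLength
  split_ifs <;> omega

-- A strict edge keeps its label and hence its gadget. A non-strict one may land on a strict edge,
-- and then its gadget is shifted past the initial long paths.
open Classical in
theorem SubIso.Fixes.fits {θ : SubIso G H} (hθ : θ.Fixes (G.edgeSet ∩ S))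
    (hc : ∀ e ∈ H.edgeSet, e ∈ S → c e < N) (e : G.edgeSet) :
    Fits (gadgetLength S c N e) (gadgetWidth S c N e) (gadgetLength S c N (θ.toE e))
      (gadgetWidth S c N (θ.toE e)) (if (e : β) ∈ S then 0 else gadgetWidth S c N (θ.toE e)) := by
  by_cases he : (e : β) ∈ S
  · rw [hθ e ⟨e.2, he⟩, if_pos he]
    exact Or.inl ⟨rfl, rfl, rfl⟩
  · rw [if_neg he]
    have h := add_two_le_gadgetLength (hc _ (θ.toE e).2)
    refine Or.inr ⟨if_neg he, rfl, ?_⟩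
    rwa [show gadgetLength S c N e = N + 2 from if_neg he]

theorem IsHybridSubgraph.isWeakSubgraph (h : IsHybridSubgraph (G.edgeSet ∩ S) G H)
    (hc : ∀ e ∈ H.edgeSet, e ∈ S → c e < N) :
    IsWeakSubgraph (thetaReplace o (gadgetLength S c N) (gadgetWidth S c N))
      (thetaReplace o' (gadgetLength S c N) (gadgetWidth S c N)) :=
  let ⟨_, θ, hθ⟩ := h
  ⟨θ.lift o o' _ _ _ (hθ.fits hc)⟩

/-- A strict edge cannot go to a non-strict one, since `5 * N + 2 + c e > N + 2`. Between strict
edges the length gives that `c` does not decrease and the sum `7 * N + 2 - c` that it does not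
increase; injectivity of `c` then gives equal labels. -/
theorem SubIso.exists_fixes_descent (hG : G.IsTwoConnected) (hH : H.IsTwoConnected)
    (hHfin : H.IsFinite) (hN : H.edgeSet.ncard ≤ N) (hc : ∀ e ∈ G.edgeSet, e ∈ S → c e < N)
    (hc' : ∀ e ∈ H.edgeSet, e ∈ S → c e < N) (hinj : Set.InjOn c (S ∩ (G.edgeSet ∪ H.edgeSet)))
    (θ' : SubIso (thetaReplace o (gadgetLength S c N) (gadgetWidth S c N))
      (thetaReplace o' (gadgetLength S c N) (gadgetWidth S c N))) :
    ∃ θ : SubIso G H, θ.Fixes (G.edgeSet ∩ S) ∧ ∀ f, θ'.flag (outerFlag o _ _ f) =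
      outerFlag o' _ _ (θ.flag f) := by
  obtain ⟨θ, hf, hle⟩ := exists_descent hG hH hHfin
    (thetaReplace_isFinite hHfin fun e he => gadgetLength_le (hc' e he)) hN
    (fun e he => add_two_le_gadgetLength (hc e he))
    (fun e he => add_two_le_gadgetLength (hc' e he)) θ'
  refine ⟨θ, fun e he => ?_, hf⟩
  have h := hle e
  have h1 := hc e e.2 he.2
  have h2 := hc' _ (θ.toE e).2
  have h3 : (θ.toE e : β) ∈ S := by
    by_contra hn
    have := h.1
    rw [gadgetLength, gadgetLength, if_pos he.2, if_neg hn] at this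
    omega
  have h4 := h2 h3
  rw [gadgetLength, gadgetLength, gadgetWidth, gadgetWidth, if_pos he.2, if_pos h3, if_pos he.2,
    if_pos h3] at h
  exact hinj ⟨h3, Or.inr (θ.toE e).2⟩ ⟨he.2, Or.inl e.2⟩ (by omega)

theorem SubIso.Induces.of_outerFlag {m b : β → ℕ}
    {θ' : SubIso (thetaReplace o m b) (thetaReplace o' m b)} {θ : SubIso G H}
    (hf : ∀ f, θ'.flag (outerFlag o _ _ f) = outerFlag o' _ _ (θ.flag f))
    {φ : G.PlanarEmbedding} {ψ : H.PlanarEmbedding} {φ' : (thetaReplace o m b).PlanarEmbedding}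
    {ψ' : (thetaReplace o' m b).PlanarEmbedding}
    (hφ : ∀ f, φ'.rot (outerFlag o m b f) = outerFlag o m b (φ.rot f))
    (hψ : ∀ f, ψ'.rot (outerFlag o' m b f) = outerFlag o' m b (ψ.rot f))
    (h : θ'.Induces ψ' φ') : θ.Induces ψ φ := by
  intro f
  have hpow : ∀ k : ℕ, (ψ'.rot ^ k) (θ'.flag (outerFlag o m b f)) =
      outerFlag o' m b ((ψ.rot ^ k) (θ.flag f)) := fun k => by
    rw [hf]
    exact pow_comm_of_forall (fun _ => True) (fun _ _ => trivial) (fun x _ => hψ x) trivial k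
  obtain ⟨k, h0, hk, hn⟩ := h (outerFlag o m b f)
  refine ⟨k, h0, outerFlag_injective (o := o') (m := m) (b := b) ?_, ?_⟩
  · rw [← hpow, hk, hφ, hf]
  · rintro j h1 h2 ⟨g, hg⟩
    refine hn j h1 h2 ⟨outerFlag o m b g, ?_⟩
    rw [hpow, hf, hg]

end

/-! ### Equivalence of the two embedding problems -/

section

variable {α β : Type*} {n : ℕ} {S : Set β} {c : β → ℕ} {N : ℕ} {G : Fin n → Graph α β}
  {o : ∀ i, (G i).EndOrder}

/-- The weak condition applies whenever a weak relation holds between new graphs. Each such relation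
descends to a hybrid one, so the hybrid condition supplies an inducing isomorphism that can be
lifted. -/
theorem exists_weak_of_hybrid (hfin : ∀ i, (G i).IsFinite) (hG : ∀ i, (G i).IsTwoConnected)
    (hN : ∀ i, (G i).edgeSet.ncard ≤ N) (hc : ∀ i, ∀ e ∈ (G i).edgeSet, e ∈ S → c e < N)
    (hinj : ∀ i j, Set.InjOn c (S ∩ ((G i).edgeSet ∪ (G j).edgeSet)))
    {φ : ∀ i, (G i).PlanarEmbedding} (hφ : IsHybridSimultaneousEmbedding S G φ) :
    ∃ φ' : ∀ i, (thetaReplace (o i) (gadgetLength S c N) (gadgetWidth S c N)).PlanarEmbedding,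
      IsWeakSimultaneousEmbedding _ φ' := by
  choose φ' hφ' using fun i => exists_lift (o := o i) (m := gadgetLength S c N)
    (b := gadgetWidth S c N) (hG i) (hfin i)
    (thetaReplace_isFinite (hfin i) fun e he => gadgetLength_le (hc i e he))
    (fun e _ => gadgetLength_pos e) (φ i)
  have hlift : ∀ i j, ∀ θ : SubIso (G i) (G j), θ.Fixes ((G i).edgeSet ∩ S) →
      θ.Induces (φ j) (φ i) → ∃ θ' : SubIso (thetaReplace (o i) (gadgetLength S c N)
        (gadgetWidth S c N)) (thetaReplace (o j) (gadgetLength S c N) (gadgetWidth S c N)),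
        θ'.Induces (φ' j) (φ' i) := fun i j θ hθ h =>
    ⟨_, lift_induces θ (hθ.fits (hc j)) (hG i).loopless (hG j).loopless
      (fun e _ => gadgetLength_pos e) (fun e _ => gadgetLength_pos e) (hφ' i) (hφ' j) h⟩
  refine ⟨φ', fun i j hij => ⟨fun ⟨η⟩ => ?_, fun ⟨η⟩ => ?_⟩⟩
  · obtain ⟨θ, hθ, -⟩ := η.exists_fixes_descent (hG i) (hG j) (hfin j) (hN j) (hc i) (hc j)
      (hinj i j)
    obtain ⟨θ, hθ, h⟩ := (hφ i j hij).1 ⟨Set.inter_subset_left, θ, hθ⟩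
    exact hlift i j θ hθ h
  · obtain ⟨η, hη, -⟩ := η.exists_fixes_descent (hG j) (hG i) (hfin i) (hN i) (hc j) (hc i)
      (hinj j i)
    -- If the reverse relation also holds, the hybrid condition speaks only about that one, and its
    -- isomorphism has to be inverted.
    by_cases hs : IsHybridSubgraph ((G i).edgeSet ∩ S) (G i) (G j)
    · obtain ⟨θ, hθ, h⟩ := (hφ i j hij).1 hs
      obtain ⟨θ, hθ, h⟩ := h.exists_inverse hθ hη (hfin i) (hfin j)
      exact hlift j i θ hθ h
    · obtain ⟨θ, hθ, h⟩ := (hφ i j hij).2 hs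
      exact hlift j i θ hθ h

theorem exists_hybrid_of_weak (hfin : ∀ i, (G i).IsFinite) (hG : ∀ i, (G i).IsTwoConnected)
    (hN : ∀ i, (G i).edgeSet.ncard ≤ N) (hc : ∀ i, ∀ e ∈ (G i).edgeSet, e ∈ S → c e < N)
    (hinj : ∀ i j, Set.InjOn c (S ∩ ((G i).edgeSet ∪ (G j).edgeSet)))
    (hS : IsHybridDeletionSequence S G)
    {φ' : ∀ i, (thetaReplace (o i) (gadgetLength S c N) (gadgetWidth S c N)).PlanarEmbedding}
    (hφ' : IsWeakSimultaneousEmbedding _ φ') :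
    ∃ φ : ∀ i, (G i).PlanarEmbedding, IsHybridSimultaneousEmbedding S G φ := by
  choose φ hφ using fun i => exists_restriction (hG i) (hfin i)
    (thetaReplace_isFinite (hfin i) fun e he => gadgetLength_le (hc i e he))
    (fun e he => by have := add_two_le_gadgetLength (hc i e he); omega) (φ' i)
  have hdesc : ∀ i j, ∀ θ' : SubIso (thetaReplace (o i) (gadgetLength S c N)
        (gadgetWidth S c N)) (thetaReplace (o j) (gadgetLength S c N) (gadgetWidth S c N)),
      θ'.Induces (φ' j) (φ' i) →
      ∃ θ : SubIso (G i) (G j), θ.Fixes ((G i).edgeSet ∩ S) ∧ θ.Induces (φ j) (φ i) := by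
    intro i j θ' h
    obtain ⟨θ, hθ, hf⟩ := θ'.exists_fixes_descent (hG i) (hG j) (hfin j) (hN j) (hc i) (hc j)
      (hinj i j)
    exact ⟨θ, hθ, h.of_outerFlag hf (hφ i) (hφ j)⟩
  refine ⟨φ, fun i j hij => ⟨fun hs => ?_, fun hs => ?_⟩⟩
  · obtain ⟨θ, h⟩ := (hφ' i j hij).1 (hs.isWeakSubgraph (hc j))
    exact hdesc i j θ h
  -- Without the first relation, the definition of a hybrid deletion sequence yields the reverse
  -- one.
  · obtain ⟨θ, h⟩ := (hφ' i j hij).2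
      (((hS i j hij).resolve_left hs).isWeakSubgraph (hc i))
    exact hdesc j i θ h

theorem seqSize_thetaReplace_le (hfin : ∀ i, (G i).IsFinite)
    (hc : ∀ i, ∀ e ∈ (G i).edgeSet, e ∈ S → c e < N) :
    seqSize (fun i => thetaReplace (o i) (gadgetLength S c N) (gadgetWidth S c N)) ≤
      seqSize G * (30 * N + 17) := by
  unfold seqSize
  rw [Finset.sum_mul]
  refine Finset.sum_le_sum fun i _ => ?_
  refine (thetaReplace_size_le (hfin i) fun e he => gadgetLength_le (hc i e he)).trans ?_
  rw [add_mul]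
  -- The factor `30 * N + 17` is `5 * C + 7` with the bound `C = 6 * N + 2` on the lengths.
  refine Nat.add_le_add (Nat.le_mul_of_pos_right _ (by omega)) (Nat.mul_le_mul_left _ (by omega))

end

theorem IsTwoConnected.exists_endOrder {α β : Type*} {G : Graph α β} (hG : G.IsTwoConnected) :
    Nonempty G.EndOrder := by
  obtain ⟨v, -⟩ := hG.connected.1
  have h : ∀ e, ∃ p : α × α, e ∈ G.edgeSet → G.IsLink e p.1 p.2 := fun e => by
    by_cases he : e ∈ G.edgeSet
    · obtain ⟨x, y, h⟩ := exists_isLink_of_mem_edgeSet he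
      exact ⟨(x, y), fun _ => h⟩
    · exact ⟨(v, v), fun h => (he h).elim⟩
  choose p hp using h
  exact ⟨⟨fun e => (p e).1, fun e => (p e).2, hp⟩⟩

end Graph

/-! ### The main theorem -/

theorem mainTheorem5 :
    ∃ (p : Polynomial ℕ) (Q₀ : ℕ → Graph.Gadget) (Q : ℕ → ℕ → Graph.Gadget),
      (∀ N, (Q₀ N).graph.IsPlanar ∧ (∀ k < N, (Q N k).graph.IsPlanar) ∧
        ∀ k < N, ∀ l < N, k ≠ l → ¬ Graph.IsWeakSubgraph (Q N k).graph (Q N l).graph) ∧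
      ∀ (α β : Type*) (n : ℕ) (S : Set β) (G : Fin n → Graph α β),
        (∀ i, (G i).IsFinite) → (∀ i, (G i).IsTwoConnected) →
        Graph.IsHybridDeletionSequence S G →
        ∀ c : β → ℕ, Set.InjOn c (S ∩ ⋃ i, (G i).edgeSet) →
          (∀ e ∈ S ∩ ⋃ i, (G i).edgeSet, c e < Graph.seqSize G) →
          ∃ G' : Fin n → Graph (α ⊕ (β × ℕ)) (β × ℕ),
            (∀ i, Graph.IsGadgetReplacement
              (Graph.gadgetOf S c (Q₀ (Graph.seqSize G)) (Q (Graph.seqSize G))) (G i) (G' i)) ∧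
            (∀ i, (G' i).IsFinite ∧ (G' i).Simple ∧ (G' i).IsTwoConnected) ∧
            Graph.IsWeakDeletionSequence G' ∧
            ((∃ φ : ∀ i, (G i).PlanarEmbedding, Graph.IsHybridSimultaneousEmbedding S G φ) ↔
              ∃ φ' : ∀ i, (G' i).PlanarEmbedding, Graph.IsWeakSimultaneousEmbedding G' φ') ∧
            Graph.seqSize G' ≤ p.eval (Graph.seqSize G) := by
  refine ⟨Polynomial.X * (30 * Polynomial.X + 17), fun N => Graph.Theta.gadget (N + 2) 0,
    fun N k => Graph.Theta.gadget (5 * N + 2 + k) (2 * (N - k)), fun N =>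
      ⟨⟨Graph.Theta.embedding _ (by omega)⟩, fun k _ => ⟨Graph.Theta.embedding _ (by omega)⟩, ?_⟩,
      ?_⟩
  · rintro k hk l hl hkl ⟨θ⟩
    -- Hub degrees give `k ≤ l`; the sums `7 * N + 2 - k` and `7 * N + 2 - l` give `l ≤ k`. The
    -- truncated subtraction `N - k` is harmless since `k < N`.
    have h1 := Graph.Theta.le_of_subIso θ (by omega)
    have h2 := Graph.Theta.add_le_of_subIso θ (by omega) (by omega)
    omega
  · intro α β n S G hfin hG hS c hinj hc
    have hN : ∀ i, (G i).edgeSet.ncard ≤ Graph.seqSize G := fun i =>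
      (Nat.le_add_left _ _).trans (Finset.single_le_sum
        (f := fun i => (G i).vertexSet.ncard + (G i).edgeSet.ncard) (fun _ _ => Nat.zero_le _)
        (Finset.mem_univ i))
    replace hc : ∀ i, ∀ e ∈ (G i).edgeSet, e ∈ S → c e < Graph.seqSize G := fun i e he heS =>
      hc e ⟨heS, Set.mem_iUnion_of_mem i he⟩
    replace hinj : ∀ i j, Set.InjOn c (S ∩ ((G i).edgeSet ∪ (G j).edgeSet)) := fun i j =>
      hinj.mono (Set.inter_subset_inter_right _ (Set.union_subset
        (Set.subset_iUnion (fun i => (G i).edgeSet) i)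
        (Set.subset_iUnion (fun i => (G i).edgeSet) j)))
    have o : ∀ i, (G i).EndOrder := fun i => (hG i).exists_endOrder.some
    refine ⟨fun i => Graph.thetaReplace (o i) _ _, fun i => ⟨o i, by rw [Graph.gadgetOf_eq]; rfl⟩,
      fun i => ⟨Graph.thetaReplace_isFinite (hfin i) fun e he => Graph.gadgetLength_le (hc i e he),
        Graph.thetaReplace_simple (hG i).loopless,
        Graph.thetaReplace_isTwoConnected (hG i) fun e _ => Graph.gadgetLength_pos e⟩,
      fun i j hij => (hS i j hij).imp (fun h => h.isWeakSubgraph (hc j))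
        fun h => h.isWeakSubgraph (hc i),
      ⟨fun ⟨φ, hφ⟩ => Graph.exists_weak_of_hybrid hfin hG hN hc hinj hφ,
        fun ⟨φ', hφ'⟩ => Graph.exists_hybrid_of_weak hfin hG hN hc hinj hS hφ'⟩, ?_⟩
    refine (Graph.seqSize_thetaReplace_le hfin hc).trans ?_
    simp
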